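/- Let $q:\mathbb R\times\mathbb R\to\mathbb C$, $(x,t)\mapsto q(x,t)$, be a $C^3$ solution of the third-order flow equation of the Kaup--Newell system (TOFKN) $$q_t+q_{xxx}-3\mathrm i(|q|^2q_x)_x-\tfrac32(|q|^4q)_x=0$$ with zero boundary conditions: $q,q_x,q_{xx}\to0$ as $x\to\pm\infty$ locally uniformly in $t$, and $q(\cdot,t),q_x(\cdot,t)\in L^1(\mathbb R)$ for every $t$. Put $\theta(\lambda;x,t)=\lambda^2(x+4\lambda^4t)$, $\sigma_3=\mathrm{diag}(1,-1)$, $X=\lambda(\mathrm i\lambda\sigma_3+Q)$ with $Q=\begin{pmatrix}0&q\\-q^*&0\end{pmatrix}$, $\Sigma=\mathbb R\cup\mathrm i\mathbb R$, $D^{\pm}=\{\pm\mathrm{Re}\lambda\,\mathrm{Im}\lambda>0\}$. Let $\psi_\pm=(\psi_{\pm1},\psi_{\pm2})$ be the Jost solutions: $\psi_{\pm,x}=X\psi_\pm$, $\psi_\pm\sim \mathrm e^{\mathrm i\theta\sigma_3}$ as $x\to\pm\infty$ for $\lambda\in\Sigma$; the columns $\psi_{+1},\psi_{-2}$ extend analytically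 to $D^+$ and $\psi_{+2},\psi_{-1}$ to $D^-$. The scattering coefficients (independent of $x,t$) are $s_{11}=\det(\psi_{+1},\psi_{-2})$, $s_{12}=\det(\psi_{+2},\psi_{-2})$, $s_{21}=\det(\psi_{-1},\psi_{+1})$, $s_{22}=\det(\psi_{-1},\psi_{+2})$. Assume that $s_{11},s_{22}$ have no zeros on $\Sigma$, that the potential is reflectionless, i.e. $\rho=s_{21}/s_{11}=0$ and $\tilde\rho=s_{12}/s_{22}=0$ on $\Sigma$, and that the zeros of $s_{11}$ in the open first quadrant are exactly $N$ distinct points $\lambda_1,\dots,\lambda_N$, each of them triple. Put $\zeta_n=\lambda_n$, $\zeta_{N+n}=-\lambda_n$ for $1\le n\le N$. Then there are norming constants $b[\lambda_0],d[\lambda_0],h[\lambda_0]$, independent of $(x,t)$, for $\lambda_0\in\{\zeta_n,\zeta_n^*\}_{n=1}^{2N}$, such that for all $x,t$, with $'$ the derivative in $\lambda$ and all functions evaluated at $\lambda=\lambda_0$, $$\psi_{+1}=b\,\psi_{-2},\quad \psi_{+1}'-b\,\psi_{-2}'=d\,\psi_{-2},\quad \psi_{+1}''-b\,\psi_{-2}''-2d\,\psi_{-2}'=h\,\psi_{-2}\qquad(\lambda_0=\zeta_n),$$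 and the same relations with $(\psi_{+2},\psi_{-1})$ in place of $(\psi_{+1},\psi_{-2})$ for $\lambda_0=\zeta_n^*$. For any such constants define, with $s=s_{11}$ if $\lambda_0\in D^+$ and $s=s_{22}$ if $\lambda_0\in D^-$, $$\widetilde A=\frac{6b}{s'''},\qquad \widetilde B=\frac db-\frac{s''''}{4s'''},\qquad \widetilde C=\frac h{2b}-\frac{d\,s''''}{4b\,s'''}+\frac{(s'''')^2}{16(s''')^2}-\frac{s^{(5)}}{20\,s'''}\qquad\text{at }\lambda_0,$$ and, with $\theta,\theta',\theta''$ evaluated at $\zeta_n$ (resp. $\zeta_n^*$) in $C_n,D_n,F_n$ (resp. $\widehat C_n,\widehat D_n,\widehat F_n$), $$C_n(\lambda)=\frac{\widetilde A[\zeta_n]}{\lambda-\zeta_n}\mathrm e^{-2\mathrm i\theta},\quad D_n=\widetilde B[\zeta_n]-2\mathrm i\theta',\quad F_n=\widetilde C[\zeta_n]-2\theta'^2-\mathrm i\theta''-2\mathrm i\theta'\widetilde B[\zeta_n],$$ $$\widehat C_n(\lambda)=\frac{\widetilde A[\zeta_n^*]}{\lambda-\zeta_n^*}\mathrm e^{2\mathrm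 i\theta},\quad \widehat D_n=\widetilde B[\zeta_n^*]+2\mathrm i\theta',\quad \widehat F_n=\widetilde C[\zeta_n^*]-2\theta'^2+\mathrm i\theta''+2\mathrm i\theta'\widetilde B[\zeta_n^*].$$ Let $G=(G^{(i,k)})_{i,k=1,2,3}$ be the $6N\times6N$ matrix with $2N\times2N$ blocks $G^{(i,k)}=(g^{(i,k)}_{n,j})$, $$g^{(i,k)}_{n,j}=\kappa_i\sum_{s=1}^{2N}\frac{C_s(\zeta_n^*)\widehat C_j(\zeta_s)}{u^{i-1}}\Big[\frac{1}{v^2}H_k^{(3)}-\frac1v\Big(D_s+\frac iu\Big)H_k^{(2)}+\Big(\frac{c_i}{u^2}+\frac{iD_s}{u}+F_s\Big)H_k^{(1)}\Big],$$ where $i$ denotes the block index, $u=\zeta_n^*-\zeta_s$, $v=\zeta_s-\zeta_j^*$, $(\kappa_1,\kappa_2,\kappa_3)=(1,-1,2)$, $(c_1,c_2,c_3)=(1,3,6)$, and for $m=1,2,3$ $$H_1^{(m)}=\frac{c_m}{v^2}+\frac{m\widehat D_j}{v}+\widehat F_j,\qquad H_2^{(m)}=\widehat D_j+\frac mv,\qquad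 H_3^{(m)}=\frac12 .$$ Let $\alpha=(\alpha^{(1)},\alpha^{(2)},\alpha^{(3)})$ be the row vector with $\alpha^{(1)}_n=\widetilde A[\zeta_n^*]\mathrm e^{2\mathrm i\theta(\zeta_n^*)}\widehat F_n$, $\alpha^{(2)}_n=\widetilde A[\zeta_n^*]\mathrm e^{2\mathrm i\theta(\zeta_n^*)}\widehat D_n$, $\alpha^{(3)}_n=\frac12\widetilde A[\zeta_n^*]\mathrm e^{2\mathrm i\theta(\zeta_n^*)}$ $(1\le n\le 2N)$, let $\tau$ be the column vector with $2N$ ones followed by $4N$ zeros, and $R=\begin{pmatrix}0&\alpha\\ \tau&I-G\end{pmatrix}$. Then for all $x,t\in\mathbb R$ one has $\det(I-G)\ne0$ and $$q(x,t)=2\mathrm i\,\mathrm e^{2\mathrm i\nu_-(x,t)}\,\frac{\det R}{\det(I-G)},\qquad \nu_-(x,t)=\frac12\int_{-\infty}^x|q(y,t)|^2\,dy .$$ -/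

import Mathlib

open Filter Topology Complex MeasureTheory
open scoped ComplexConjugate

noncomputable section

namespace TOFKN

/-! ### The equation and its Lax operator -/

/-- `q x t` is a classical solution on the whole `(x,t)`-plane of the third-order flow equation
`q_t + q_xxx - 3i (|q|^2 q_x)_x - (3/2) (|q|^4 q)_x = 0`
of the Kaup-Newell system, with zero boundary conditions: `q`, `q_x`, `q_xx` tend to `0` as
`x → ±∞`, locally uniformly in `t`, and `q(·,t)`, `q_x(·,t)` are in `L^1(ℝ)` for each `t`. -/
structure IsDecayingSolution (q : ℝ → ℝ → ℂ) : Prop where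
  contDiff : ContDiff ℝ 3 (fun p : ℝ × ℝ => q p.1 p.2)
  equation : ∀ x t : ℝ,
    deriv (fun s => q x s) t + iteratedDeriv 3 (fun y => q y t) x
      - 3 * I * deriv (fun y => (‖q y t‖ : ℂ) ^ 2 * deriv (fun w => q w t) y) x
      - 3 / 2 * deriv (fun y => (‖q y t‖ : ℂ) ^ 4 * q y t) x = 0
  tendsto_zero : ∀ k : ℕ, k ≤ 2 → ∀ t₀ : ℝ,
    Tendsto (fun p : ℝ × ℝ => iteratedDeriv k (fun y => q y p.2) p.1)
      (cocompact ℝ ×ˢ 𝓝 t₀) (𝓝 0)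
  integrable : ∀ t : ℝ, Integrable (fun x => q x t)
  integrable_deriv : ∀ t : ℝ, Integrable (fun x => deriv (fun y => q y t) x)

/-- The Pauli matrix `σ₃`. -/
def sigma3 : Matrix (Fin 2) (Fin 2) ℂ := !![1, 0; 0, -1]

/-- The potential matrix `Q`. -/
def potential (q : ℝ → ℝ → ℂ) (x t : ℝ) : Matrix (Fin 2) (Fin 2) ℂ :=
  !![0, q x t; -conj (q x t), 0]

/-- `X = λ (i λ σ₃ + Q)`, the coefficient matrix of the spectral problem `Ψ_x = X Ψ`. -/
def laxX (q : ℝ → ℝ → ℂ) (l : ℂ) (x t : ℝ) : Matrix (Fin 2) (Fin 2) ℂ :=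
  l • ((I * l) • sigma3 + potential q x t)

/-- `θ(λ; x, t) = λ² (x + 4 λ⁴ t)`. -/
def theta (l : ℂ) (x t : ℝ) : ℂ := l ^ 2 * (x + 4 * l ^ 4 * t)

/-- `θ'`, the derivative in `λ`. -/
def theta1 (l : ℂ) (x t : ℝ) : ℂ := deriv (fun w => theta w x t) l

/-- `θ''`, the second derivative in `λ`. -/
def theta2 (l : ℂ) (x t : ℝ) : ℂ := iteratedDeriv 2 (fun w => theta w x t) l

/-- `ν₋(x,t) = ½ ∫_{-∞}^x |q(y,t)|² dy`. -/
def nuMinus (q : ℝ → ℝ → ℂ) (x t : ℝ) : ℝ := 1 / 2 * ∫ y in Set.Iic x, ‖q y t‖ ^ 2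

/-- The contour `Σ = ℝ ∪ iℝ`. -/
def contour : Set ℂ := {l | l.im = 0 ∨ l.re = 0}

/-- `D⁺ = {Re λ Im λ > 0}`. -/
def Dplus : Set ℂ := {l | 0 < l.re * l.im}

/-! ### Jost solutions and scattering coefficients -/

/-- `f` solves `f_x = X f` and is asymptotic to the `j`-th column of `e^{iθσ₃}` along the filter
`F` (which is `x → +∞` or `x → -∞`): `e^{∓iθ} f → e_j`.

On `Σ ∪ D⁺` this determines `ψ₊₁` and `ψ₋₂` uniquely, and on `Σ ∪ D⁻` it determines `ψ₊₂` and `ψ₋₁`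
uniquely; there it describes the Jost columns on `Σ` together with their analytic extensions. -/
def IsJostColumn (q : ℝ → ℝ → ℂ) (F : Filter ℝ) (j : Fin 2) (l : ℂ) (t : ℝ)
    (f : ℝ → Fin 2 → ℂ) : Prop :=
  (∀ x : ℝ, HasDerivAt f ((laxX q l x t).mulVec (f x)) x) ∧
    Tendsto (fun x : ℝ => exp (-(I * theta l x t * sigma3 j j)) • f x) F
      (𝓝 (Pi.single j (1 : ℂ)))

open Classical in
/-- The Jost column characterised by `IsJostColumn`. -/
def jost (q : ℝ → ℝ → ℂ) (F : Filter ℝ) (j : Fin 2) (l : ℂ) (x t : ℝ) : Fin 2 → ℂ :=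
  Classical.epsilon (fun f : ℝ → Fin 2 → ℂ => IsJostColumn q F j l t f) x

/-- `ψ₊₁`. -/
def psiPlus1 (q : ℝ → ℝ → ℂ) (l : ℂ) (x t : ℝ) : Fin 2 → ℂ := jost q atTop 0 l x t
/-- `ψ₊₂`. -/
def psiPlus2 (q : ℝ → ℝ → ℂ) (l : ℂ) (x t : ℝ) : Fin 2 → ℂ := jost q atTop 1 l x t
/-- `ψ₋₁`. -/
def psiMinus1 (q : ℝ → ℝ → ℂ) (l : ℂ) (x t : ℝ) : Fin 2 → ℂ := jost q atBot 0 l x t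
/-- `ψ₋₂`. -/
def psiMinus2 (q : ℝ → ℝ → ℂ) (l : ℂ) (x t : ℝ) : Fin 2 → ℂ := jost q atBot 1 l x t

/-- The determinant of the matrix with columns `u`, `v`. -/
def detCols (u v : Fin 2 → ℂ) : ℂ := (Matrix.of ![u, v]).transpose.det

/-! The scattering coefficients of `ψ₊ = ψ₋ S`. They do not depend on `(x,t)`, and are evaluated
here at `(x,t) = (0,0)`. -/

/-- `s₁₁ = det(ψ₊₁, ψ₋₂)`, on `Σ ∪ D⁺`. -/
def s11 (q : ℝ → ℝ → ℂ) (l : ℂ) : ℂ := detCols (psiPlus1 q l 0 0) (psiMinus2 q l 0 0)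
/-- `s₁₂ = det(ψ₊₂, ψ₋₂)`, on `Σ`. -/
def s12 (q : ℝ → ℝ → ℂ) (l : ℂ) : ℂ := detCols (psiPlus2 q l 0 0) (psiMinus2 q l 0 0)
/-- `s₂₁ = det(ψ₋₁, ψ₊₁)`, on `Σ`. -/
def s21 (q : ℝ → ℝ → ℂ) (l : ℂ) : ℂ := detCols (psiMinus1 q l 0 0) (psiPlus1 q l 0 0)
/-- `s₂₂ = det(ψ₋₁, ψ₊₂)`, on `Σ ∪ D⁻`. -/
def s22 (q : ℝ → ℝ → ℂ) (l : ℂ) : ℂ := detCols (psiMinus1 q l 0 0) (psiPlus2 q l 0 0)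

/-- No spectral singularities: `s₁₁` and `s₂₂` have no zeros on `Σ`. -/
def NoSpectralSingularity (q : ℝ → ℝ → ℂ) : Prop :=
  ∀ l ∈ contour, s11 q l ≠ 0 ∧ s22 q l ≠ 0

/-- Reflectionless: `ρ = s₂₁/s₁₁` and `ρ̃ = s₁₂/s₂₂` vanish on `Σ`. -/
def Reflectionless (q : ℝ → ℝ → ℂ) : Prop :=
  ∀ l ∈ contour, s21 q l / s11 q l = 0 ∧ s12 q l / s22 q l = 0

/-- The zeros of `s₁₁` in the open first quadrant are exactly the `N` distinct points
`λ_1, …, λ_N`, and each of them is a triple zero. -/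
structure HasTripleZeros {N : ℕ} (q : ℝ → ℝ → ℂ) (lam : Fin N → ℂ) : Prop where
  injective : Function.Injective lam
  re_pos : ∀ n, 0 < (lam n).re
  im_pos : ∀ n, 0 < (lam n).im
  zero_iff : ∀ l : ℂ, 0 < l.re → 0 < l.im → (s11 q l = 0 ↔ ∃ n, l = lam n)
  deriv_one : ∀ n, iteratedDeriv 1 (s11 q) (lam n) = 0
  deriv_two : ∀ n, iteratedDeriv 2 (s11 q) (lam n) = 0
  deriv_three : ∀ n, iteratedDeriv 3 (s11 q) (lam n) ≠ 0

/-- The points `ζ_n`: `ζ_n = λ_n` and `ζ_{N+n} = -λ_n` for `n = 1, …, N`. The index set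
`{1, …, 2N}` is represented by `Fin N ⊕ Fin N`. -/
def zeta {N : ℕ} (lam : Fin N → ℂ) : Fin N ⊕ Fin N → ℂ :=
  Sum.elim lam (fun n => -lam n)

/-! ### Norming constants and the constants `Ã`, `B̃`, `C̃` -/

/-- `b[λ₀]`, `d[λ₀]`, `h[λ₀]` are the norming constants at the points `λ₀ = ζ_n` and `λ₀ = ζ_n^*`.
They do not depend on `(x,t)`. Derivatives are in the spectral parameter. -/
structure IsNorming {N : ℕ} (q : ℝ → ℝ → ℂ) (lam : Fin N → ℂ) (b d h : ℂ → ℂ) : Prop where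
  b_plus : ∀ n x t, ∀ l₀ : ℂ, l₀ = zeta lam n →
    psiPlus1 q l₀ x t = b l₀ • psiMinus2 q l₀ x t
  b_minus : ∀ n x t, ∀ l₀ : ℂ, l₀ = conj (zeta lam n) →
    psiPlus2 q l₀ x t = b l₀ • psiMinus1 q l₀ x t
  d_plus : ∀ n x t, ∀ l₀ : ℂ, l₀ = zeta lam n →
    iteratedDeriv 1 (fun l => psiPlus1 q l x t) l₀
        - b l₀ • iteratedDeriv 1 (fun l => psiMinus2 q l x t) l₀
      = d l₀ • psiMinus2 q l₀ x t
  d_minus : ∀ n x t, ∀ l₀ : ℂ, l₀ = conj (zeta lam n) →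
    iteratedDeriv 1 (fun l => psiPlus2 q l x t) l₀
        - b l₀ • iteratedDeriv 1 (fun l => psiMinus1 q l x t) l₀
      = d l₀ • psiMinus1 q l₀ x t
  h_plus : ∀ n x t, ∀ l₀ : ℂ, l₀ = zeta lam n →
    iteratedDeriv 2 (fun l => psiPlus1 q l x t) l₀
        - b l₀ • iteratedDeriv 2 (fun l => psiMinus2 q l x t) l₀
        - (2 * d l₀) • iteratedDeriv 1 (fun l => psiMinus2 q l x t) l₀
      = h l₀ • psiMinus2 q l₀ x t
  h_minus : ∀ n x t, ∀ l₀ : ℂ, l₀ = conj (zeta lam n) →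
    iteratedDeriv 2 (fun l => psiPlus2 q l x t) l₀
        - b l₀ • iteratedDeriv 2 (fun l => psiMinus1 q l x t) l₀
        - (2 * d l₀) • iteratedDeriv 1 (fun l => psiMinus1 q l x t) l₀
      = h l₀ • psiMinus1 q l₀ x t

open Classical in
/-- The `k`-th derivative at `λ₀` of `s₁₁` if `λ₀ ∈ D⁺`, and of `s₂₂` otherwise. -/
def sDer (q : ℝ → ℝ → ℂ) (k : ℕ) (l₀ : ℂ) : ℂ :=
  if l₀ ∈ Dplus then iteratedDeriv k (s11 q) l₀ else iteratedDeriv k (s22 q) l₀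

/-- `Ã[λ₀]`. -/
def tA (q : ℝ → ℝ → ℂ) (b : ℂ → ℂ) (l₀ : ℂ) : ℂ := 6 * b l₀ / sDer q 3 l₀

/-- `B̃[λ₀]`. -/
def tB (q : ℝ → ℝ → ℂ) (b d : ℂ → ℂ) (l₀ : ℂ) : ℂ :=
  d l₀ / b l₀ - sDer q 4 l₀ / (4 * sDer q 3 l₀)

/-- `C̃[λ₀]`. With this value the coefficient of `(λ - λ₀)⁻¹` in the Laurent expansion of `ψ₊₁/s₁₁`
(resp. `ψ₊₂/s₂₂`) is `Ã (½ ψ'' + B̃ ψ' + C̃ ψ)` with `ψ = ψ₋₂` (resp. `ψ₋₁`), evaluated at `λ₀`. -/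
def tC (q : ℝ → ℝ → ℂ) (b d h : ℂ → ℂ) (l₀ : ℂ) : ℂ :=
  h l₀ / (2 * b l₀) - d l₀ * sDer q 4 l₀ / (4 * b l₀ * sDer q 3 l₀)
    + sDer q 4 l₀ ^ 2 / (16 * sDer q 3 l₀ ^ 2) - sDer q 5 l₀ / (20 * sDer q 3 l₀)

/-! ### The matrices `G` and `R`

Here `A B C` are the functions `Ã`, `B̃`, `C̃` on the discrete spectrum, and `z n = ζ_n`. -/

section Matrices

variable {ι : Type} (A B C : ℂ → ℂ) (z : ι → ℂ) (x t : ℝ)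

/-- `C_n(λ)`. -/
def cF (n : ι) (l : ℂ) : ℂ := A (z n) / (l - z n) * exp (-2 * I * theta (z n) x t)

/-- `Ĉ_n(λ)`. -/
def cHat (n : ι) (l : ℂ) : ℂ :=
  A (conj (z n)) / (l - conj (z n)) * exp (2 * I * theta (conj (z n)) x t)

/-- `D_n`. -/
def dF (n : ι) : ℂ := B (z n) - 2 * I * theta1 (z n) x t

/-- `D̂_n`. -/
def dHat (n : ι) : ℂ := B (conj (z n)) + 2 * I * theta1 (conj (z n)) x t

/-- `F_n`. -/
def fF (n : ι) : ℂ :=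
  C (z n) - 2 * theta1 (z n) x t ^ 2 - I * theta2 (z n) x t
    - 2 * I * theta1 (z n) x t * B (z n)

/-- `F̂_n`. -/
def fHat (n : ι) : ℂ :=
  C (conj (z n)) - 2 * theta1 (conj (z n)) x t ^ 2 + I * theta2 (conj (z n)) x t
    + 2 * I * theta1 (conj (z n)) x t * B (conj (z n))

/-- The summand with index `s` of the entry `g^{(i,k)}_{n,j}`. -/
def gTerm (n j s : ι) : Matrix (Fin 3) (Fin 3) ℂ :=
  let CC := cF A z x t s (conj (z n)) * cHat A z x t j (z s)
  let u := conj (z n) - z s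
  let v := z s - conj (z j)
  let D := dF B z x t s
  let E := fF B C z x t s
  let Dh := dHat B z x t j
  let Fh := fHat B C z x t j
  !![ CC * (1 / v ^ 2 * (6 / v ^ 2 + 3 * Dh / v + Fh)
          - 1 / v * (D + 1 / u) * (3 / v ^ 2 + 2 * Dh / v + Fh)
          + (1 / u ^ 2 + D / u + E) * (1 / v ^ 2 + Dh / v + Fh)),
      CC * (1 / v ^ 2 * (Dh + 3 / v) - 1 / v * (D + 1 / u) * (Dh + 2 / v)
          + (1 / u ^ 2 + D / u + E) * (Dh + 1 / v)),
      CC / 2 * (1 / v ^ 2 - 1 / v * (D + 1 / u) + (1 / u ^ 2 + D / u + E));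
      -(CC / u) * (1 / v ^ 2 * (6 / v ^ 2 + 3 * Dh / v + Fh)
          - 1 / v * (D + 2 / u) * (3 / v ^ 2 + 2 * Dh / v + Fh)
          + (3 / u ^ 2 + 2 * D / u + E) * (1 / v ^ 2 + Dh / v + Fh)),
      -(CC / u) * (1 / v ^ 2 * (Dh + 3 / v) - 1 / v * (D + 2 / u) * (Dh + 2 / v)
          + (3 / u ^ 2 + 2 * D / u + E) * (Dh + 1 / v)),
      -(CC / (2 * u)) * (1 / v ^ 2 - 1 / v * (D + 2 / u) + (3 / u ^ 2 + 2 * D / u + E));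
      2 * CC / u ^ 2 * (1 / v ^ 2 * (6 / v ^ 2 + 3 * Dh / v + Fh)
          - 1 / v * (D + 3 / u) * (3 / v ^ 2 + 2 * Dh / v + Fh)
          + (6 / u ^ 2 + 3 * D / u + E) * (1 / v ^ 2 + Dh / v + Fh)),
      2 * CC / u ^ 2 * (1 / v ^ 2 * (Dh + 3 / v) - 1 / v * (D + 3 / u) * (Dh + 2 / v)
          + (6 / u ^ 2 + 3 * D / u + E) * (Dh + 1 / v)),
      CC / u ^ 2 * (1 / v ^ 2 - 1 / v * (D + 3 / u) + (6 / u ^ 2 + 3 * D / u + E)) ]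

/-- The `6N × 6N` matrix `G`; the index `(i, n)` is position `n` in block `i`. -/
def matG [Fintype ι] : Matrix (Fin 3 × ι) (Fin 3 × ι) ℂ :=
  Matrix.of fun p r => ∑ s, gTerm A B C z x t p.2 r.2 s p.1 r.1

/-- The row vector `α = (α⁽¹⁾, α⁽²⁾, α⁽³⁾)`. -/
def vecAlpha : Fin 3 × ι → ℂ := fun p =>
  A (conj (z p.2)) * exp (2 * I * theta (conj (z p.2)) x t) *
    ![fHat B C z x t p.2, dHat B z x t p.2, 1 / 2] p.1

/-- The column vector `τ`: ones in the first block and zeros in the other two. -/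
def vecTau : Fin 3 × ι → ℂ := fun p => ![1, 0, 0] p.1

/-- `R`, the matrix `I - G` bordered by `α` above, `τ` on the left and `0` in the corner. -/
def matR [Fintype ι] [DecidableEq ι] :
    Matrix (Unit ⊕ Fin 3 × ι) (Unit ⊕ Fin 3 × ι) ℂ :=
  Matrix.fromBlocks 0 (Matrix.of fun _ p => vecAlpha A B C z x t p)
    (Matrix.of fun p _ => vecTau p) (1 - matG A B C z x t)

end Matrices

end TOFKN

end

/-!
The reflectionless potential is recovered from a Riemann-Hilbert problem that has no jump and only
triple poles, so that it reduces to linear algebra.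

*Direct scattering.* The four Jost columns, stripped of their exponential factors, are obtained by
reflection and conjugation from a single object: the solution `(a, b)` of the spectral problem that
tends to `(1, 0)` at `-∞`, for `λ` in the closure of `D⁻` (`IsLeftSol`). It exists and is continuous
in `λ`, and holomorphic in `D⁻`, because the Volterra equation can be solved in a Banach algebra of
functions of `λ` (`exists_isLeftSol_family`); uniqueness and bounds come from an energy estimate.
For `λ → ∞` a gauge transformation and an integration by parts give
`a → e^{iν₋}` and `λ b → (i/2) q^* e^{iν₋}` (`IsLeftSol.asymptotics`).

*Time evolution.* The flow equation is the compatibility condition of a Lax pair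
(`exists_zero_curvature`). Solving the time part from a Jost column at one time yields, by a Grönwall
argument, again a solution of the spectral problem with the same normalisation, hence the Jost
column at nearby times (`hasDerivAt_jost_time`). Therefore Wronskians are constant, and a
combination of Jost columns that vanishes to third order at a point of the discrete spectrum for
`(x, t) = (0, 0)` does so for all `(x, t)`. This gives the norming constants
(`IsSpectralPair.exists_isNormingAt`), and conversely the norming relations determine the principal
parts of `ψ₊₁ / s₁₁` and `ψ₊₂ / s₂₂` (`IsSpectralPair.div_sub_poleCoef_isBigO`).

*Inverse scattering.* Let `M₁` be `e^{-iθ} ψ₋₁` in `D⁻` and `e^{-iθ} ψ₊₁ / s₁₁` in `D⁺`, and let `M₂`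
be `e^{iθ} ψ₋₂` in `D⁺` and `e^{iθ} ψ₊₂ / s₂₂` in `D⁻`. Without reflection both are continuous across
`ℝ ∪ iℝ`, hence meromorphic in the plane with poles only at `ζ_n`, respectively `ζ_n^*`, and
`det (M₁, M₂) = 1` (`isRHSolution`). By Liouville's theorem the first entries of `M₁` and `M₂` are a
constant plus the sum of their principal parts, the principal parts of each being determined by the
second order jets of the other. Eliminating the jets of `M₂` gives for the jets `p` of `M₁` at the
points `ζ_n^*` the linear system `(I - G) p = e^{iν₋} τ` (`matG_mulVec`), and the coefficient of
`λ⁻¹` in `M₂` at infinity gives `α p = (i/2) q e^{-iν₋}`. A solution of the homogeneous system would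
give a row vector with the same principal parts that vanishes at infinity; multiplied by the inverse
of `(M₁, M₂)` it is entire, hence zero, so that `det (I - G) ≠ 0`
(`IsRHSolution.eq_zero_of_mulVec_eq`). Expanding the bordered determinant `det R` gives the formula.
-/

namespace TOFKN

/-! ### Functions holomorphic off the contour -/

/-- A continuous function that is holomorphic off the real axis is holomorphic: a rectangle that
meets the axis is cut along it, and Cauchy's theorem holds for both halves. -/
theorem differentiableOn_of_off_real {f : ℂ → ℂ} {U : Set ℂ} (hU : IsOpen U)
    (hc : ContinuousOn f U) (hd : ∀ z ∈ U, z.im ≠ 0 → DifferentiableAt ℂ f z) :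
    DifferentiableOn ℂ f U := by
  refine (isConservativeOn_and_continuousOn_iff_isDifferentiableOn hU).1 ⟨?_, hc⟩
  intro z w hzw
  rw [← add_eq_zero_iff_eq_neg, wedgeIntegral_add_wedgeIntegral_eq]
  have key : ∀ z' w' : ℂ, Rectangle z' w' ⊆ U →
      (0 : ℝ) ∉ Set.Ioo (min z'.im w'.im) (max z'.im w'.im) →
      (∫ x : ℝ in z'.re..w'.re, f (x + z'.im * I)) - (∫ x : ℝ in z'.re..w'.re, f (x + w'.im * I)) +
      I • (∫ y : ℝ in z'.im..w'.im, f (re w' + y * I)) -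
      I • (∫ y : ℝ in z'.im..w'.im, f (re z' + y * I)) = 0 := by
    intro z' w' h' h0
    refine integral_boundary_rect_eq_zero_of_continuousOn_of_differentiableOn f z' w'
      (hc.mono h') fun p hp => (hd p (h' ?_) ?_).differentiableWithinAt
    · exact ⟨Set.Ioo_subset_Icc_self hp.1, Set.Ioo_subset_Icc_self hp.2⟩
    · rintro h
      exact h0 (h ▸ hp.2)
  by_cases h0 : (0 : ℝ) ∈ Set.Ioo (min z.im w.im) (max z.im w.im)
  swap
  · exact key z w hzw h0
  have h0' : (0 : ℝ) ∈ Set.uIcc z.im w.im := Set.Ioo_subset_Icc_self h0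
  have hs1 : Set.uIcc z.im 0 ⊆ Set.uIcc z.im w.im := Set.uIcc_subset_uIcc_left h0'
  have hs2 : Set.uIcc 0 w.im ⊆ Set.uIcc z.im w.im := Set.uIcc_subset_uIcc_right h0'
  have h1 := key z (w.re : ℂ) (by
    refine subset_trans ?_ hzw
    rintro p ⟨hp1, hp2⟩
    exact ⟨by simpa using hp1, hs1 (by simpa using hp2)⟩) (by
      simp only [ofReal_im, Set.mem_Ioo, not_and, not_lt]
      intro h
      rcases le_total z.im 0 with h' | h'
      · simp [h']
      · simp [h'] at h)
  have h2 := key (z.re : ℂ) w (by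
    refine subset_trans ?_ hzw
    rintro p ⟨hp1, hp2⟩
    exact ⟨by simpa using hp1, hs2 (by simpa using hp2)⟩) (by
      simp only [ofReal_im, Set.mem_Ioo, not_and, not_lt]
      intro h
      rcases le_total w.im 0 with h' | h'
      · simp [h']
      · simp [h'] at h)
  have hint : ∀ c ∈ Set.uIcc z.re w.re, ∀ a b : ℝ, Set.uIcc a b ⊆ Set.uIcc z.im w.im →
      IntervalIntegrable (fun y : ℝ => f (c + y * I)) volume a b := by
    intro c hcm a b hab
    apply ContinuousOn.intervalIntegrable
    refine hc.comp (by fun_prop) fun y hy => hzw ⟨by simpa using hcm, by simpa using hab hy⟩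
  have e1 := intervalIntegral.integral_add_adjacent_intervals
    (hint w.re Set.right_mem_uIcc z.im 0 hs1) (hint w.re Set.right_mem_uIcc 0 w.im hs2)
  have e2 := intervalIntegral.integral_add_adjacent_intervals
    (hint z.re Set.left_mem_uIcc z.im 0 hs1) (hint z.re Set.left_mem_uIcc 0 w.im hs2)
  simp only [ofReal_re, ofReal_im, smul_eq_mul, ofReal_zero, zero_mul, add_zero] at h1 h2 ⊢
  rw [← e1, ← e2]
  linear_combination h1 + h2

/-- A continuous function that is holomorphic off `Σ` is holomorphic. -/
theorem differentiableOn_of_off_contour {f : ℂ → ℂ} {U : Set ℂ} (hU : IsOpen U)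
    (hc : ContinuousOn f U) (hd : ∀ z ∈ U, z ∉ contour → DifferentiableAt ℂ f z) :
    DifferentiableOn ℂ f U := by
  refine differentiableOn_of_off_real hU hc fun z hz hzi => ?_
  -- off the real axis, the imaginary axis is removed after a rotation by a right angle
  have hV : IsOpen {p : ℂ | I * p ∈ U ∧ (I * p).im ≠ 0} := by
    apply IsOpen.inter
    · exact hU.preimage (by fun_prop)
    · exact isOpen_ne.preimage (f := fun p : ℂ => (I * p).im) (by fun_prop)
  have h := differentiableOn_of_off_real (f := fun p => f (I * p)) hV
    (hc.comp (by fun_prop) fun p hp => hp.1) (by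
      intro p hp hpi
      have hI : I * p ∉ contour := by
        rintro (h | h)
        · exact hp.2 h
        · simp at h; exact hpi h
      exact (hd _ hp.1 hI).comp p (by fun_prop))
  have hmem : -I * z ∈ {p : ℂ | I * p ∈ U ∧ (I * p).im ≠ 0} := by
    have : I * (-I * z) = z := by linear_combination (-z) * I_mul_I
    simp only [Set.mem_ofPred_eq, this]
    exact ⟨hz, hzi⟩
  have h2 := (h.differentiableAt (hV.mem_nhds hmem)).comp z (f := fun z : ℂ => -I * z)
    (by fun_prop)
  refine h2.congr_of_eventuallyEq (Eventually.of_forall fun p => ?_)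
  have : I * (-I * p) = p := by linear_combination (-p) * I_mul_I
  simp only [Function.comp, this]

/-- Liouville's theorem for a function that is continuous off a finite set `S`, holomorphic off
`S ∪ Σ`, and bounded near infinity and near every point of `S`. -/
theorem exists_const_of_off_contour {f : ℂ → ℂ} {S : Set ℂ} (hS : S.Finite)
    (hc : ContinuousOn f Sᶜ) (hd : ∀ z ∉ S, z ∉ contour → DifferentiableAt ℂ f z)
    (hb : ∀ s ∈ S, f =O[𝓝[≠] s] (fun _ => (1 : ℂ)))
    (hinf : f =O[cocompact ℂ] (fun _ => (1 : ℂ))) : ∃ c, ∀ z ∉ S, f z = c := by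
  have hSo : IsOpen Sᶜ := hS.isClosed.isOpen_compl
  have hdf : DifferentiableOn ℂ f Sᶜ := differentiableOn_of_off_contour hSo hc hd
  set g : ℂ → ℂ := fun z => limUnder (𝓝[≠] z) f with hg
  have hgf : ∀ z ∉ S, g z = f z := fun z hz =>
    ((hc.continuousAt (hSo.mem_nhds hz)).tendsto.mono_left nhdsWithin_le_nhds).limUnder_eq
  have hgd : Differentiable ℂ g := by
    intro z
    by_cases hz : z ∈ S
    · have hpun : Sᶜ ∈ 𝓝[≠] z := by
        have : (S \ {z})ᶜ ∈ 𝓝 z := (hS.subset Set.sdiff_subset).isClosed.isOpen_compl.mem_nhds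
          (by simp)
        rw [mem_nhdsWithin_iff_exists_mem_nhds_inter]
        exact ⟨_, this, fun p hp => fun hpS => hp.1 ⟨hpS, hp.2⟩⟩
      have h1 := differentiableOn_update_limUnder_insert_of_isLittleO hpun hdf (by
        apply IsBoundedUnder.isLittleO_sub_self_inv
        obtain ⟨C, hC⟩ := (hb z hz).bound
        refine ⟨C + ‖f z‖, eventually_map.2 ?_⟩
        filter_upwards [hC] with p hp
        have := norm_sub_le (f p) (f z)
        simp at hp
        simp only [Function.comp]
        linarith)
      have h2 := h1.differentiableAt (insert_mem_nhds_iff.2 hpun)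
      refine h2.congr_of_eventuallyEq ?_
      filter_upwards [insert_mem_nhds_iff.2 hpun] with p hp
      by_cases hpz : p = z
      · simp [hpz, hg]
      · rw [Function.update_of_ne hpz]
        exact hgf p (hp.resolve_left hpz)
    · refine (hdf.differentiableAt (hSo.mem_nhds hz)).congr_of_eventuallyEq ?_
      filter_upwards [hSo.mem_nhds hz] with p hp using hgf p hp
  have hbd : Bornology.IsBounded (Set.range g) := by
    obtain ⟨C, hC⟩ := hinf.bound
    have hfin : ∀ᶠ z in cocompact ℂ, z ∉ S := hS.isCompact.compl_mem_cocompact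
    obtain ⟨K, hK, hKs⟩ := mem_cocompact.1 (hC.and hfin)
    obtain ⟨C', hC'⟩ := hK.exists_bound_of_continuousOn hgd.continuous.continuousOn
    refine isBounded_iff_forall_norm_le.2 ⟨max C C', ?_⟩
    rintro _ ⟨z, rfl⟩
    by_cases hz : z ∈ K
    · exact (hC' z hz).trans (le_max_right _ _)
    · obtain ⟨h1, h2⟩ := hKs hz
      rw [hgf z h2]
      simp at h1
      exact h1.trans (le_max_left _ _)
  obtain ⟨c, hcc⟩ := hgd.exists_const_forall_eq_of_bounded hbd
  exact ⟨c, fun z hz => by rw [← hgf z hz, hcc]⟩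

/-! ### Taylor expansions and triple poles -/

/-- Taylor's formula with a big-O remainder, in terms of iterated derivatives. -/
theorem taylor_isBigO {f : ℂ → ℂ} {z₀ : ℂ} (hf : AnalyticAt ℂ f z₀) (n : ℕ) :
    (fun z => f z - ∑ k ∈ Finset.range n, iteratedDeriv k f z₀ / k.factorial * (z - z₀) ^ k)
      =O[𝓝 z₀] fun z => (z - z₀) ^ n := by
  have h := hf.hasFPowerSeriesAt.isBigO_sub_partialSum_pow n
  have ht : Tendsto (fun z => z - z₀) (𝓝 z₀) (𝓝 0) := by
    have : Tendsto (fun z => z - z₀) (𝓝 z₀) (𝓝 (z₀ - z₀)) := tendsto_id.sub_const z₀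
    simpa using this
  have h2 := h.comp_tendsto ht
  refine (h2.congr' (Eventually.of_forall fun z => ?_) EventuallyEq.rfl).trans ?_
  · simp [FormalMultilinearSeries.partialSum]
    refine Finset.sum_congr rfl fun k _ => by ring
  · refine Asymptotics.IsBigO.of_norm_right ?_
    simpa [Function.comp_def] using Asymptotics.isBigO_refl _ _

/-- The principal part at `ε = 0` of `A (1 + D ε + F ε²) ε⁻³ f`, where `y₀, y₁, y₂` are the values
of `f, f', f''` at the pole. -/
noncomputable def polePart (A D F y₀ y₁ y₂ e : ℂ) : ℂ :=
  A * ((F * y₀ + D * y₁ + y₂ / 2) / e + (D * y₀ + y₁) / e ^ 2 + y₀ / e ^ 3)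

theorem sub_ne_zero_eventually (z₀ : ℂ) : ∀ᶠ z in 𝓝[≠] z₀, z - z₀ ≠ 0 := by
  filter_upwards [self_mem_nhdsWithin] with z hz using sub_ne_zero.2 hz

theorem isBigO_one_of_continuousAt {f : ℂ → ℂ} {z₀ : ℂ} (hf : ContinuousAt f z₀) :
    f =O[𝓝[≠] z₀] fun _ => (1 : ℂ) :=
  (hf.tendsto.isBigO_one ℂ).mono nhdsWithin_le_nhds

theorem sub_polePart_isBigO {f : ℂ → ℂ} {z₀ : ℂ} (hf : AnalyticAt ℂ f z₀) (A D F : ℂ) :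
    (fun z => A * (1 + D * (z - z₀) + F * (z - z₀) ^ 2) / (z - z₀) ^ 3 * f z
      - polePart A D F (f z₀) (iteratedDeriv 1 f z₀) (iteratedDeriv 2 f z₀) (z - z₀))
      =O[𝓝[≠] z₀] fun _ => (1 : ℂ) := by
  have ht := (taylor_isBigO hf 3).mono (nhdsWithin_le_nhds (s := {z₀}ᶜ))
  simp only [Finset.sum_range_succ, Finset.sum_range_zero, Nat.factorial, iteratedDeriv_zero] at ht
  have hA : (fun z => A * (1 + D * (z - z₀) + F * (z - z₀) ^ 2)) =O[𝓝[≠] z₀] fun _ => (1 : ℂ) :=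
    isBigO_one_of_continuousAt (by fun_prop)
  have hr := (hA.mul ht).mul (Asymptotics.isBigO_refl (fun z => ((z - z₀) ^ 3)⁻¹) (𝓝[≠] z₀))
  have hB : (fun z => A * (D * iteratedDeriv 2 f z₀ / 2 + F * iteratedDeriv 1 f z₀
      + F * iteratedDeriv 2 f z₀ / 2 * (z - z₀))) =O[𝓝[≠] z₀] fun _ => (1 : ℂ) :=
    isBigO_one_of_continuousAt (by fun_prop)
  have hr1 : (fun z : ℂ => 1 * (z - z₀) ^ 3 * ((z - z₀) ^ 3)⁻¹) =O[𝓝[≠] z₀]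
      fun _ => (1 : ℂ) := by
    refine Asymptotics.IsBigO.congr' (Asymptotics.isBigO_refl (fun _ => (1 : ℂ)) _) ?_ EventuallyEq.rfl
    filter_upwards [sub_ne_zero_eventually z₀] with z hz
    field_simp
  refine ((hr.trans hr1).add hB).congr' ?_ EventuallyEq.rfl
  filter_upwards [sub_ne_zero_eventually z₀] with z hz
  simp only [polePart]
  push_cast
  field_simp
  ring

/-- Comparison of the Laurent expansion of `β / s` at a triple zero `z₀` of `s` with
`A (1 + D ε + F ε²) ε⁻³`: the stated relations say that `β - A (1 + D ε + F ε²) ε⁻³ s` vanishes to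
third order. -/
theorem div_sub_isBigO_of_triple_zero {s β : ℂ → ℂ} {z₀ : ℂ} (hs : AnalyticAt ℂ s z₀)
    (s0 : s z₀ = 0) (s1 : iteratedDeriv 1 s z₀ = 0) (s2 : iteratedDeriv 2 s z₀ = 0)
    (s3 : iteratedDeriv 3 s z₀ ≠ 0) {A D F b₀ b₁ b₂ : ℂ}
    (hβ : (fun z => β z - (b₀ + b₁ * (z - z₀) + b₂ * (z - z₀) ^ 2)) =O[𝓝[≠] z₀]
      fun z => (z - z₀) ^ 3)
    (h0 : b₀ = A * (iteratedDeriv 3 s z₀ / 6))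
    (h1 : b₁ = A * (iteratedDeriv 4 s z₀ / 24 + D * (iteratedDeriv 3 s z₀ / 6)))
    (h2 : b₂ = A * (iteratedDeriv 5 s z₀ / 120 + D * (iteratedDeriv 4 s z₀ / 24)
      + F * (iteratedDeriv 3 s z₀ / 6))) :
    (fun z => β z / s z - A * (1 + D * (z - z₀) + F * (z - z₀) ^ 2) / (z - z₀) ^ 3)
      =O[𝓝[≠] z₀] fun _ => (1 : ℂ) := by
  have hinv : (fun z => (z - z₀) ^ 3) =O[𝓝[≠] z₀] s := by
    have ht := (taylor_isBigO hs 4).mono (nhdsWithin_le_nhds (s := {z₀}ᶜ))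
    simp only [Finset.sum_range_succ, Finset.sum_range_zero, Nat.factorial, iteratedDeriv_zero,
      s0, s1, s2] at ht
    have h34 : (fun z => (z - z₀) ^ 4) =o[𝓝[≠] z₀] fun z => (z - z₀) ^ 3 := by
      have : Tendsto (fun z => z - z₀) (𝓝[≠] z₀) (𝓝 0) := by
        have : Tendsto (fun z => z - z₀) (𝓝 z₀) (𝓝 (z₀ - z₀)) := tendsto_id.sub_const z₀
        simpa using this.mono_left nhdsWithin_le_nhds
      have h := (Asymptotics.isBigO_refl (fun z => (z - z₀) ^ 3) (𝓝[≠] z₀)).mul_isLittleO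
        ((Asymptotics.isLittleO_one_iff ℂ).2 this)
      refine h.congr (fun z => by ring) (fun z => by ring)
    have h3 : (fun z => (z - z₀) ^ 3) =O[𝓝[≠] z₀]
        fun z => iteratedDeriv 3 s z₀ / 6 * (z - z₀) ^ 3 :=
      Asymptotics.isBigO_self_const_mul (div_ne_zero s3 (by norm_num)) _ _
    have heq : Asymptotics.IsEquivalent (𝓝[≠] z₀) s
        fun z => iteratedDeriv 3 s z₀ / 6 * (z - z₀) ^ 3 := by
      refine ((ht.trans_isLittleO h34).trans_isBigO h3).congr_left fun z => ?_
      simp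
    exact h3.trans heq.isBigO_symm
  have ht := (taylor_isBigO hs 6).mono (nhdsWithin_le_nhds (s := {z₀}ᶜ))
  simp only [Finset.sum_range_succ, Finset.sum_range_zero, Nat.factorial, iteratedDeriv_zero,
    s0, s1, s2] at ht
  have hA : (fun z => A * (1 + D * (z - z₀) + F * (z - z₀) ^ 2)) =O[𝓝[≠] z₀] fun _ => (1 : ℂ) :=
    isBigO_one_of_continuousAt (by fun_prop)
  have n1 : (fun z => (z - z₀) ^ 3 * (β z - (b₀ + b₁ * (z - z₀) + b₂ * (z - z₀) ^ 2)))
      =O[𝓝[≠] z₀] fun z => (z - z₀) ^ 6 :=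
    ((Asymptotics.isBigO_refl _ _).mul hβ).congr_right fun z => by ring
  have n2 := (hA.mul ht).congr_right (g₂ := fun z => (z - z₀) ^ 6) fun z => by ring
  have hrest : (fun z => A * (D * (iteratedDeriv 5 s z₀ / 120)
      + F * (iteratedDeriv 4 s z₀ / 24) + F * (iteratedDeriv 5 s z₀ / 120) * (z - z₀)))
      =O[𝓝[≠] z₀] fun _ => (1 : ℂ) := isBigO_one_of_continuousAt (by fun_prop)
  have n3 := (hrest.mul (Asymptotics.isBigO_refl (fun z => (z - z₀) ^ 6) _)).congr_right
    (g₂ := fun z => (z - z₀) ^ 6) fun z => by ring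
  have hnum : (fun z => (z - z₀) ^ 3 * β z - A * (1 + D * (z - z₀) + F * (z - z₀) ^ 2) * s z)
      =O[𝓝[≠] z₀] fun z => (z - z₀) ^ 6 := by
    refine ((n1.sub n2).sub n3).congr_left fun z => ?_
    simp only [h0, h1, h2]
    push_cast
    ring
  have hs0 : ∀ᶠ z in 𝓝[≠] z₀, s z ≠ 0 := by
    filter_upwards [hinv.eq_zero_imp, sub_ne_zero_eventually z₀] with z hz hz' h
    exact hz' (by simpa using hz h)
  have hden : (fun z => ((z - z₀) ^ 3 * s z)⁻¹) =O[𝓝[≠] z₀] fun z => ((z - z₀) ^ 6)⁻¹ := by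
    refine Asymptotics.IsBigO.inv_rev ?_ ?_
    · exact ((Asymptotics.isBigO_refl (fun z => (z - z₀) ^ 3) _).mul hinv).congr_left
        fun z => by ring
    · filter_upwards [sub_ne_zero_eventually z₀] with z hz h
      exact absurd h (pow_ne_zero 6 hz)
  refine ((hnum.mul hden).trans ?_).congr' ?_ EventuallyEq.rfl
  · refine Asymptotics.IsBigO.congr' (Asymptotics.isBigO_refl (fun _ => (1 : ℂ)) _) ?_
      EventuallyEq.rfl
    filter_upwards [sub_ne_zero_eventually z₀] with z hz
    field_simp
  · filter_upwards [sub_ne_zero_eventually z₀, hs0] with z hz hz'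
    field_simp

/-! ### The matrix `G` as the composition of two pole expansions -/

/-- The derivatives of orders `0, 1, 2` of `polePart`, given by explicit formulas. -/
noncomputable def polePartDeriv (A D F y₀ y₁ y₂ e : ℂ) : Fin 3 → ℂ :=
  ![polePart A D F y₀ y₁ y₂ e,
    -A * ((F * y₀ + D * y₁ + y₂ / 2) / e ^ 2 + 2 * (D * y₀ + y₁) / e ^ 3 + 3 * y₀ / e ^ 4),
    2 * A * ((F * y₀ + D * y₁ + y₂ / 2) / e ^ 3 + 3 * (D * y₀ + y₁) / e ^ 4 + 6 * y₀ / e ^ 5)]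

theorem hasDerivAt_polePart (A D F y₀ y₁ y₂ : ℂ) {w l : ℂ} (h : l ≠ w) :
    HasDerivAt (fun l => polePart A D F y₀ y₁ y₂ (l - w))
      (polePartDeriv A D F y₀ y₁ y₂ (l - w) 1) l := by
  have h0 : l - w ≠ 0 := sub_ne_zero.2 h
  have h1 : HasDerivAt (fun l : ℂ => l - w) 1 l := (hasDerivAt_id l).sub_const w
  have := ((((hasDerivAt_const l (F * y₀ + D * y₁ + y₂ / 2)).div h1 h0).add
    ((hasDerivAt_const l (D * y₀ + y₁)).div (h1.pow 2) (pow_ne_zero 2 h0))).add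
    ((hasDerivAt_const l y₀).div (h1.pow 3) (pow_ne_zero 3 h0))).const_mul A
  refine HasDerivAt.congr_deriv (this.congr_of_eventuallyEq
    (Eventually.of_forall fun z => rfl)) ?_
  simp [polePartDeriv]
  field_simp
  ring

theorem hasDerivAt_polePartDeriv_one (A D F y₀ y₁ y₂ : ℂ) {w l : ℂ} (h : l ≠ w) :
    HasDerivAt (fun l => polePartDeriv A D F y₀ y₁ y₂ (l - w) 1)
      (polePartDeriv A D F y₀ y₁ y₂ (l - w) 2) l := by
  have h0 : l - w ≠ 0 := sub_ne_zero.2 h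
  have h1 : HasDerivAt (fun l : ℂ => l - w) 1 l := (hasDerivAt_id l).sub_const w
  have := ((((hasDerivAt_const l (F * y₀ + D * y₁ + y₂ / 2)).div (h1.pow 2)
      (pow_ne_zero 2 h0)).add
    ((hasDerivAt_const l (2 * (D * y₀ + y₁))).div (h1.pow 3) (pow_ne_zero 3 h0))).add
    ((hasDerivAt_const l (3 * y₀)).div (h1.pow 4) (pow_ne_zero 4 h0))).const_mul (-A)
  refine HasDerivAt.congr_deriv (this.congr_of_eventuallyEq
    (Eventually.of_forall fun z => rfl)) ?_
  simp [polePartDeriv]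
  field_simp
  ring

/-- The jet `(f, f', f'')` of a function. -/
noncomputable def jet (f : ℂ → ℂ) (l : ℂ) (i : Fin 3) : ℂ := iteratedDeriv (i : ℕ) f l

section PoleSum

variable {ι : Type} [Fintype ι] (A D F : ι → ℂ) (w : ι → ℂ)

/-- The sum of the principal parts at the points `w j` that belong to the jets `p (·, j)`. -/
noncomputable def poleSum (p : Fin 3 × ι → ℂ) (l : ℂ) : ℂ :=
  ∑ j, polePart (A j) (D j) (F j) (p (0, j)) (p (1, j)) (p (2, j)) (l - w j)

theorem hasDerivAt_poleSum (p : Fin 3 × ι → ℂ) {l : ℂ} (hl : ∀ j, l ≠ w j) :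
    HasDerivAt (poleSum A D F w p)
      (∑ j, polePartDeriv (A j) (D j) (F j) (p (0, j)) (p (1, j)) (p (2, j)) (l - w j) 1) l := by
  have := HasDerivAt.sum (u := Finset.univ) fun j _ =>
    hasDerivAt_polePart (A j) (D j) (F j) (p (0, j)) (p (1, j)) (p (2, j)) (hl j)
  refine this.congr_of_eventuallyEq (Eventually.of_forall fun z => ?_)
  simp [poleSum]

theorem eventually_ne_points {l : ℂ} (hl : ∀ j, l ≠ w j) : ∀ᶠ z in 𝓝 l, ∀ j, z ≠ w j :=
  eventually_all.2 fun j => isOpen_ne.mem_nhds (hl j)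

/-- The jets of a function that is a constant plus a sum of principal parts. -/
theorem jet_const_add_poleSum (c : ℂ) (p : Fin 3 × ι → ℂ) {l : ℂ} (hl : ∀ j, l ≠ w j) (i : Fin 3) :
    jet (fun z => c + poleSum A D F w p z) l i = (if i = 0 then c else 0) +
      ∑ j, polePartDeriv (A j) (D j) (F j) (p (0, j)) (p (1, j)) (p (2, j)) (l - w j) i := by
  have h1 : ∀ z, (∀ j, z ≠ w j) → deriv (fun z => c + poleSum A D F w p z) z = _ :=
    fun z hz => ((hasDerivAt_poleSum A D F w p hz).const_add c).deriv
  fin_cases i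
  · simp [jet, poleSum, polePartDeriv]
  · simp [jet, iteratedDeriv_one, h1 l hl]
  · simp only [jet, Fin.reduceFinMk, Fin.isValue, iteratedDeriv_succ, iteratedDeriv_zero]
    have h2 : deriv (fun z => c + poleSum A D F w p z) =ᶠ[𝓝 l] fun z =>
        ∑ j, polePartDeriv (A j) (D j) (F j) (p (0, j)) (p (1, j)) (p (2, j)) (z - w j) 1 := by
      filter_upwards [eventually_ne_points w hl] with z hz using h1 z hz
    rw [h2.deriv_eq]
    have := HasDerivAt.sum (u := Finset.univ) fun j _ =>
      hasDerivAt_polePartDeriv_one (A j) (D j) (F j) (p (0, j)) (p (1, j)) (p (2, j)) (hl j)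
    have h3 := (this.congr_of_eventuallyEq
      (f₁ := fun z => ∑ j, polePartDeriv (A j) (D j) (F j) (p (0, j)) (p (1, j)) (p (2, j))
        (z - w j) 1) (Eventually.of_forall fun z => by simp)).deriv
    rw [h3]
    simp

theorem jet_poleSum (p : Fin 3 × ι → ℂ) {l : ℂ} (hl : ∀ j, l ≠ w j) (i : Fin 3) :
    jet (poleSum A D F w p) l i =
      ∑ j, polePartDeriv (A j) (D j) (F j) (p (0, j)) (p (1, j)) (p (2, j)) (l - w j) i := by
  have := jet_const_add_poleSum A D F w 0 p hl i
  simpa using this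

theorem differentiableAt_poleSum (p : Fin 3 × ι → ℂ) {l : ℂ} (hl : ∀ j, l ≠ w j) :
    DifferentiableAt ℂ (poleSum A D F w p) l :=
  (hasDerivAt_poleSum A D F w p hl).differentiableAt

theorem tendsto_polePart_cocompact (A D F y₀ y₁ y₂ w : ℂ) :
    Tendsto (fun l => polePart A D F y₀ y₁ y₂ (l - w)) (cocompact ℂ) (𝓝 0) := by
  have h : Tendsto (fun l : ℂ => (l - w)⁻¹) (cocompact ℂ) (𝓝 0) := by
    refine tendsto_inv₀_cobounded.comp ?_ |>.mono_left (Metric.cobounded_eq_cocompact (α := ℂ)).ge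
    exact tendsto_sub_const_cobounded w
  have := (((h.const_mul (F * y₀ + D * y₁ + y₂ / 2)).add
    ((h.pow 2).const_mul (D * y₀ + y₁))).add ((h.pow 3).const_mul y₀)).const_mul A
  simpa [polePart, div_eq_mul_inv] using this

theorem tendsto_mul_polePart_cocompact (A D F y₀ y₁ y₂ w : ℂ) :
    Tendsto (fun l => l * polePart A D F y₀ y₁ y₂ (l - w)) (cocompact ℂ)
      (𝓝 (A * (F * y₀ + D * y₁ + y₂ / 2))) := by
  have h : Tendsto (fun l : ℂ => (l - w)⁻¹) (cocompact ℂ) (𝓝 0) := by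
    refine tendsto_inv₀_cobounded.comp ?_ |>.mono_left (Metric.cobounded_eq_cocompact (α := ℂ)).ge
    exact tendsto_sub_const_cobounded w
  have h1 : Tendsto (fun l : ℂ => l * (l - w)⁻¹) (cocompact ℂ) (𝓝 1) := by
    have := (h.const_mul w).const_add 1
    simp only [mul_zero, add_zero] at this
    refine this.congr' ?_
    filter_upwards [(isCompact_singleton (x := w)).compl_mem_cocompact] with l hl
    have : l - w ≠ 0 := sub_ne_zero.2 hl
    field_simp
    ring
  have := ((((h1.const_mul (F * y₀ + D * y₁ + y₂ / 2)).add
    ((h1.mul h).const_mul (D * y₀ + y₁))).add ((h1.mul (h.pow 2)).const_mul y₀))).const_mul A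
  simp only [mul_one, mul_zero, add_zero, ne_eq, OfNat.ofNat_ne_zero, not_false_eq_true,
    zero_pow] at this
  refine this.congr fun l => ?_
  simp only [polePart]
  generalize l - w = e
  ring

theorem tendsto_poleSum_cocompact (p : Fin 3 × ι → ℂ) :
    Tendsto (poleSum A D F w p) (cocompact ℂ) (𝓝 0) := by
  have := tendsto_finsetSum Finset.univ fun j (_ : j ∈ Finset.univ) =>
    tendsto_polePart_cocompact (A j) (D j) (F j) (p (0, j)) (p (1, j)) (p (2, j)) (w j)
  simp only [Finset.sum_const_zero] at this
  exact this

theorem tendsto_mul_poleSum_cocompact (p : Fin 3 × ι → ℂ) :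
    Tendsto (fun l => l * poleSum A D F w p l) (cocompact ℂ)
      (𝓝 (∑ j, A j * (F j * p (0, j) + D j * p (1, j) + p (2, j) / 2))) := by
  have := tendsto_finsetSum Finset.univ fun j (_ : j ∈ Finset.univ) =>
    tendsto_mul_polePart_cocompact (A j) (D j) (F j) (p (0, j)) (p (1, j)) (p (2, j)) (w j)
  simpa [poleSum, Finset.mul_sum] using this

/-- Near `w k` a pole sum is its principal part at `w k`, up to a bounded term. -/
theorem poleSum_sub_polePart_isBigO [DecidableEq ι] (hw : Function.Injective w)
    (p : Fin 3 × ι → ℂ) (k : ι) :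
    (fun l => poleSum A D F w p l
      - polePart (A k) (D k) (F k) (p (0, k)) (p (1, k)) (p (2, k)) (l - w k))
      =O[𝓝[≠] (w k)] fun _ => (1 : ℂ) := by
  have h : ContinuousAt (fun l => ∑ j ∈ Finset.univ.erase k,
      polePart (A j) (D j) (F j) (p (0, j)) (p (1, j)) (p (2, j)) (l - w j)) (w k) := by
    refine tendsto_finsetSum _ fun j hj => ?_
    have hjk : w k ≠ w j := fun h => (Finset.mem_erase.1 hj).1 (hw h).symm
    exact (hasDerivAt_polePart _ _ _ _ _ _ hjk).continuousAt
  refine (isBigO_one_of_continuousAt h).congr_left fun l => ?_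
  rw [poleSum, ← Finset.add_sum_erase _ _ (Finset.mem_univ k)]
  ring

end PoleSum

section MatG

variable {ι : Type} [Fintype ι] (A B C : ℂ → ℂ) (z : ι → ℂ) (x t : ℝ)

/-- The pole sum at the points `ζ_n`. -/
noncomputable def sumZ : (Fin 3 × ι → ℂ) → ℂ → ℂ :=
  poleSum (fun n => A (z n) * exp (-2 * I * theta (z n) x t)) (dF B z x t) (fF B C z x t) z

/-- The pole sum at the points `ζ_n^*`. -/
noncomputable def sumW : (Fin 3 × ι → ℂ) → ℂ → ℂ :=
  poleSum (fun n => A (conj (z n)) * exp (2 * I * theta (conj (z n)) x t)) (dHat B z x t)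
    (fHat B C z x t) (fun n => conj (z n))

/-- The matrix `G` sends jets `p` at the points `ζ_n^*` to the jets at these points of the pole sum
at the `ζ_n` built from the jets of the pole sum of `p`. -/
theorem matG_mulVec (hz : ∀ n s, conj (z n) ≠ z s) (p : Fin 3 × ι → ℂ) (i : Fin 3) (n : ι) :
    (matG A B C z x t).mulVec p (i, n) =
      jet (sumZ A B C z x t fun r => jet (sumW A B C z x t p) (z r.2) r.1) (conj (z n)) i := by
  have hv : ∀ s, ∀ m, jet (sumW A B C z x t p) (z s) m = _ := fun s m =>
    jet_poleSum _ _ _ (fun n => conj (z n)) p (fun j => (hz j s).symm) m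
  rw [sumZ, jet_poleSum _ _ _ _ _ (fun s => hz n s)]
  simp only [hv, Matrix.mulVec, dotProduct, matG, Matrix.of_apply, Finset.sum_mul]
  rw [Finset.sum_comm]
  refine Finset.sum_congr rfl fun s _ => ?_
  rw [Fintype.sum_prod_type, Finset.sum_comm]
  have hlin : ∀ (a d f e : ℂ) (y : ι → Fin 3 → ℂ),
      polePartDeriv a d f (∑ j, y j 0) (∑ j, y j 1) (∑ j, y j 2) e i =
        ∑ j, polePartDeriv a d f (y j 0) (y j 1) (y j 2) e i := by
    intro a d f e y
    fin_cases i <;>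
    · simp only [polePartDeriv, polePart, Finset.mul_sum, Finset.sum_div, ← Finset.sum_add_distrib,
        Fin.zero_eta, Fin.mk_one, Fin.reduceFinMk, Matrix.cons_val]
  rw [hlin]
  refine Finset.sum_congr rfl fun j _ => ?_
  rw [Fin.sum_univ_three]
  fin_cases i <;>
  · simp only [gTerm, cF, cHat, polePartDeriv, polePart, Fin.zero_eta, Fin.mk_one,
      Fin.reduceFinMk, Matrix.of_apply, Matrix.cons_val, Matrix.cons_val_zero, Matrix.cons_val_one]
    generalize conj (z n) - z s = u
    generalize z s - conj (z j) = v
    ring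

end MatG

/-! ### Volterra equations on the line -/

section Volterra

variable {E : Type*} [NormedAddCommGroup E]

variable {K : ℝ → ℝ → E → E} {p : ℝ → ℝ}

/-- The data of a linear Volterra equation `v x = a + ∫_{-∞}^x K x y (v y) dy` with an integrable
majorant `p` of the kernel. Linearity enters only through the Lipschitz bound and `K x y 0 = 0`. -/
structure IsVolterraKernel (K : ℝ → ℝ → E → E) (p : ℝ → ℝ) : Prop where
  cont_maj : Continuous p
  int_maj : Integrable p
  nonneg : ∀ y, 0 ≤ p y
  cont : Continuous fun z : ℝ × ℝ × E => K z.1 z.2.1 z.2.2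
  zero : ∀ x y, K x y 0 = 0
  lip : ∀ x y, y ≤ x → ∀ v w, ‖K x y v - K x y w‖ ≤ p y * ‖v - w‖

theorem IsVolterraKernel.norm_le (h : IsVolterraKernel K p) {x y : ℝ} (hxy : y ≤ x) (v : E) :
    ‖K x y v‖ ≤ p y * ‖v‖ := by
  simpa [h.zero] using h.lip x y hxy v 0

theorem IsVolterraKernel.integrableOn (h : IsVolterraKernel K p) {v : ℝ → E} (hv : Continuous v)
    {C : ℝ} (hC : ∀ y, ‖v y‖ ≤ C) (x : ℝ) :
    IntegrableOn (fun y => K x y (v y)) (Set.Iic x) := by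
  refine Integrable.mono' (g := fun y => p y * C) (h.int_maj.mul_const C).integrableOn ?_ ?_
  · exact (h.cont.comp (by fun_prop :
      Continuous fun y => (x, y, v y))).aestronglyMeasurable
  · filter_upwards [ae_restrict_mem measurableSet_Iic] with y hy
    exact (h.norm_le hy _).trans (mul_le_mul_of_nonneg_left (hC y) (h.nonneg y))

variable [NormedSpace ℝ E]

theorem hasDerivAt_integral_Iic [CompleteSpace E] {f : ℝ → E} (hf : Continuous f)
    (hi : ∀ b, IntegrableOn f (Set.Iic b)) (x : ℝ) :
    HasDerivAt (fun x => ∫ y in Set.Iic x, f y) (f x) x := by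
  have h : (fun x => ∫ y in Set.Iic x, f y) =
      fun x => (∫ y in Set.Iic 0, f y) + ∫ y in (0 : ℝ)..x, f y := by
    funext x
    rw [← intervalIntegral.integral_Iic_sub_Iic (hi 0) (hi x)]
    abel
  rw [h]
  exact (intervalIntegral.integral_hasDerivAt_right (hf.intervalIntegrable _ _)
    hf.stronglyMeasurable.stronglyMeasurableAtFilter hf.continuousAt).const_add _

theorem tendsto_integral_Iic_atBot (f : ℝ → E) :
    Tendsto (fun x => ∫ y in Set.Iic x, f y) atBot (𝓝 0) :=
  tendsto_integral_Iic_zero tendsto_id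

theorem IsVolterraKernel.continuous_integral (h : IsVolterraKernel K p) {v : ℝ → E}
    (hv : Continuous v) {C : ℝ} (hC : ∀ y, ‖v y‖ ≤ C) :
    Continuous fun x => ∫ y in Set.Iic x, K x y (v y) := by
  have h0 : (fun x => ∫ y in Set.Iic x, K x y (v y)) =
      fun x => ∫ y, (Set.Iic x).indicator (fun y => K x y (v y)) y := by
    funext x
    rw [integral_indicator measurableSet_Iic]
  rw [h0]
  refine continuous_iff_continuousAt.2 fun x₀ => ?_
  refine continuousAt_of_dominated (bound := fun y => p y * C) ?_ ?_ (h.int_maj.mul_const C) ?_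
  · refine Eventually.of_forall fun x => ?_
    exact (h.cont.comp (by fun_prop :
      Continuous fun y => (x, y, v y))).aestronglyMeasurable.indicator measurableSet_Iic
  · refine Eventually.of_forall fun x => Eventually.of_forall fun y => ?_
    by_cases hy : y ∈ Set.Iic x
    · rw [Set.indicator_of_mem hy]
      exact (h.norm_le hy _).trans (mul_le_mul_of_nonneg_left (hC y) (h.nonneg y))
    · rw [Set.indicator_of_notMem hy, norm_zero]
      exact mul_nonneg (h.nonneg y) ((norm_nonneg _).trans (hC y))
  · have : ∀ᵐ y : ℝ, y ≠ x₀ := by simp [ae_iff]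
    filter_upwards [this] with y hy
    have hcK : ContinuousAt (fun x => K x y (v y)) x₀ :=
      (h.cont.comp (by fun_prop : Continuous fun x => (x, y, v y))).continuousAt
    rcases lt_or_gt_of_ne hy with hlt | hgt
    · refine hcK.congr ?_
      filter_upwards [lt_mem_nhds hlt] with x hx
      rw [Set.indicator_of_mem (show y ∈ Set.Iic x from le_of_lt hx)]
    · refine (continuousAt_const (y := (0 : E))).congr ?_
      filter_upwards [gt_mem_nhds hgt] with x hx
      rw [Set.indicator_of_notMem (by simpa using hx)]

/-- A Volterra equation has a bounded continuous solution. In the unknown `e^{-2h} v`, where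
`h(x) = ∫_{-∞}^x p`, the equation is a fixed point problem for a contraction of ratio `1/2` on the
bounded continuous functions. -/
theorem IsVolterraKernel.exists_solution [CompleteSpace E] (h : IsVolterraKernel K p) (a : E) :
    ∃ v : ℝ → E, Continuous v ∧ (∃ C, ∀ x, ‖v x‖ ≤ C) ∧
      ∀ x, v x = a + ∫ y in Set.Iic x, K x y (v y) := by
  set H : ℝ → ℝ := fun x => ∫ y in Set.Iic x, p y with hH
  have hHd : ∀ x, HasDerivAt H (p x) x := hasDerivAt_integral_Iic h.cont_maj fun _ => h.int_maj.integrableOn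
  have hHc : Continuous H := continuous_iff_continuousAt.2 fun x => (hHd x).continuousAt
  have hH0 : ∀ x, 0 ≤ H x := fun x => integral_nonneg fun y => h.nonneg y
  have hHP : ∀ x, H x ≤ ∫ y, p y := fun x =>
    setIntegral_le_integral h.int_maj (Eventually.of_forall h.nonneg)
  set P := ∫ y, p y with hP
  set w : ℝ → ℝ := fun y => Real.exp (2 * H y) with hw
  have hwc : Continuous w := by fun_prop
  have hw1 : ∀ y, w y ≤ Real.exp (2 * P) := fun y =>
    Real.exp_le_exp.2 (by linarith [hHP y])
  have hw0 : ∀ y, 0 < w y := fun y => Real.exp_pos _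
  have hpw : ∀ x, IntegrableOn (fun y => p y * w y) (Set.Iic x) := fun x => by
    refine Integrable.mono' (g := fun y => p y * Real.exp (2 * P))
      (h.int_maj.mul_const _).integrableOn (by
        exact (h.cont_maj.mul hwc).aestronglyMeasurable) (Eventually.of_forall fun y => ?_)
    rw [Real.norm_of_nonneg (mul_nonneg (h.nonneg y) (hw0 y).le)]
    exact mul_le_mul_of_nonneg_left (hw1 y) (h.nonneg y)
  have hint : ∀ x, ∫ y in Set.Iic x, p y * w y = w x / 2 - 1 / 2 := fun x => by
    have hd : ∀ y ∈ Set.Iic x, HasDerivAt (fun y => w y / 2) (p y * w y) y := fun y _ => by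
      have := (((hHd y).const_mul 2).exp).div_const 2
      refine this.congr_deriv ?_
      simp only [hw]; ring
    refine integral_Iic_of_hasDerivAt_of_tendsto' hd (hpw x) ?_
    have h0 : Tendsto H atBot (𝓝 0) := tendsto_integral_Iic_atBot p
    have := ((Real.continuous_exp.tendsto _).comp (h0.const_mul 2)).div_const 2
    simpa using this
  -- the fixed point map in the weighted unknown
  have hbd : ∀ u : BoundedContinuousFunction ℝ E, ∀ y, ‖w y • u y‖ ≤ Real.exp (2 * P) * ‖u‖ :=
    fun u y => by
      rw [norm_smul, Real.norm_of_nonneg (hw0 y).le]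
      exact mul_le_mul (hw1 y) (u.norm_coe_le_norm y) (norm_nonneg _) (Real.exp_pos _).le
  have hwi : ∀ y, ‖(w y)⁻¹‖ ≤ 1 := fun y => by
    rw [norm_inv, Real.norm_of_nonneg (hw0 y).le]
    exact inv_le_one_of_one_le₀ (Real.one_le_exp (by linarith [hH0 y]))
  have hIb : ∀ (u : BoundedContinuousFunction ℝ E) x,
      ‖∫ y in Set.Iic x, K x y (w y • u y)‖ ≤ P * (Real.exp (2 * P) * ‖u‖) := fun u x => by
    refine (norm_integral_le_of_norm_le
      ((h.int_maj.mul_const (Real.exp (2 * P) * ‖u‖)).integrableOn (s := Set.Iic x)) ?_).trans ?_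
    · filter_upwards [ae_restrict_mem measurableSet_Iic] with y hy
      exact (h.norm_le hy _).trans (mul_le_mul_of_nonneg_left (hbd u y) (h.nonneg y))
    · rw [integral_mul_const]
      exact mul_le_mul_of_nonneg_right (hHP x) (by positivity)
  let Φ : BoundedContinuousFunction ℝ E → BoundedContinuousFunction ℝ E := fun u =>
    BoundedContinuousFunction.ofNormedAddCommGroup
      (fun x => (w x)⁻¹ • (a + ∫ y in Set.Iic x, K x y (w y • u y)))
      ((hwc.inv₀ fun y => (hw0 y).ne').smul (continuous_const.add
        (h.continuous_integral (hwc.smul u.continuous) (hbd u))))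
      (‖a‖ + P * (Real.exp (2 * P) * ‖u‖)) (fun x => by
        rw [norm_smul]
        have h1 := norm_add_le a (∫ y in Set.Iic x, K x y (w y • u y))
        have h2 := hIb u x
        calc _ ≤ 1 * ‖a + ∫ y in Set.Iic x, K x y (w y • u y)‖ :=
              mul_le_mul_of_nonneg_right (hwi x) (norm_nonneg _)
          _ ≤ _ := by rw [one_mul]; linarith)
  have hΦ : ContractingWith (1 / 2) Φ := by
    refine ⟨by norm_num, LipschitzWith.of_dist_le_mul fun u v => ?_⟩
    rw [BoundedContinuousFunction.dist_le (by positivity)]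
    intro x
    have hdiff : (Φ u) x - (Φ v) x =
        (w x)⁻¹ • ∫ y in Set.Iic x, (K x y (w y • u y) - K x y (w y • v y)) := by
      have := integral_sub (h.integrableOn (v := fun y => w y • u y) (hwc.smul u.continuous)
        (hbd u) x) (h.integrableOn (v := fun y => w y • v y) (hwc.smul v.continuous) (hbd v) x)
      rw [this]
      simp only [Φ, BoundedContinuousFunction.coe_ofNormedAddCommGroup]
      rw [← smul_sub]
      congr 1
      abel
    rw [dist_eq_norm, hdiff, norm_smul, norm_inv, Real.norm_of_nonneg (hw0 x).le]
    have h1 : ‖∫ y in Set.Iic x, (K x y (w y • u y) - K x y (w y • v y))‖ ≤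
        ∫ y in Set.Iic x, p y * w y * dist u v := by
      refine norm_integral_le_of_norm_le ((hpw x).mul_const _) ?_
      filter_upwards [ae_restrict_mem measurableSet_Iic] with y hy
      refine (h.lip x y hy _ _).trans ?_
      rw [← smul_sub, norm_smul, Real.norm_of_nonneg (hw0 y).le, mul_assoc, ← dist_eq_norm]
      exact mul_le_mul_of_nonneg_left (mul_le_mul_of_nonneg_left
        (BoundedContinuousFunction.dist_coe_le_dist y) (hw0 y).le) (h.nonneg y)
    rw [integral_mul_const, hint x] at h1
    have hd0 : 0 ≤ dist u v := dist_nonneg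
    calc (w x)⁻¹ * _ ≤ (w x)⁻¹ * ((w x / 2 - 1 / 2) * dist u v) :=
          mul_le_mul_of_nonneg_left h1 (inv_nonneg.2 (hw0 x).le)
      _ ≤ (w x)⁻¹ * (w x / 2 * dist u v) := by
          refine mul_le_mul_of_nonneg_left ?_ (inv_nonneg.2 (hw0 x).le)
          nlinarith
      _ = _ := by
          have := (hw0 x).ne'
          push_cast
          field_simp
  obtain ⟨u, hu⟩ : ∃ u, Φ u = u := ⟨_, hΦ.fixedPoint_isFixedPt⟩
  refine ⟨fun x => w x • u x, hwc.smul u.continuous, ⟨_, hbd u⟩, fun x => ?_⟩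
  have hx : (w x)⁻¹ • (a + ∫ y in Set.Iic x, K x y (w y • u y)) = u x :=
    congrArg (fun f : BoundedContinuousFunction ℝ E => f x) hu
  simp only
  rw [← hx, smul_inv_smul₀ (hw0 x).ne']

end Volterra

/-! ### The algebra of continuous functions that are holomorphic inside -/

section HolAlgebra

variable {K : Set ℂ}

theorem extend_apply_of_mem (f : K → ℂ) {z : ℂ} (hz : z ∈ K) :
    Function.extend Subtype.val f 0 z = f ⟨z, hz⟩ :=
  Subtype.val_injective.extend_apply f 0 ⟨z, hz⟩

/-- The continuous functions on the compact set `K` that are holomorphic in the interior of `K`,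
as a subalgebra of `C(K, ℂ)`. -/
def holAlgebra (K : Set ℂ) : Subalgebra ℂ C(K, ℂ) where
  carrier := {f | DifferentiableOn ℂ (Function.extend Subtype.val f 0) (interior K)}
  mul_mem' := by
    intro f g hf hg
    refine (DifferentiableOn.mul hf hg).congr fun z hz => ?_
    rw [Pi.mul_apply]
    simp only [extend_apply_of_mem _ (interior_subset hz)]
    rfl
  add_mem' := by
    intro f g hf hg
    refine (DifferentiableOn.add hf hg).congr fun z hz => ?_
    rw [Pi.add_apply]
    simp only [extend_apply_of_mem _ (interior_subset hz)]
    rfl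
  algebraMap_mem' := by
    intro c
    refine (differentiableOn_const c).congr fun z hz => ?_
    rw [extend_apply_of_mem _ (interior_subset hz)]
    rfl

theorem isClosed_holAlgebra [CompactSpace K] : IsClosed (holAlgebra K : Set C(K, ℂ)) := by
  refine IsSeqClosed.isClosed fun f g hf hfg => ?_
  have hu : TendstoUniformly (fun n => (f n : K → ℂ)) g atTop :=
    ContinuousMap.tendsto_iff_tendstoUniformly.1 hfg
  have : TendstoLocallyUniformlyOn (fun n => Function.extend Subtype.val (f n : K → ℂ) 0)
      (Function.extend Subtype.val (g : K → ℂ) 0) atTop (interior K) := by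
    refine TendstoUniformlyOn.tendstoLocallyUniformlyOn ?_
    rw [Metric.tendstoUniformlyOn_iff]
    rw [Metric.tendstoUniformly_iff] at hu
    intro ε hε
    filter_upwards [hu ε hε] with n hn z hz
    rw [extend_apply_of_mem _ (interior_subset hz), extend_apply_of_mem _ (interior_subset hz)]
    exact hn _
  exact this.differentiableOn (Eventually.of_forall hf) isOpen_interior

instance completeSpace_holAlgebra [CompactSpace K] : CompleteSpace (holAlgebra K) :=
  isClosed_holAlgebra.completeSpace_coe

/-- The restriction to `K` of an entire function, as an element of `holAlgebra K`. -/
def holOfEntire (K : Set ℂ) (f : ℂ → ℂ) (hf : Differentiable ℂ f) : holAlgebra K :=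
  ⟨⟨fun z => f z, hf.continuous.comp continuous_subtype_val⟩, by
    refine hf.differentiableOn.congr fun z hz => ?_
    rw [extend_apply_of_mem _ (interior_subset hz)]
    rfl⟩

/-- Evaluation at a point of `K`, as a continuous linear map. -/
noncomputable def holEval [CompactSpace K] (z : K) : holAlgebra K →L[ℝ] ℂ :=
  ((ContinuousMap.evalCLM ℂ z).comp (holAlgebra K).toSubmodule.subtypeL).restrictScalars ℝ

theorem holAlgebra_norm_le [CompactSpace K] {f : holAlgebra K} {C : ℝ} (hC : 0 ≤ C)
    (h : ∀ z : K, ‖(f : C(K, ℂ)) z‖ ≤ C) : ‖f‖ ≤ C :=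
  (ContinuousMap.norm_le _ hC).2 h

theorem differentiableOn_of_holAlgebra {g : ℂ → ℂ} (f : holAlgebra K)
    (h : ∀ z : K, g z = (f : C(K, ℂ)) z) : DifferentiableOn ℂ g (interior K) := by
  refine DifferentiableOn.congr (f := Function.extend Subtype.val ((f : C(K, ℂ)) : K → ℂ) 0)
    f.2 fun z hz => ?_
  rw [extend_apply_of_mem _ (interior_subset hz)]
  exact h ⟨z, interior_subset hz⟩

theorem continuousOn_of_holAlgebra {g : ℂ → ℂ} (f : holAlgebra K)
    (h : ∀ z : K, g z = (f : C(K, ℂ)) z) : ContinuousOn g K := by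
  rw [continuousOn_iff_continuous_domRestrict]
  refine (f : C(K, ℂ)).continuous.congr fun z => ?_
  exact (h z).symm

end HolAlgebra

/-! ### Solutions normalised at `-∞` for a fixed potential -/

/-- The class of potentials of the spectral problem at a fixed time. -/
structure IsPotential (u : ℝ → ℂ) : Prop where
  contDiff : ContDiff ℝ 2 u
  tendsto : Tendsto u (cocompact ℝ) (𝓝 0)
  integrable : Integrable u
  integrable_deriv : Integrable (deriv u)

/-- The closure of `D⁻`. -/
def sectorMinus : Set ℂ := {l | l.re * l.im ≤ 0}

/-- The closure of `D⁺`. -/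
def sectorPlus : Set ℂ := {l | 0 ≤ l.re * l.im}

/-- `(a, b) = e^{-iλ²x} ψ₋₁` for the potential `u`: the solution of the spectral problem, stripped of
its exponential factor, that tends to `(1, 0)` at `-∞`. The other three Jost columns are obtained
from this one by reflection in `x` and complex conjugation. -/
structure IsLeftSol (u : ℝ → ℂ) (l : ℂ) (a b : ℝ → ℂ) : Prop where
  deriv_fst : ∀ x, HasDerivAt a (l * u x * b x) x
  deriv_snd : ∀ x, HasDerivAt b (-(2 * I * l ^ 2) * b x - l * conj (u x) * a x) x
  lim_fst : Tendsto a atBot (𝓝 1)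
  lim_snd : Tendsto b atBot (𝓝 0)

theorem re_two_I_sq (l : ℂ) : (-(2 * I * l ^ 2)).re = 4 * (l.re * l.im) := by
  simp [pow_two]; ring

/-- Energy estimate: a bound for the growth rate of `|a|² + |b|²` gives a bound in terms of the
value at `-∞`. -/
theorem normSq_add_normSq_le {a b a' b' : ℝ → ℂ} {P : ℝ → ℝ} (hPc : Continuous P)
    (hPi : Integrable P) (ha : ∀ x, HasDerivAt a (a' x) x) (hb : ∀ x, HasDerivAt b (b' x) x)
    (h : ∀ x, (conj (a x) * a' x + conj (b x) * b' x).re ≤ 2 * P x * (‖a x‖ ^ 2 + ‖b x‖ ^ 2))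
    {E₀ : ℝ} (hlim : Tendsto (fun x => ‖a x‖ ^ 2 + ‖b x‖ ^ 2) atBot (𝓝 E₀)) (x : ℝ) :
    ‖a x‖ ^ 2 + ‖b x‖ ^ 2 ≤ E₀ * Real.exp (4 * ∫ y in Set.Iic x, P y) := by
  set H : ℝ → ℝ := fun x => ∫ y in Set.Iic x, P y with hH
  have hHd : ∀ x, HasDerivAt H (P x) x :=
    hasDerivAt_integral_Iic hPc fun _ => hPi.integrableOn
  set F : ℝ → ℝ := fun x => (‖a x‖ ^ 2 + ‖b x‖ ^ 2) * Real.exp (-4 * H x) with hF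
  have hFd : ∀ x, HasDerivAt F ((2 * (conj (a x) * a' x + conj (b x) * b' x).re
      - 4 * P x * (‖a x‖ ^ 2 + ‖b x‖ ^ 2)) * Real.exp (-4 * H x)) x := fun x => by
    have := ((ha x).norm_sq.add (hb x).norm_sq).mul (((hHd x).const_mul (-4)).exp)
    refine this.congr_deriv ?_
    simp only [Complex.inner, add_re, mul_re, conj_re, conj_im, Pi.add_apply]
    ring
  have hanti : Antitone F := by
    refine antitone_of_deriv_nonpos (fun x => (hFd x).differentiableAt) fun x => ?_
    rw [(hFd x).deriv]
    exact mul_nonpos_of_nonpos_of_nonneg (by linarith [h x]) (Real.exp_pos _).le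
  have hFl : Tendsto F atBot (𝓝 E₀) := by
    have h0 : Tendsto H atBot (𝓝 0) := tendsto_integral_Iic_atBot P
    have := hlim.mul ((Real.continuous_exp.tendsto _).comp (h0.const_mul (-4)))
    simp only [mul_zero, Real.exp_zero, mul_one] at this
    exact this
  have hx : F x ≤ E₀ := by
    refine ge_of_tendsto hFl ?_
    filter_upwards [Iic_mem_atBot x] with y hy using hanti hy
  calc ‖a x‖ ^ 2 + ‖b x‖ ^ 2 = F x * Real.exp (4 * H x) := by
        simp only [hF]
        rw [mul_assoc, ← Real.exp_add]
        simp
    _ ≤ _ := mul_le_mul_of_nonneg_right hx (Real.exp_pos _).le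

/-- The growth rate of the energy for a system whose off-diagonal coefficients are `p`, `r` and whose
diagonal part `κ` is dissipative. -/
theorem re_energy_le {a b p r κ : ℂ} {P : ℝ} (hκ : κ.re ≤ 0) (hp : ‖p‖ ≤ P) (hr : ‖r‖ ≤ P) :
    (conj a * (p * b) + conj b * (κ * b + r * a)).re ≤ 2 * P * (‖a‖ ^ 2 + ‖b‖ ^ 2) := by
  have h1 : (conj a * (p * b)).re ≤ ‖a‖ * P * ‖b‖ := by
    refine (re_le_norm _).trans ?_
    rw [norm_mul, norm_mul, RCLike.norm_conj, mul_assoc]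
    gcongr
  have h2 : (conj b * (r * a)).re ≤ ‖a‖ * P * ‖b‖ := by
    refine (re_le_norm _).trans ?_
    rw [norm_mul, norm_mul, RCLike.norm_conj]
    have : ‖b‖ * (‖r‖ * ‖a‖) ≤ ‖b‖ * (P * ‖a‖) := by gcongr
    linarith
  have h3 : (conj b * (κ * b)).re ≤ 0 := by
    have : conj b * (κ * b) = κ * ((‖b‖ ^ 2 : ℝ) : ℂ) := by
      rw [mul_left_comm, Complex.conj_mul']
      push_cast
      ring
    rw [this, re_mul_ofReal]
    exact mul_nonpos_of_nonpos_of_nonneg hκ (by positivity)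
  have hP : 0 ≤ P := (norm_nonneg _).trans hp
  have h4 : conj b * (κ * b + r * a) = conj b * (κ * b) + conj b * (r * a) := by ring
  rw [add_re, h4, add_re]
  nlinarith [mul_nonneg hP (sq_nonneg (‖a‖ - ‖b‖)), mul_nonneg hP (sq_nonneg ‖a‖),
    mul_nonneg hP (sq_nonneg ‖b‖)]

theorem IsPotential.continuous {u : ℝ → ℂ} (hu : IsPotential u) : Continuous u :=
  hu.contDiff.continuous

theorem IsLeftSol.unique {u : ℝ → ℂ} (hu : IsPotential u) {l : ℂ} (hl : l ∈ sectorMinus)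
    {a b a₂ b₂ : ℝ → ℂ} (h₁ : IsLeftSol u l a b) (h₂ : IsLeftSol u l a₂ b₂) :
    a = a₂ ∧ b = b₂ := by
  have hE := normSq_add_normSq_le (a := fun x => a x - a₂ x) (b := fun x => b x - b₂ x)
    (P := fun x => ‖l‖ * ‖u x‖) (continuous_const.mul hu.continuous.norm)
    (hu.integrable.norm.const_mul _)
    (fun x => (h₁.deriv_fst x).sub (h₂.deriv_fst x))
    (fun x => (h₁.deriv_snd x).sub (h₂.deriv_snd x)) (fun x => by
      have := re_energy_le (a := a x - a₂ x) (b := b x - b₂ x) (p := l * u x)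
        (r := -(l * conj (u x))) (κ := -(2 * I * l ^ 2)) (P := ‖l‖ * ‖u x‖)
        (by rw [re_two_I_sq]; have : l.re * l.im ≤ 0 := hl; linarith) (by rw [norm_mul])
        (by rw [norm_neg, norm_mul, RCLike.norm_conj])
      refine (le_of_eq ?_).trans this
      congr 1
      ring) (E₀ := 0) (by
      have h1 := ((h₁.lim_fst.sub h₂.lim_fst).norm.pow 2).add
        ((h₁.lim_snd.sub h₂.lim_snd).norm.pow 2)
      simpa using h1)
  have h0 : ∀ x, a x - a₂ x = 0 ∧ b x - b₂ x = 0 := fun x => by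
    have := hE x
    rw [zero_mul] at this
    constructor
    · have : ‖a x - a₂ x‖ ^ 2 = 0 := by nlinarith [sq_nonneg ‖a x - a₂ x‖, sq_nonneg ‖b x - b₂ x‖]
      simpa using this
    · have : ‖b x - b₂ x‖ ^ 2 = 0 := by nlinarith [sq_nonneg ‖a x - a₂ x‖, sq_nonneg ‖b x - b₂ x‖]
      simpa using this
  exact ⟨funext fun x => sub_eq_zero.1 (h0 x).1, funext fun x => sub_eq_zero.1 (h0 x).2⟩

theorem isClosed_sectorMinus : IsClosed sectorMinus :=
  isClosed_le (by fun_prop) continuous_const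

theorem norm_exp_sq_le_one {l : ℂ} (hl : l ∈ sectorMinus) {s : ℝ} (hs : 0 ≤ s) :
    ‖exp (-(2 * I * l ^ 2) * s)‖ ≤ 1 := by
  rw [norm_exp, re_mul_ofReal, re_two_I_sq]
  have : l.re * l.im ≤ 0 := hl
  exact Real.exp_le_one_iff.2 (mul_nonpos_of_nonpos_of_nonneg (by linarith) hs)

/-- Existence of the left solutions for bounded `λ` in the closure of `D⁻`, with continuous and, in
the interior, holomorphic dependence on `λ`: a Volterra equation in the Banach algebra of functions
of `λ`. -/
theorem exists_isLeftSol_family {u : ℝ → ℂ} (hu : IsPotential u) (R : ℝ) (hR : 0 ≤ R) :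
    ∃ a b : ℂ → ℝ → ℂ, (∀ l ∈ sectorMinus ∩ Metric.closedBall 0 R, IsLeftSol u l (a l) (b l)) ∧
      ∀ x, (ContinuousOn (fun l => a l x) (sectorMinus ∩ Metric.closedBall 0 R) ∧
        ContinuousOn (fun l => b l x) (sectorMinus ∩ Metric.closedBall 0 R)) ∧
        DifferentiableOn ℂ (fun l => a l x) (interior (sectorMinus ∩ Metric.closedBall 0 R)) ∧
        DifferentiableOn ℂ (fun l => b l x) (interior (sectorMinus ∩ Metric.closedBall 0 R)) := by
  classical
  set K : Set ℂ := sectorMinus ∩ Metric.closedBall 0 R with hK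
  have hKc : IsCompact K := (isCompact_closedBall (0 : ℂ) R).inter_left isClosed_sectorMinus
  have : CompactSpace K := isCompact_iff_compactSpace.1 hKc
  let el : holAlgebra K := holOfEntire K (fun l => l) differentiable_id
  let ex : ℝ → holAlgebra K := fun s => holOfEntire K (fun l => exp (-(2 * I * l ^ 2) * s))
    (by fun_prop)
  have hel : ‖el‖ ≤ R := holAlgebra_norm_le hR fun z =>
    mem_closedBall_zero_iff.1 z.2.2
  have hex : ∀ s, 0 ≤ s → ‖ex s‖ ≤ 1 := fun s hs => holAlgebra_norm_le zero_le_one fun z =>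
    norm_exp_sq_le_one z.2.1 hs
  have hexc : Continuous ex := by
    refine Continuous.subtype_mk ?_ _
    refine ContinuousMap.continuous_of_continuous_uncurry _ ?_
    change Continuous fun z : ℝ × K => exp (-(2 * I * (z.2 : ℂ) ^ 2) * (z.1 : ℂ))
    fun_prop
  let Ker : ℝ → ℝ → holAlgebra K × holAlgebra K → holAlgebra K × holAlgebra K := fun x y f =>
    (u y • (el * f.2), -(conj (u y)) • (ex (x - y) * (el * f.1)))
  have huc := hu.continuous
  have hV : IsVolterraKernel Ker fun y => R * ‖u y‖ :=
    { cont_maj := by fun_prop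
      int_maj := hu.integrable.norm.const_mul _
      nonneg := fun y => by positivity
      cont := by
        have h1 : Continuous fun z : ℝ × ℝ × (holAlgebra K × holAlgebra K) => ex (z.1 - z.2.1) :=
          hexc.comp (by fun_prop)
        have h2 : Continuous fun z : ℝ × ℝ × (holAlgebra K × holAlgebra K) => conj (u z.2.1) :=
          continuous_conj.comp (by fun_prop)
        have h3 : Continuous fun z : ℝ × ℝ × (holAlgebra K × holAlgebra K) => u z.2.1 :=
          huc.comp (by fun_prop)
        have h4 : Continuous fun z : ℝ × ℝ × (holAlgebra K × holAlgebra K) => el * z.2.2.1 :=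
          continuous_const.mul (by fun_prop)
        have h5 : Continuous fun z : ℝ × ℝ × (holAlgebra K × holAlgebra K) => el * z.2.2.2 :=
          continuous_const.mul (by fun_prop)
        exact (h3.smul h5).prodMk (h2.neg.smul (h1.mul h4))
      zero := fun x y => by simp [Ker]
      lip := fun x y hxy v w => by
        have h1 : Ker x y v - Ker x y w =
            (u y • (el * (v - w).2), -(conj (u y)) • (ex (x - y) * (el * (v - w).1))) := by
          simp only [Ker, Prod.mk_sub_mk, Prod.fst_sub, Prod.snd_sub, mul_sub, smul_sub]
        rw [h1, Prod.norm_def]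
        have hf : ∀ f : holAlgebra K, ‖el * f‖ ≤ R * ‖f‖ := fun f =>
          (norm_mul_le _ _).trans (mul_le_mul_of_nonneg_right hel (norm_nonneg _))
        refine max_le ?_ ?_
        · rw [norm_smul]
          calc ‖u y‖ * ‖el * (v - w).2‖ ≤ ‖u y‖ * (R * ‖(v - w).2‖) := by gcongr; exact hf _
            _ ≤ ‖u y‖ * (R * ‖v - w‖) := by gcongr; exact norm_snd_le _
            _ = _ := by ring
        · rw [norm_smul, norm_neg, RCLike.norm_conj]
          calc ‖u y‖ * ‖ex (x - y) * (el * (v - w).1)‖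
              ≤ ‖u y‖ * (1 * (R * ‖(v - w).1‖)) := by
                gcongr
                refine (norm_mul_le _ _).trans ?_
                exact mul_le_mul (hex _ (by linarith)) (hf _) (norm_nonneg _) zero_le_one
            _ ≤ ‖u y‖ * (1 * (R * ‖v - w‖)) := by gcongr; exact norm_fst_le _
            _ = _ := by ring }
  obtain ⟨v, hvc, ⟨C, hC⟩, hv⟩ := hV.exists_solution ((1, 0) : holAlgebra K × holAlgebra K)
  let a : ℂ → ℝ → ℂ := fun l x => if h : l ∈ K then ((v x).1 : C(K, ℂ)) ⟨l, h⟩ else 0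
  let b : ℂ → ℝ → ℂ := fun l x => if h : l ∈ K then ((v x).2 : C(K, ℂ)) ⟨l, h⟩ else 0
  have ha : ∀ x (z : K), a z x = ((v x).1 : C(K, ℂ)) z := fun x z => by simp [a]
  have hb : ∀ x (z : K), b z x = ((v x).2 : C(K, ℂ)) z := fun x z => by simp [b]
  refine ⟨a, b, fun l hl => ?_, fun x => ⟨⟨?_, ?_⟩, ?_, ?_⟩⟩
  rotate_left
  · exact continuousOn_of_holAlgebra _ (ha x)
  · exact continuousOn_of_holAlgebra _ (hb x)
  · exact differentiableOn_of_holAlgebra _ (ha x)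
  · exact differentiableOn_of_holAlgebra _ (hb x)
  let z : K := ⟨l, hl⟩
  have hal : a l = fun x => holEval z (v x).1 := funext fun x => ha x z
  have hbl : b l = fun x => holEval z (v x).2 := funext fun x => hb x z
  have hac : Continuous (a l) := by
    rw [hal]; exact (holEval z).continuous.comp (continuous_fst.comp hvc)
  have hbc : Continuous (b l) := by
    rw [hbl]; exact (holEval z).continuous.comp (continuous_snd.comp hvc)
  have hbound : ∀ (z : K) (f : holAlgebra K), ‖holEval z f‖ ≤ ‖f‖ := fun z f =>
    ContinuousMap.norm_coe_le_norm (f : C(K, ℂ)) z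
  have haC : ∀ x, ‖a l x‖ ≤ C := fun x => by
    rw [hal]; exact (hbound z _).trans ((norm_fst_le _).trans (hC x))
  have hbC : ∀ x, ‖b l x‖ ≤ C := fun x => by
    rw [hbl]; exact (hbound z _).trans ((norm_snd_le _).trans (hC x))
  have hmul : ∀ f g : holAlgebra K, holEval z (f * g) = holEval z f * holEval z g :=
    fun f g => rfl
  have hsmul : ∀ (c : ℂ) (g : holAlgebra K), holEval z (c • g) = c * holEval z g :=
    fun f g => rfl
  have hae : ∀ x, a l x = 1 + ∫ y in Set.Iic x, u y * (l * b l y) := fun x => by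
    have h1 : (v x).1 = 1 + (∫ y in Set.Iic x, Ker x y (v y)).1 := congrArg Prod.fst (hv x)
    have h2 := ((holEval z).comp (ContinuousLinearMap.fst ℝ _ _)).integral_comp_comm
      (hV.integrableOn hvc hC x)
    rw [hal]
    simp only
    rw [h1, map_add]
    refine congrArg₂ _ rfl (h2.symm.trans ?_)
    refine setIntegral_congr_fun measurableSet_Iic fun y _ => ?_
    simp only [Ker, ContinuousLinearMap.comp_apply, ContinuousLinearMap.coe_fst', hsmul, hmul, hbl]
    rfl
  have hbe : ∀ x, b l x = ∫ y in Set.Iic x, -(conj (u y)) *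
      (exp (-(2 * I * l ^ 2) * ((x - y : ℝ) : ℂ)) * (l * a l y)) := fun x => by
    have h1 : (v x).2 = 0 + (∫ y in Set.Iic x, Ker x y (v y)).2 := congrArg Prod.snd (hv x)
    have h2 := ((holEval z).comp (ContinuousLinearMap.snd ℝ _ _)).integral_comp_comm
      (hV.integrableOn hvc hC x)
    rw [hbl]
    simp only
    rw [h1, zero_add]
    refine h2.symm.trans ?_
    refine setIntegral_congr_fun measurableSet_Iic fun y _ => ?_
    simp only [Ker, ContinuousLinearMap.comp_apply, ContinuousLinearMap.coe_snd', hsmul, hmul, hal]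
    rfl
  have hcu : Continuous fun y => conj (u y) := continuous_conj.comp huc
  have hia : Integrable fun y => u y * (l * b l y) :=
    hu.integrable.mul_bdd (c := ‖l‖ * C) (by fun_prop) (Eventually.of_forall fun y => by
      rw [norm_mul]; exact mul_le_mul_of_nonneg_left (hbC y) (norm_nonneg _))
  have hib : Integrable fun y => conj (u y) * (l * a l y) := by
    have hci : Integrable fun y => conj (u y) :=
      hu.integrable.norm.mono' hcu.aestronglyMeasurable
        (Eventually.of_forall fun y => by rw [RCLike.norm_conj])
    exact hci.mul_bdd (c := ‖l‖ * C) (by fun_prop) (Eventually.of_forall fun y => by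
      rw [norm_mul]; exact mul_le_mul_of_nonneg_left (haC y) (norm_nonneg _))
  -- factoring out the exponential turns the second equation into a primitive
  have hbe' : ∀ x : ℝ, b l x = exp (-(2 * I * l ^ 2) * x) * ∫ y in Set.Iic x,
      exp ((2 * I * l ^ 2) * y) * -(conj (u y) * (l * a l y)) := fun x => by
    rw [hbe x, ← integral_const_mul]
    refine setIntegral_congr_fun measurableSet_Iic fun y _ => ?_
    have : exp (-(2 * I * l ^ 2) * ((x - y : ℝ) : ℂ)) =
        exp (-(2 * I * l ^ 2) * x) * exp ((2 * I * l ^ 2) * y) := by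
      rw [← exp_add]; congr 1; push_cast; ring
    rw [this]; ring
  have hintb : ∀ x, IntegrableOn
      (fun y : ℝ => exp ((2 * I * l ^ 2) * y) * -(conj (u y) * (l * a l y))) (Set.Iic x) :=
    fun x => by
      refine Integrable.bdd_mul (c := ‖exp ((2 * I * l ^ 2) * x)‖) hib.neg.integrableOn
        (by fun_prop) ?_
      filter_upwards [ae_restrict_mem measurableSet_Iic] with y hy
      have : exp ((2 * I * l ^ 2) * (y : ℂ)) =
          exp ((2 * I * l ^ 2) * x) * exp (-(2 * I * l ^ 2) * ((x - y : ℝ) : ℂ)) := by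
        rw [← exp_add]; congr 1; push_cast; ring
      rw [this, norm_mul]
      have hy' : y ≤ x := hy
      exact mul_le_of_le_one_right (norm_nonneg _) (norm_exp_sq_le_one hl.1 (by linarith))
  refine ⟨fun x => ?_, fun x => ?_, ?_, ?_⟩
  · have h := (hasDerivAt_integral_Iic (f := fun y => u y * (l * b l y)) (by fun_prop)
      (fun _ => hia.integrableOn) x).const_add 1
    rw [show a l = fun x => 1 + ∫ y in Set.Iic x, u y * (l * b l y) from funext hae]
    exact h.congr_deriv (by ring)
  · have h := hasDerivAt_integral_Iic
      (f := fun y : ℝ => exp ((2 * I * l ^ 2) * y) * -(conj (u y) * (l * a l y)))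
      (by fun_prop) hintb x
    have he : HasDerivAt (fun x : ℝ => exp (-(2 * I * l ^ 2) * x))
        (exp (-(2 * I * l ^ 2) * x) * (-(2 * I * l ^ 2))) x := by
      have := ((hasDerivAt_id x).ofReal_comp.const_mul (-(2 * I * l ^ 2))).cexp
      simpa using this
    have hm := he.mul h
    rw [show b l = _ from funext hbe']
    refine hm.congr_deriv ?_
    have hee : exp (-(2 * I * l ^ 2) * x) * exp ((2 * I * l ^ 2) * x) = 1 := by
      rw [← exp_add]; simp
    simp only
    linear_combination (-(conj (u x) * (l * a l x))) * hee
  · rw [show a l = fun x => 1 + ∫ y in Set.Iic x, u y * (l * b l y) from funext hae]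
    have := (tendsto_integral_Iic_atBot fun y => u y * (l * b l y)).const_add 1
    simpa using this
  · have h0 := tendsto_integral_Iic_atBot fun y => ‖conj (u y) * (l * a l y)‖
    refine squeeze_zero_norm (fun x => ?_) h0
    rw [hbe x]
    refine norm_integral_le_of_norm_le hib.norm.integrableOn ?_
    filter_upwards [ae_restrict_mem measurableSet_Iic] with y hy
    have hy' : y ≤ x := hy
    rw [norm_mul, norm_neg, norm_mul (exp _), norm_mul (conj (u y))]
    have hs : 0 ≤ x - y := by linarith
    gcongr
    exact mul_le_of_le_one_left (norm_nonneg _) (norm_exp_sq_le_one hl.1 hs)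

/-! ### Behaviour for large spectral parameter -/

/-- A dissipative scalar equation `w' = κ w + g` does not amplify its initial value. -/
theorem norm_le_of_dissipative {w g : ℝ → ℂ} {γ : ℝ → ℝ} {κ : ℂ} (hκ : κ.re ≤ 0)
    (hw : ∀ s, HasDerivAt w (κ * w s + g s) s) (hg : Continuous g) (hγ : Continuous γ)
    (hgγ : ∀ s, ‖g s‖ ≤ γ s) {y x : ℝ} (hyx : y ≤ x) :
    ‖w x‖ ≤ ‖w y‖ + ∫ s in y..x, γ s := by
  have he : ∀ s : ℝ, HasDerivAt (fun s : ℝ => exp (-κ * s)) (exp (-κ * s) * (-κ)) s := fun s => by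
    have := ((hasDerivAt_id s).ofReal_comp.const_mul (-κ)).cexp
    simpa using this
  have hφ : ∀ s ∈ Set.uIcc y x, HasDerivAt (fun s : ℝ => exp (-κ * s) * w s)
      (exp (-κ * s) * g s) s := fun s _ => by
    refine ((he s).mul (hw s)).congr_deriv ?_
    ring
  have hint := intervalIntegral.integral_eq_sub_of_hasDerivAt hφ
    (Continuous.intervalIntegrable (by fun_prop) _ _)
  have hmono : ∀ s ≤ x, ‖exp (-κ * (s : ℂ))‖ ≤ ‖exp (-κ * (x : ℂ))‖ := fun s hs => by
    rw [norm_exp, norm_exp, re_mul_ofReal, re_mul_ofReal, neg_re]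
    exact Real.exp_le_exp.2 (mul_le_mul_of_nonneg_left hs (by linarith))
  have hb : ‖∫ s in y..x, exp (-κ * s) * g s‖ ≤ ∫ s in y..x, ‖exp (-κ * (x : ℂ))‖ * γ s := by
    refine intervalIntegral.norm_integral_le_of_norm_le hyx (Eventually.of_forall fun s hs => ?_)
      (Continuous.intervalIntegrable (by fun_prop) _ _)
    rw [norm_mul]
    exact mul_le_mul (hmono s hs.2) (hgγ s) (norm_nonneg _) (norm_nonneg _)
  rw [intervalIntegral.integral_const_mul, hint] at hb
  have hpos : 0 < ‖exp (-κ * (x : ℂ))‖ := norm_pos_iff.2 (exp_ne_zero _)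
  have h1 : ‖exp (-κ * (x : ℂ)) * w x‖ ≤ ‖exp (-κ * (y : ℂ)) * w y‖ +
      ‖exp (-κ * (x : ℂ))‖ * ∫ s in y..x, γ s := by
    have := norm_le_norm_add_norm_sub' (exp (-κ * (x : ℂ)) * w x) (exp (-κ * (y : ℂ)) * w y)
    linarith
  rw [norm_mul, norm_mul] at h1
  have h2 : ‖exp (-κ * (y : ℂ))‖ * ‖w y‖ ≤ ‖exp (-κ * (x : ℂ))‖ * ‖w y‖ :=
    mul_le_mul_of_nonneg_right (hmono y hyx) (norm_nonneg _)
  have h3 : ‖exp (-κ * (x : ℂ))‖ * ‖w x‖ ≤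
      ‖exp (-κ * (x : ℂ))‖ * (‖w y‖ + ∫ s in y..x, γ s) := by
    rw [mul_add]; linarith
  exact le_of_mul_le_mul_left h3 hpos

/-- The spectral problem after the gauge transformation that makes its off-diagonal coefficients
independent of `λ`. -/
structure IsGaugedSol (U G : ℝ → ℂ) (l : ℂ) (α w : ℝ → ℂ) : Prop where
  deriv_fst : ∀ x, HasDerivAt α (U x * w x) x
  deriv_snd : ∀ x, HasDerivAt w (-(2 * I * l ^ 2) * w x + G x * α x) x
  lim_fst : Tendsto α atBot (𝓝 1)
  lim_snd : Tendsto w atBot (𝓝 0)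

section Gauged

variable {U G : ℝ → ℂ} (hUc : Continuous U) (hUi : Integrable U) (hGc : ContDiff ℝ 1 G)
  (hGi : Integrable G)

include hUc hUi hGc hGi

theorem IsGaugedSol.norm_le {l : ℂ} (hl : l ∈ sectorMinus) {α w : ℝ → ℂ}
    (h : IsGaugedSol U G l α w) (x : ℝ) :
    ‖α x‖ ≤ Real.exp (2 * ∫ y, (‖U y‖ + ‖G y‖)) ∧ ‖w x‖ ≤ Real.exp (2 * ∫ y, (‖U y‖ + ‖G y‖)) := by
  have hGcc := hGc.continuous
  have hPi : Integrable fun y => ‖U y‖ + ‖G y‖ := hUi.norm.add hGi.norm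
  have hE := normSq_add_normSq_le (P := fun y => ‖U y‖ + ‖G y‖) (by fun_prop) hPi
    h.deriv_fst h.deriv_snd (fun x => re_energy_le
      (by rw [re_two_I_sq]; have : l.re * l.im ≤ 0 := hl; linarith)
      (le_add_of_nonneg_right (norm_nonneg _)) (le_add_of_nonneg_left (norm_nonneg _)))
    (E₀ := 1) (by simpa using (h.lim_fst.norm.pow 2).add (h.lim_snd.norm.pow 2)) x
  have hI : ∫ y in Set.Iic x, (‖U y‖ + ‖G y‖) ≤ ∫ y, (‖U y‖ + ‖G y‖) :=
    setIntegral_le_integral hPi (Eventually.of_forall fun y => by positivity)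
  have h2 : 1 * Real.exp (4 * ∫ y in Set.Iic x, (‖U y‖ + ‖G y‖)) ≤
      Real.exp (2 * ∫ y, (‖U y‖ + ‖G y‖)) ^ 2 := by
    rw [one_mul, ← Real.exp_nat_mul]
    exact Real.exp_le_exp.2 (by push_cast; linarith)
  constructor
  · exact (pow_le_pow_iff_left₀ (norm_nonneg _) (Real.exp_pos _).le two_ne_zero).1
      (by nlinarith [sq_nonneg ‖w x‖])
  · exact (pow_le_pow_iff_left₀ (norm_nonneg _) (Real.exp_pos _).le two_ne_zero).1
      (by nlinarith [sq_nonneg ‖α x‖])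

/-- The second component of the gauged solution tends to zero as `λ → ∞` in the closure of `D⁻`: a
Riemann–Lebesgue lemma, by one integration by parts on a bounded interval. -/
theorem IsGaugedSol.tendsto_snd {α w : ℂ → ℝ → ℂ}
    (h : ∀ l ∈ sectorMinus, IsGaugedSol U G l (α l) (w l)) (x : ℝ) :
    Tendsto (fun l => w l x) (cocompact ℂ ⊓ 𝓟 sectorMinus) (𝓝 0) := by
  set C := Real.exp (2 * ∫ y, (‖U y‖ + ‖G y‖)) with hC
  have hC0 : 0 < C := Real.exp_pos _
  have hGcc := hGc.continuous
  have hGd : ∀ s, HasDerivAt G (deriv G s) s := fun s =>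
    (hGc.differentiable one_ne_zero s).hasDerivAt
  have hG'c : Continuous (deriv G) := hGc.continuous_deriv le_rfl
  have hre : ∀ l ∈ sectorMinus, (-(2 * I * l ^ 2)).re ≤ 0 := fun l hl => by
    rw [re_two_I_sq]; have : l.re * l.im ≤ 0 := hl; linarith
  have hcont : ∀ l ∈ sectorMinus, Continuous (α l) ∧ Continuous (w l) := fun l hl =>
    ⟨continuous_iff_continuousAt.2 fun s => ((h l hl).deriv_fst s).continuousAt,
      continuous_iff_continuousAt.2 fun s => ((h l hl).deriv_snd s).continuousAt⟩
  -- the contribution of the left tail, uniformly in `λ`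
  have htail : ∀ l ∈ sectorMinus, ∀ y, ‖w l y‖ ≤ C * ∫ s in Set.Iic y, ‖G s‖ := fun l hl y => by
    obtain ⟨hac, hwc⟩ := hcont l hl
    have h1 : ∀ᶠ y₀ in atBot, ‖w l y‖ ≤ ‖w l y₀‖ + C * ∫ s in Set.Iic y, ‖G s‖ := by
      filter_upwards [Iic_mem_atBot y] with y₀ hy₀
      refine (norm_le_of_dissipative (hre l hl) (h l hl).deriv_snd (by fun_prop)
        (γ := fun s => C * ‖G s‖) (by fun_prop) (fun s => ?_) hy₀).trans ?_
      · rw [norm_mul, mul_comm]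
        exact mul_le_mul_of_nonneg_right ((h l hl).norm_le hUc hUi hGc hGi hl s).1 (norm_nonneg _)
      · rw [intervalIntegral.integral_const_mul,
          ← intervalIntegral.integral_Iic_sub_Iic hGi.norm.integrableOn hGi.norm.integrableOn]
        have : 0 ≤ ∫ s in Set.Iic y₀, ‖G s‖ := integral_nonneg fun s => norm_nonneg _
        nlinarith
    have h2 := ((h l hl).lim_snd.norm.add_const (C * ∫ s in Set.Iic y, ‖G s‖))
    simp only [norm_zero, zero_add] at h2
    exact ge_of_tendsto h2 h1
  rw [Metric.tendsto_nhds]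
  intro ε hε
  obtain ⟨y, hyx, hy⟩ : ∃ y ≤ x, C * ∫ s in Set.Iic y, ‖G s‖ < ε / 2 := by
    have h0 := (tendsto_integral_Iic_atBot fun s => ‖G s‖).const_mul C
    rw [mul_zero] at h0
    obtain ⟨y, hy1, hy2⟩ := ((h0.eventually (gt_mem_nhds (half_pos hε))).and
      (Iic_mem_atBot x)).exists
    exact ⟨y, hy2, hy1⟩
  set M := C * (‖G y‖ + ‖G x‖ + ∫ s in y..x, (‖deriv G s‖ + ‖G s‖ * ‖U s‖)) with hM
  have hM' : ∀ l ∈ sectorMinus, l ≠ 0 → ‖w l x‖ ≤ ‖w l y‖ + M / ‖-(2 * I * l ^ 2)‖ :=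
    fun l hl hl0 => by
    obtain ⟨hac, hwc⟩ := hcont l hl
    have hb := (h l hl).norm_le hUc hUi hGc hGi hl
    set κ := -(2 * I * l ^ 2) with hκ
    have hκ0 : κ ≠ 0 := by
      rw [hκ, neg_ne_zero]
      exact mul_ne_zero (mul_ne_zero two_ne_zero I_ne_zero) (pow_ne_zero 2 hl0)
    have hκp : 0 < ‖κ‖ := norm_pos_iff.2 hκ0
    have hV : ∀ s, HasDerivAt (fun s => w l s + G s * α l s / κ)
        (κ * (w l s + G s * α l s / κ) + (deriv G s * α l s + G s * (U s * w l s)) / κ) s :=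
      fun s => by
        refine (((h l hl).deriv_snd s).add
          (((hGd s).mul ((h l hl).deriv_fst s)).div_const κ)).congr_deriv ?_
        field_simp
        ring
    have hd := norm_le_of_dissipative (hre l hl) hV (by fun_prop)
      (γ := fun s => C / ‖κ‖ * (‖deriv G s‖ + ‖G s‖ * ‖U s‖)) (by fun_prop) (fun s => by
        rw [norm_div, div_mul_eq_mul_div]
        refine div_le_div_of_nonneg_right ((norm_add_le _ _).trans ?_) hκp.le
        rw [norm_mul, norm_mul, norm_mul]
        have h1 : ‖deriv G s‖ * ‖α l s‖ ≤ ‖deriv G s‖ * C :=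
          mul_le_mul_of_nonneg_left (hb s).1 (norm_nonneg _)
        have h2 : ‖G s‖ * (‖U s‖ * ‖w l s‖) ≤ ‖G s‖ * (‖U s‖ * C) := by
          gcongr; exact (hb s).2
        linarith) hyx
    rw [intervalIntegral.integral_const_mul] at hd
    have hq : ∀ s, ‖G s * α l s / κ‖ ≤ C * ‖G s‖ / ‖κ‖ := fun s => by
      rw [norm_div, norm_mul, mul_comm]
      exact div_le_div_of_nonneg_right (mul_le_mul_of_nonneg_right (hb s).1 (norm_nonneg _)) hκp.le
    have h1 : ‖w l x‖ ≤ ‖w l x + G x * α l x / κ‖ + ‖G x * α l x / κ‖ := by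
      have := norm_sub_le (w l x + G x * α l x / κ) (G x * α l x / κ)
      simpa using this
    have h2 := norm_add_le (w l y) (G y * α l y / κ)
    have h3 := hq x
    have h4 := hq y
    have h5 : M / ‖κ‖ = C * ‖G y‖ / ‖κ‖ + C * ‖G x‖ / ‖κ‖ +
      C / ‖κ‖ * ∫ s in y..x, (‖deriv G s‖ + ‖G s‖ * ‖U s‖) := by rw [hM]; ring
    linarith
  have hlim : Tendsto (fun l : ℂ => M / ‖-(2 * I * l ^ 2)‖) (cocompact ℂ) (𝓝 0) := by
    refine tendsto_const_nhds.div_atTop ?_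
    have h1 : (fun l : ℂ => ‖-(2 * I * l ^ 2)‖) = fun l => 2 * ‖l‖ ^ 2 := by
      funext l; simp
    rw [h1]
    exact ((tendsto_pow_atTop two_ne_zero).comp
      (tendsto_norm_cocompact_atTop)).const_mul_atTop two_pos
  have hne : ∀ᶠ l : ℂ in cocompact ℂ, l ≠ 0 :=
    (isCompact_singleton (x := (0 : ℂ))).compl_mem_cocompact
  filter_upwards [mem_inf_of_left (hlim.eventually (gt_mem_nhds (half_pos hε))),
    mem_inf_of_left hne, mem_inf_of_right (mem_principal_self sectorMinus)] with l h1 h2 h3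
  rw [dist_zero_right]
  have := hM' l h3 h2
  have := htail l h3 y
  linarith

theorem IsGaugedSol.tendsto_fst {α w : ℂ → ℝ → ℂ}
    (h : ∀ l ∈ sectorMinus, IsGaugedSol U G l (α l) (w l)) (x : ℝ) :
    Tendsto (fun l => α l x) (cocompact ℂ ⊓ 𝓟 sectorMinus) (𝓝 1) := by
  have hw := IsGaugedSol.tendsto_snd hUc hUi hGc hGi h
  set C := Real.exp (2 * ∫ y, (‖U y‖ + ‖G y‖)) with hC
  have hcont : ∀ l ∈ sectorMinus, Continuous (w l) := fun l hl =>
    continuous_iff_continuousAt.2 fun s => ((h l hl).deriv_snd s).continuousAt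
  have hbd : ∀ l ∈ sectorMinus, ∀ s, ‖U s * w l s‖ ≤ ‖U s‖ * C := fun l hl s => by
    rw [norm_mul]
    exact mul_le_mul_of_nonneg_left ((h l hl).norm_le hUc hUi hGc hGi hl s).2 (norm_nonneg _)
  have hint : ∀ l ∈ sectorMinus, ∫ s in Set.Iic x, U s * w l s = α l x - 1 := fun l hl => by
    refine integral_Iic_of_hasDerivAt_of_tendsto' (fun s _ => (h l hl).deriv_fst s) ?_
      (h l hl).lim_fst
    exact ((hUi.norm.mul_const C).mono' (hUc.mul (hcont l hl)).aestronglyMeasurable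
      (Eventually.of_forall (hbd l hl))).integrableOn
  have hDCT : Tendsto (fun l => ∫ s in Set.Iic x, U s * w l s) (cocompact ℂ ⊓ 𝓟 sectorMinus)
      (𝓝 (∫ s in Set.Iic x, U s * 0)) := by
    have : (cocompact ℂ ⊓ 𝓟 sectorMinus).IsCountablyGenerated := by
      rw [← Metric.cobounded_eq_cocompact, ← comap_norm_atTop]
      infer_instance
    refine tendsto_integral_filter_of_dominated_convergence (fun s => ‖U s‖ * C) ?_ ?_
      (hUi.norm.mul_const C).integrableOn ?_
    · filter_upwards [mem_inf_of_right (mem_principal_self sectorMinus)] with l hl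
      exact (hUc.mul (hcont l hl)).aestronglyMeasurable
    · filter_upwards [mem_inf_of_right (mem_principal_self sectorMinus)] with l hl
      exact Eventually.of_forall (hbd l hl)
    · exact Eventually.of_forall fun s => (hw s).const_mul _
  have h2 := hDCT.const_add 1
  simp only [mul_zero, integral_zero, add_zero] at h2
  refine h2.congr' ?_
  filter_upwards [mem_inf_of_right (mem_principal_self sectorMinus)] with l hl
  rw [hint l hl]
  ring

end Gauged

section Potential

variable {u : ℝ → ℂ}

/-- `½ ∫_{-∞}^x |u|²`. -/
noncomputable def halfMass (u : ℝ → ℂ) (x : ℝ) : ℝ := 1 / 2 * ∫ y in Set.Iic x, ‖u y‖ ^ 2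

theorem IsPotential.exists_bound (hu : IsPotential u) : ∃ C, ∀ x, ‖u x‖ ≤ C := by
  let f : ZeroAtInftyContinuousMap ℝ ℂ := ⟨⟨u, hu.continuous⟩, hu.tendsto⟩
  exact ⟨_, fun x => f.toBCF.norm_coe_le_norm x⟩

theorem IsPotential.integrable_sq (hu : IsPotential u) : Integrable fun x => ‖u x‖ ^ 2 := by
  obtain ⟨C, hC⟩ := hu.exists_bound
  have huc := hu.continuous
  have := hu.integrable.norm.mul_bdd (c := C) (f := fun x => ‖u x‖) (g := fun x => ‖u x‖)
    (by fun_prop) (Eventually.of_forall fun x => by simpa using hC x)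
  simpa [pow_two] using this

theorem hasDerivAt_halfMass (hu : IsPotential u) (x : ℝ) :
    HasDerivAt (halfMass u) (1 / 2 * ‖u x‖ ^ 2) x := by
  have huc := hu.continuous
  exact (hasDerivAt_integral_Iic (f := fun y => ‖u y‖ ^ 2) (by fun_prop)
    (fun _ => hu.integrable_sq.integrableOn) x).const_mul (1 / 2)

theorem tendsto_halfMass (u : ℝ → ℂ) : Tendsto (halfMass u) atBot (𝓝 0) := by
  have := (tendsto_integral_Iic_atBot fun y => ‖u y‖ ^ 2).const_mul (1 / 2)
  rw [mul_zero] at this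
  exact this

theorem contDiff_halfMass (hu : IsPotential u) : ContDiff ℝ 1 (halfMass u) := by
  have huc := hu.continuous
  refine contDiff_one_iff_deriv.2 ⟨fun x => (hasDerivAt_halfMass hu x).differentiableAt, ?_⟩
  rw [show deriv (halfMass u) = fun x => 1 / 2 * ‖u x‖ ^ 2 from
    funext fun x => (hasDerivAt_halfMass hu x).deriv]
  fun_prop

/-- The coefficient `U` of the gauged problem. -/
noncomputable def gaugeU (u : ℝ → ℂ) (x : ℝ) : ℂ := exp (-(2 * I * halfMass u x)) * u x

/-- The coefficient `G` of the gauged problem. -/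
noncomputable def gaugeG (u : ℝ → ℂ) (x : ℝ) : ℂ :=
  exp (2 * I * halfMass u x) *
    (-(I / 2) * (conj (deriv u x) + I / 2 * (u x * conj (u x) * conj (u x))))

theorem contDiff_gaugeG (hu : IsPotential u) : ContDiff ℝ 1 (gaugeG u) := by
  have h1 : ContDiff ℝ 1 fun x => (halfMass u x : ℂ) :=
    ofRealCLM.contDiff.comp (contDiff_halfMass hu)
  have h2 : ContDiff ℝ 1 u := hu.contDiff.of_le (by norm_num)
  have h3 : ContDiff ℝ 1 fun x => conj (u x) := conjCLE.contDiff.comp h2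
  have h4 : ContDiff ℝ 1 fun x => conj (deriv u x) :=
    conjCLE.contDiff.comp ((contDiff_succ_iff_deriv (n := 1)).1
      (by simpa [one_add_one_eq_two] using hu.contDiff)).2.2
  unfold gaugeG
  exact (contDiff_const.mul h1).cexp.mul
    (contDiff_const.mul (h4.add (contDiff_const.mul ((h2.mul h3).mul h3))))

theorem norm_exp_two_I (s : ℝ) : ‖exp (2 * I * s)‖ = 1 := by
  rw [show 2 * I * (s : ℂ) = ((2 * s : ℝ) : ℂ) * I by push_cast; ring]
  exact norm_exp_ofReal_mul_I _

theorem integrable_gaugeG (hu : IsPotential u) : Integrable (gaugeG u) := by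
  obtain ⟨C, hC⟩ := hu.exists_bound
  have hc := (contDiff_gaugeG hu).continuous
  refine ((hu.integrable_deriv.norm.add (hu.integrable_sq.mul_const C))).mono'
    hc.aestronglyMeasurable (Eventually.of_forall fun x => ?_)
  rw [gaugeG, norm_mul, norm_exp_two_I, one_mul, norm_mul, norm_neg]
  have h1 := norm_add_le (conj (deriv u x)) (I / 2 * (u x * conj (u x) * conj (u x)))
  simp only [norm_mul, norm_div, RCLike.norm_conj, norm_I, Complex.norm_ofNat] at h1 ⊢
  have h2 : ‖u x‖ * ‖u x‖ * ‖u x‖ ≤ ‖u x‖ ^ 2 * C := by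
    rw [← pow_two]; exact mul_le_mul_of_nonneg_left (hC x) (by positivity)
  have h3 := norm_nonneg (deriv u x)
  have h4 : 0 ≤ ‖u x‖ * ‖u x‖ * ‖u x‖ := by positivity
  simp only [Pi.add_apply]
  linarith

theorem continuous_gaugeU (hu : IsPotential u) : Continuous (gaugeU u) := by
  have h1 := hu.continuous
  have h2 := (contDiff_halfMass hu).continuous
  unfold gaugeU
  fun_prop

theorem norm_gaugeU (u : ℝ → ℂ) (x : ℝ) : ‖gaugeU u x‖ = ‖u x‖ := by
  rw [gaugeU, norm_mul, exp_neg, norm_inv, norm_exp_two_I, inv_one, one_mul]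

theorem integrable_gaugeU (hu : IsPotential u) : Integrable (gaugeU u) :=
  hu.integrable.norm.mono' (continuous_gaugeU hu).aestronglyMeasurable
    (Eventually.of_forall fun x => (norm_gaugeU u x).le)

/-- The gauge transformation `(a, b) ↦ (e^{-iν} a, e^{iν} (λ b - (i/2) u^* a))`. -/
theorem IsLeftSol.gauged (hu : IsPotential u) {l : ℂ} {a b : ℝ → ℂ} (h : IsLeftSol u l a b) :
    IsGaugedSol (gaugeU u) (gaugeG u) l (fun x => exp (-(I * halfMass u x)) * a x)
      (fun x => exp (I * halfMass u x) * (l * b x - I / 2 * conj (u x) * a x)) := by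
  have hν : ∀ x, HasDerivAt (fun x => (halfMass u x : ℂ)) (1 / 2 * (u x * conj (u x))) x :=
    fun x => by
      refine (hasDerivAt_halfMass hu x).ofReal_comp.congr_deriv ?_
      rw [Complex.mul_conj']
      push_cast
      ring
  have hud : ∀ x, HasDerivAt (fun x => conj (u x)) (conj (deriv u x)) x := fun x =>
    ((hu.contDiff.differentiable two_ne_zero x).hasDerivAt).star
  have e1 : ∀ x, exp (-(2 * I * halfMass u x)) = exp (-(I * halfMass u x)) ^ 2 := fun x => by
    rw [← exp_nat_mul]; congr 1; push_cast; ring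
  have e2 : ∀ x, exp (2 * I * halfMass u x) = exp (I * halfMass u x) ^ 2 := fun x => by
    rw [← exp_nat_mul]; congr 1; push_cast; ring
  have e3 : ∀ x, exp (-(I * halfMass u x)) * exp (I * halfMass u x) = 1 := fun x => by
    rw [← exp_add]; simp
  have hν0 : Tendsto (fun x => (halfMass u x : ℂ)) atBot (𝓝 0) := by
    have := (continuous_ofReal.tendsto _).comp (tendsto_halfMass u)
    rwa [ofReal_zero] at this
  have hI : I * I = -1 := I_mul_I
  have d1 : ∀ x, HasDerivAt (fun x => exp (-(I * halfMass u x)))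
      (exp (-(I * halfMass u x)) * -(I * (1 / 2 * (u x * conj (u x))))) x := fun x =>
    ((hν x).const_mul I).neg.cexp
  have d2 : ∀ x, HasDerivAt (fun x => exp (I * halfMass u x))
      (exp (I * halfMass u x) * (I * (1 / 2 * (u x * conj (u x))))) x := fun x =>
    ((hν x).const_mul I).cexp
  refine ⟨fun x => ?_, fun x => ?_, ?_, ?_⟩
  · refine ((d1 x).mul (h.deriv_fst x)).congr_deriv ?_
    simp only [gaugeU, e1]
    linear_combination (-(exp (-(I * halfMass u x)) * u x * (l * b x - I / 2 * conj (u x) * a x)))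
      * e3 x
  · refine ((d2 x).mul (((h.deriv_snd x).const_mul l).sub
      (((hud x).const_mul (I / 2)).mul (h.deriv_fst x)))).congr_deriv ?_
    simp only [gaugeG, e2, Pi.sub_apply, Pi.mul_apply]
    linear_combination (-(exp (I * halfMass u x) * (-(I / 2) * (conj (deriv u x)
      + I / 2 * (u x * conj (u x) * conj (u x)))) * a x)) * e3 x
      - l ^ 2 * conj (u x) * a x * exp (I * halfMass u x) * hI
  · have := ((continuous_exp.tendsto _).comp (hν0.const_mul I).neg).mul h.lim_fst
    simpa using this
  · have hu0 : Tendsto (fun x => conj (u x)) atBot (𝓝 0) := by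
      have := (continuous_conj.tendsto _).comp (hu.tendsto.mono_left atBot_le_cocompact)
      rwa [map_zero] at this
    have := ((continuous_exp.tendsto _).comp (hν0.const_mul I)).mul
      ((h.lim_snd.const_mul l).sub ((hu0.const_mul (I / 2)).mul h.lim_fst))
    simpa using this

/-- Bounds and limits of the left solutions as `λ → ∞` in the closure of `D⁻`. -/
theorem IsLeftSol.asymptotics (hu : IsPotential u) {a b : ℂ → ℝ → ℂ}
    (h : ∀ l ∈ sectorMinus, IsLeftSol u l (a l) (b l)) (x : ℝ) :
    ((∃ C, ∀ l ∈ sectorMinus, 1 ≤ ‖l‖ → ‖a l x‖ ≤ C ∧ ‖b l x‖ ≤ C) ∧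
      Tendsto (fun l => a l x) (cocompact ℂ ⊓ 𝓟 sectorMinus) (𝓝 (exp (I * halfMass u x)))) ∧
    Tendsto (fun l => l * b l x) (cocompact ℂ ⊓ 𝓟 sectorMinus)
      (𝓝 (I / 2 * conj (u x) * exp (I * halfMass u x))) := by
  have hg := fun l hl => (h l hl).gauged hu
  have hUc := continuous_gaugeU hu
  have hUi := integrable_gaugeU hu
  have hGc := contDiff_gaugeG hu
  have hGi := integrable_gaugeG hu
  have e3 : exp (I * halfMass u x) * exp (-(I * halfMass u x)) = 1 := by
    rw [← exp_add]; simp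
  have ha' : ∀ c : ℂ, exp (I * halfMass u x) * (exp (-(I * halfMass u x)) * c) = c := fun c => by
    rw [← mul_assoc, e3, one_mul]
  have hb' : ∀ c : ℂ, exp (-(I * halfMass u x)) * (exp (I * halfMass u x) * c) = c := fun c => by
    rw [← mul_assoc, mul_comm (exp (-_)), e3, one_mul]
  have n1 : ‖exp (I * halfMass u x)‖ = 1 := by
    rw [mul_comm]; exact norm_exp_ofReal_mul_I _
  have n2 : ‖exp (-(I * halfMass u x))‖ = 1 := by
    rw [exp_neg, norm_inv, n1, inv_one]
  have hta : Tendsto (fun l => a l x) (cocompact ℂ ⊓ 𝓟 sectorMinus)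
      (𝓝 (exp (I * halfMass u x))) := by
    have := (IsGaugedSol.tendsto_fst hUc hUi hGc hGi hg x).const_mul (exp (I * halfMass u x))
    simpa only [ha', mul_one] using this
  refine ⟨⟨?_, hta⟩, ?_⟩
  · set C := Real.exp (2 * ∫ y, (‖gaugeU u y‖ + ‖gaugeG u y‖)) with hC
    refine ⟨C + ‖u x‖ * C, fun l hl hl1 => ?_⟩
    have hbd := (hg l hl).norm_le hUc hUi hGc hGi hl x
    have hC0 : 0 < C := Real.exp_pos _
    have haC : ‖a l x‖ ≤ C := by
      have := hbd.1
      rwa [norm_mul, n2, one_mul] at this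
    have hlb : ‖l * b l x - I / 2 * conj (u x) * a l x‖ ≤ C := by
      have := hbd.2
      rwa [norm_mul, n1, one_mul] at this
    have h1 : ‖l * b l x‖ ≤ C + ‖u x‖ * C := by
      have h2 := norm_add_le (l * b l x - I / 2 * conj (u x) * a l x)
        (I / 2 * conj (u x) * a l x)
      rw [sub_add_cancel] at h2
      have h3 : ‖I / 2 * conj (u x) * a l x‖ ≤ ‖u x‖ * C := by
        simp only [norm_div, norm_mul, RCLike.norm_conj, norm_I, Complex.norm_ofNat]
        have : ‖u x‖ * ‖a l x‖ ≤ ‖u x‖ * C := mul_le_mul_of_nonneg_left haC (norm_nonneg _)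
        have : 0 ≤ ‖u x‖ * ‖a l x‖ := by positivity
        linarith
      linarith
    refine ⟨haC.trans (le_add_of_nonneg_right (by positivity)), le_trans ?_ h1⟩
    rw [norm_mul]
    exact le_mul_of_one_le_left (norm_nonneg _) hl1
  · have h1 := (IsGaugedSol.tendsto_snd hUc hUi hGc hGi hg x).const_mul
      (exp (-(I * halfMass u x)))
    simp only [hb', mul_zero] at h1
    have h2 := h1.add (hta.const_mul (I / 2 * conj (u x)))
    simpa only [sub_add_cancel, zero_add] using h2

end Potential

/-! ### The four Jost columns as left solutions -/

theorem forall_hasDerivAt_comp_neg {g v : ℝ → ℂ} :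
    (∀ x, HasDerivAt (fun x => g (-x)) (v x) x) ↔ ∀ x, HasDerivAt g (-(v (-x))) x := by
  have key : ∀ g v : ℝ → ℂ, (∀ x, HasDerivAt g (v x) x) →
      ∀ x, HasDerivAt (fun x => g (-x)) (-(v (-x))) x := fun g v h x => by
    have := (h (-x)).scomp x (hasDerivAt_neg x)
    simpa [Function.comp_def] using this
  refine ⟨fun h x => ?_, fun h x => ?_⟩
  · simpa using key _ _ h x
  · simpa using key _ _ h x

theorem hasDerivAt_conj_iff {g : ℝ → ℂ} {v : ℂ} {x : ℝ} :
    HasDerivAt (fun x => conj (g x)) v x ↔ HasDerivAt g (conj v) x :=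
  ⟨fun h => by simpa using h.star, fun h => by simpa using h.star⟩

theorem hasDerivAt_exp_mul_iff {g θ : ℝ → ℂ} {c v : ℂ} {x : ℝ} (hθ : HasDerivAt θ c x) :
    HasDerivAt (fun x => exp (θ x) * g x) v x ↔ HasDerivAt g (exp (-θ x) * v - c * g x) x := by
  have e : ∀ x, exp (-θ x) * exp (θ x) = 1 := fun x => by rw [← exp_add]; simp
  constructor
  · intro h
    have h1 : HasDerivAt (fun x => exp (-θ x)) (exp (-θ x) * -c) x := hθ.neg.cexp
    have h2 := h1.mul h
    have h3 : (fun x => exp (-θ x)) * (fun x => exp (θ x) * g x) = g := by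
      funext y
      simp only [Pi.mul_apply]
      rw [← mul_assoc, e, one_mul]
    rw [h3] at h2
    refine h2.congr_deriv ?_
    linear_combination (-c * g x) * e x
  · intro h
    refine (hθ.cexp.mul h).congr_deriv ?_
    linear_combination v * e x

theorem tendsto_conj_iff {α : Type*} {F : Filter α} {g : α → ℂ} {c : ℂ} :
    Tendsto (fun x => conj (g x)) F (𝓝 c) ↔ Tendsto g F (𝓝 (conj c)) := by
  constructor
  · intro h
    have := (continuous_conj.tendsto _).comp h
    simpa [Function.comp_def] using this
  · intro h
    have := (continuous_conj.tendsto _).comp h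
    simpa [Function.comp_def] using this

theorem tendsto_comp_neg_atBot_iff {g : ℝ → ℂ} {l : Filter ℂ} :
    Tendsto (fun x => g (-x)) atBot l ↔ Tendsto g atTop l := by
  rw [← Filter.map_neg_atBot, tendsto_map'_iff]
  rfl

variable {q : ℝ → ℝ → ℂ}

theorem hasDerivAt_theta (l : ℂ) (t x : ℝ) : HasDerivAt (fun x => theta l x t) (l ^ 2) x := by
  have := (((hasDerivAt_id x).ofReal_comp).add_const (4 * l ^ 4 * t)).const_mul (l ^ 2)
  simpa [theta] using this

theorem laxX_mulVec (l : ℂ) (x t : ℝ) (v : Fin 2 → ℂ) :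
    (laxX q l x t).mulVec v =
      ![I * l ^ 2 * v 0 + l * q x t * v 1, -(l * conj (q x t)) * v 0 - I * l ^ 2 * v 1] := by
  funext i
  fin_cases i <;> simp [laxX, sigma3, potential, Matrix.mulVec, dotProduct, Fin.sum_univ_two,
    -mul_eq_mul_right_iff, -mul_eq_mul_left_iff] <;> ring

/-- The Jost conditions, component by component. -/
theorem isJostColumn_iff {F : Filter ℝ} {j : Fin 2} {l : ℂ} {t : ℝ} {f : ℝ → Fin 2 → ℂ} :
    IsJostColumn q F j l t f ↔
      ((∀ x, HasDerivAt (fun x => f x 0) (I * l ^ 2 * f x 0 + l * q x t * f x 1) x) ∧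
        ∀ x, HasDerivAt (fun x => f x 1) (-(l * conj (q x t)) * f x 0 - I * l ^ 2 * f x 1) x) ∧
      Tendsto (fun x => exp (-(I * theta l x t * sigma3 j j)) * f x 0) F
        (𝓝 (Pi.single (M := fun _ => ℂ) j 1 0)) ∧
      Tendsto (fun x => exp (-(I * theta l x t * sigma3 j j)) * f x 1) F
        (𝓝 (Pi.single (M := fun _ => ℂ) j 1 1)) := by
  unfold IsJostColumn
  refine and_congr ?_ ?_
  · rw [← forall_and]
    refine forall_congr' fun x => ?_
    rw [laxX_mulVec, hasDerivAt_pi, Fin.forall_fin_two]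
    rfl
  · rw [tendsto_pi_nhds, Fin.forall_fin_two]
    rfl

/-- Reflection of a potential in `x` together with complex conjugation. -/
def reflectPotential (u : ℝ → ℂ) (x : ℝ) : ℂ := conj (u (-x))

theorem isLeftSol_iff {u : ℝ → ℂ} {l : ℂ} {a b : ℝ → ℂ} :
    IsLeftSol u l a b ↔ ((∀ x, HasDerivAt a (l * u x * b x) x) ∧
      ∀ x, HasDerivAt b (-(2 * I * l ^ 2) * b x - l * conj (u x) * a x) x) ∧
      Tendsto a atBot (𝓝 1) ∧ Tendsto b atBot (𝓝 0) :=
  ⟨fun h => ⟨⟨h.1, h.2⟩, h.3, h.4⟩, fun h => ⟨h.1.1, h.1.2, h.2.1, h.2.2⟩⟩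

theorem sigma3_zero : sigma3 0 0 = 1 := rfl

theorem sigma3_one : sigma3 1 1 = -1 := rfl

theorem exp_mul_exp_neg (θ : ℂ) : exp θ * exp (-θ) = 1 := by
  rw [← exp_add, add_neg_cancel, exp_zero]

theorem hasDerivAt_I_theta (l : ℂ) (t x : ℝ) :
    HasDerivAt (fun x => I * theta l x t) (I * l ^ 2) x :=
  (hasDerivAt_theta l t x).const_mul I

theorem hasDerivAt_neg_I_theta (l : ℂ) (t x : ℝ) :
    HasDerivAt (fun x => -(I * theta l x t)) (-(I * l ^ 2)) x :=
  (hasDerivAt_I_theta l t x).neg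

theorem hasDerivAt_congr_value {g : ℝ → ℂ} {v w : ℂ} {x : ℝ} (h : v = w) :
    HasDerivAt g v x ↔ HasDerivAt g w x := by rw [h]

theorem isJostColumn_minus_one_iff {l : ℂ} {t : ℝ} {f : ℝ → Fin 2 → ℂ} :
    IsJostColumn q atBot 0 l t f ↔ IsLeftSol (fun x => q x t) l
      (fun x => exp (-(I * theta l x t)) * f x 0) (fun x => exp (-(I * theta l x t)) * f x 1) := by
  rw [isJostColumn_iff, isLeftSol_iff]
  simp only [sigma3_zero, mul_one]
  refine and_congr (and_congr (forall_congr' fun x => ?_) (forall_congr' fun x => ?_))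
    (and_congr (by simp) (by simp))
  · rw [hasDerivAt_exp_mul_iff (hasDerivAt_neg_I_theta l t x), neg_neg]
    refine hasDerivAt_congr_value ?_
    linear_combination (-(l * q x t * f x 1)) * exp_mul_exp_neg (I * theta l x t)
  · rw [hasDerivAt_exp_mul_iff (hasDerivAt_neg_I_theta l t x), neg_neg]
    refine hasDerivAt_congr_value ?_
    linear_combination (l * conj (q x t) * f x 0 + 2 * I * l ^ 2 * f x 1) *
      exp_mul_exp_neg (I * theta l x t)

theorem isJostColumn_plus_two_iff {l : ℂ} {t : ℝ} {f : ℝ → Fin 2 → ℂ} :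
    IsJostColumn q atTop 1 l t f ↔ IsLeftSol (reflectPotential fun x => q x t) l
      (fun x => exp (I * theta l (-x : ℝ) t) * f (-x) 1)
      (fun x => exp (I * theta l (-x : ℝ) t) * f (-x) 0) := by
  rw [isJostColumn_iff, isLeftSol_iff, and_comm (a := ∀ x, HasDerivAt (fun x => f x 0) _ x),
    and_comm (a := Tendsto _ _ (𝓝 (Pi.single (M := fun _ => ℂ) 1 1 0)))]
  simp only [sigma3_one, mul_neg, mul_one, neg_neg]
  refine and_congr (and_congr ?_ ?_) (and_congr ?_ ?_)
  · rw [forall_hasDerivAt_comp_neg (g := fun x => exp (I * theta l x t) * f x 1)]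
    refine forall_congr' fun x => ?_
    rw [hasDerivAt_exp_mul_iff (hasDerivAt_I_theta l t x)]
    simp only [neg_neg, reflectPotential]
    refine hasDerivAt_congr_value ?_
    linear_combination (l * conj (q x t) * f x 0) * exp_mul_exp_neg (I * theta l x t)
  · rw [forall_hasDerivAt_comp_neg (g := fun x => exp (I * theta l x t) * f x 0)]
    refine forall_congr' fun x => ?_
    rw [hasDerivAt_exp_mul_iff (hasDerivAt_I_theta l t x)]
    simp only [neg_neg, reflectPotential, conj_conj]
    refine hasDerivAt_congr_value ?_
    linear_combination (-(2 * I * l ^ 2 * f x 0) - l * q x t * f x 1) *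
      exp_mul_exp_neg (I * theta l x t)
  · rw [tendsto_comp_neg_atBot_iff (g := fun x => exp (I * theta l x t) * f x 1)]
    simp
  · rw [tendsto_comp_neg_atBot_iff (g := fun x => exp (I * theta l x t) * f x 0)]
    simp

theorem isJostColumn_minus_two_iff {l : ℂ} {t : ℝ} {f : ℝ → Fin 2 → ℂ} :
    IsJostColumn q atBot 1 l t f ↔ IsLeftSol (fun x => q x t) (conj l)
      (fun x => conj (exp (I * theta l x t) * f x 1))
      (fun x => conj (exp (I * theta l x t) * (-f x 0))) := by
  rw [isJostColumn_iff, isLeftSol_iff, and_comm (a := ∀ x, HasDerivAt (fun x => f x 0) _ x),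
    and_comm (a := Tendsto _ _ (𝓝 (Pi.single (M := fun _ => ℂ) 1 1 0)))]
  simp only [sigma3_one, mul_neg, mul_one, neg_neg]
  refine and_congr (and_congr (forall_congr' fun x => ?_) (forall_congr' fun x => ?_))
    (and_congr ?_ ?_)
  · rw [hasDerivAt_conj_iff, hasDerivAt_exp_mul_iff (hasDerivAt_I_theta l t x)]
    refine hasDerivAt_congr_value ?_
    simp only [map_mul, map_neg, conj_conj]
    linear_combination (l * conj (q x t) * f x 0) * exp_mul_exp_neg (I * theta l x t)
  · rw [hasDerivAt_conj_iff]
    have : HasDerivAt (fun x => f x 0) (I * l ^ 2 * f x 0 + l * q x t * f x 1) x ↔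
        HasDerivAt (fun x => -f x 0) (-(I * l ^ 2 * f x 0 + l * q x t * f x 1)) x :=
      ⟨fun h => h.neg, fun h => by simpa using h.fun_neg⟩
    rw [this]
    simp only [← mul_neg]
    rw [hasDerivAt_exp_mul_iff (hasDerivAt_I_theta l t x)]
    refine hasDerivAt_congr_value ?_
    simp only [map_mul, map_neg, map_sub, conj_conj, map_pow, conj_I, map_ofNat]
    linear_combination (2 * I * l ^ 2 * f x 0 + l * q x t * f x 1) *
      exp_mul_exp_neg (I * theta l x t)
  · rw [tendsto_conj_iff]
    simp
  · rw [tendsto_conj_iff, map_zero, ← neg_zero (G := ℂ), tendsto_neg_iff]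
    simp

theorem isJostColumn_plus_one_iff {l : ℂ} {t : ℝ} {f : ℝ → Fin 2 → ℂ} :
    IsJostColumn q atTop 0 l t f ↔ IsLeftSol (reflectPotential fun x => q x t) (conj l)
      (fun x => conj (exp (-(I * theta l (-x : ℝ) t)) * f (-x) 0))
      (fun x => conj (exp (-(I * theta l (-x : ℝ) t)) * (-f (-x) 1))) := by
  rw [isJostColumn_iff, isLeftSol_iff]
  simp only [sigma3_zero, mul_one]
  refine and_congr (and_congr ?_ ?_) (and_congr ?_ ?_)
  · rw [forall_hasDerivAt_comp_neg (g := fun x => conj (exp (-(I * theta l x t)) * f x 0))]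
    refine forall_congr' fun x => ?_
    rw [hasDerivAt_conj_iff, hasDerivAt_exp_mul_iff (hasDerivAt_neg_I_theta l t x), neg_neg]
    refine hasDerivAt_congr_value ?_
    simp only [map_mul, map_neg, conj_conj, neg_neg, reflectPotential]
    linear_combination (-(l * q x t * f x 1)) * exp_mul_exp_neg (I * theta l x t)
  · rw [forall_hasDerivAt_comp_neg (g := fun x => conj (exp (-(I * theta l x t)) * (-f x 1)))]
    refine forall_congr' fun x => ?_
    have : ∀ v, HasDerivAt (fun x => f x 1) v x ↔ HasDerivAt (fun x => -f x 1) (-v) x :=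
      fun v => ⟨fun h => h.neg, fun h => by simpa using h.fun_neg⟩
    rw [hasDerivAt_conj_iff, hasDerivAt_exp_mul_iff (hasDerivAt_neg_I_theta l t x), neg_neg, this]
    refine hasDerivAt_congr_value ?_
    simp only [map_mul, map_neg, map_sub, conj_conj, map_pow, conj_I, map_ofNat, neg_neg,
      reflectPotential]
    linear_combination (-(2 * I * l ^ 2 * f x 1) - l * conj (q x t) * f x 0) *
      exp_mul_exp_neg (I * theta l x t)
  · rw [tendsto_comp_neg_atBot_iff (g := fun x => conj (exp (-(I * theta l x t)) * f x 0)),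
      tendsto_conj_iff]
    simp
  · rw [tendsto_comp_neg_atBot_iff (g := fun x => conj (exp (-(I * theta l x t)) * (-f x 1))),
      tendsto_conj_iff, map_zero, ← neg_zero (G := ℂ)]
    simp only [mul_neg]
    rw [tendsto_neg_iff]
    simp

/-! ### Existence and uniqueness of the Jost columns -/

theorem IsDecayingSolution.isPotential {q : ℝ → ℝ → ℂ} (hq : IsDecayingSolution q) (t : ℝ) :
    IsPotential fun x => q x t := by
  refine ⟨?_, ?_, hq.integrable t, hq.integrable_deriv t⟩
  · have h : ContDiff ℝ 3 fun x : ℝ => q x t :=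
      hq.contDiff.comp (contDiff_id.prodMk contDiff_const)
    exact h.of_le (by norm_cast)
  · have h := hq.tendsto_zero 0 (by norm_num) t
    simp only [iteratedDeriv_zero] at h
    exact h.comp (tendsto_id.prodMk tendsto_const_nhds)

theorem IsPotential.reflect {u : ℝ → ℂ} (hu : IsPotential u) : IsPotential (reflectPotential u) := by
  have hc : ContDiff ℝ 2 (reflectPotential u) :=
    (conjCLE.contDiff.comp hu.contDiff).comp contDiff_neg
  have hd : ∀ x, HasDerivAt (reflectPotential u) (-conj (deriv u (-x))) x := fun x => by
    have h1 := (hu.contDiff.differentiable (by norm_num) (-x)).hasDerivAt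
    have := (h1.scomp x (hasDerivAt_neg x)).star
    simpa [Function.comp_def, reflectPotential] using! this
  have hi : ∀ v : ℝ → ℂ, Integrable v → Integrable fun x => conj (v (-x)) := fun v hv =>
    (conjCLE.toContinuousLinearMap.integrable_comp hv.comp_neg)
  refine ⟨hc, ?_, hi u hu.integrable, ?_⟩
  · have h1 : Tendsto (fun x : ℝ => -x) (cocompact ℝ) (cocompact ℝ) :=
      (Homeomorph.neg ℝ).isClosedEmbedding.tendsto_cocompact
    have := (continuous_conj.tendsto _).comp (hu.tendsto.comp h1)
    rwa [map_zero] at this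
  · have : deriv (reflectPotential u) = fun x => -conj (deriv u (-x)) :=
      funext fun x => (hd x).deriv
    rw [this]
    exact (hi _ hu.integrable_deriv).neg

/-- The left solution of the potential `u` for `λ` in the closure of `D⁻`. -/
noncomputable def leftSol (u : ℝ → ℂ) (l : ℂ) : (ℝ → ℂ) × (ℝ → ℂ) :=
  Classical.epsilon fun p => IsLeftSol u l p.1 p.2

section LeftSol

variable {u : ℝ → ℂ}

theorem isLeftSol_leftSol (hu : IsPotential u) {l : ℂ} (hl : l ∈ sectorMinus) :
    IsLeftSol u l (leftSol u l).1 (leftSol u l).2 := by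
  obtain ⟨a, b, h, -⟩ := exists_isLeftSol_family hu ‖l‖ (norm_nonneg l)
  exact Classical.epsilon_spec (p := fun p : (ℝ → ℂ) × (ℝ → ℂ) => IsLeftSol u l p.1 p.2)
    ⟨(a l, b l), h l ⟨hl, by simp⟩⟩

theorem leftSol_eqOn (hu : IsPotential u) (R : ℝ) (hR : 0 ≤ R) (x : ℝ) :
    (ContinuousOn (fun l => (leftSol u l).1 x) (sectorMinus ∩ Metric.closedBall 0 R) ∧
        ContinuousOn (fun l => (leftSol u l).2 x) (sectorMinus ∩ Metric.closedBall 0 R)) ∧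
      DifferentiableOn ℂ (fun l => (leftSol u l).1 x)
        (interior (sectorMinus ∩ Metric.closedBall 0 R)) ∧
      DifferentiableOn ℂ (fun l => (leftSol u l).2 x)
        (interior (sectorMinus ∩ Metric.closedBall 0 R)) := by
  obtain ⟨a, b, h, hx⟩ := exists_isLeftSol_family hu R hR
  obtain ⟨⟨h1, h2⟩, h3, h4⟩ := hx x
  have e : ∀ l ∈ sectorMinus ∩ Metric.closedBall 0 R, (leftSol u l).1 = a l ∧
      (leftSol u l).2 = b l := fun l hl => (isLeftSol_leftSol hu hl.1).unique hu hl.1 (h l hl)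
  refine ⟨⟨h1.congr fun l hl => ?_, h2.congr fun l hl => ?_⟩,
    h3.congr fun l hl => ?_, h4.congr fun l hl => ?_⟩
  · rw [(e l hl).1]
  · rw [(e l hl).2]
  · rw [(e l (interior_subset hl)).1]
  · rw [(e l (interior_subset hl)).2]

theorem continuousOn_leftSol (hu : IsPotential u) (x : ℝ) :
    ContinuousOn (fun l => (leftSol u l).1 x) sectorMinus ∧
      ContinuousOn (fun l => (leftSol u l).2 x) sectorMinus := by
  have key : ∀ l : ℂ, sectorMinus ∩ Metric.closedBall 0 (‖l‖ + 1) ∈ 𝓝[sectorMinus] l := fun l =>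
    inter_mem self_mem_nhdsWithin (mem_nhdsWithin_of_mem_nhds
      (Metric.closedBall_mem_nhds_of_mem (by simp)))
  constructor <;> intro l hl
  · exact (((leftSol_eqOn hu (‖l‖ + 1) (by positivity) x).1.1 l ⟨hl, by simp⟩).mono_of_mem_nhdsWithin
      (key l))
  · exact (((leftSol_eqOn hu (‖l‖ + 1) (by positivity) x).1.2 l ⟨hl, by simp⟩).mono_of_mem_nhdsWithin
      (key l))

/-- `D⁻ = {Re λ Im λ < 0}`. -/
def Dminus : Set ℂ := {l | l.re * l.im < 0}

theorem isOpen_Dminus : IsOpen Dminus := isOpen_lt (by fun_prop) continuous_const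

theorem isOpen_Dplus : IsOpen Dplus := isOpen_lt continuous_const (by fun_prop)

theorem Dminus_subset : Dminus ⊆ sectorMinus := fun l (hl : l.re * l.im < 0) =>
  show l.re * l.im ≤ 0 from hl.le

theorem Dplus_subset : Dplus ⊆ sectorPlus := fun l (hl : 0 < l.re * l.im) =>
  show 0 ≤ l.re * l.im from hl.le

theorem differentiableAt_leftSol (hu : IsPotential u) {l : ℂ} (hl : l ∈ Dminus) (x : ℝ) :
    DifferentiableAt ℂ (fun l => (leftSol u l).1 x) l ∧
      DifferentiableAt ℂ (fun l => (leftSol u l).2 x) l := by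
  have hm : interior (sectorMinus ∩ Metric.closedBall 0 (‖l‖ + 1)) ∈ 𝓝 l := by
    refine interior_mem_nhds.2 (inter_mem ?_ (Metric.closedBall_mem_nhds_of_mem (by simp)))
    exact mem_of_superset (isOpen_Dminus.mem_nhds hl) Dminus_subset
  have := (leftSol_eqOn hu (‖l‖ + 1) (by positivity) x).2
  exact ⟨this.1.differentiableAt hm, this.2.differentiableAt hm⟩

theorem leftSol_neg (hu : IsPotential u) {l : ℂ} (hl : l ∈ sectorMinus) (x : ℝ) :
    (leftSol u (-l)).1 x = (leftSol u l).1 x ∧ (leftSol u (-l)).2 x = -(leftSol u l).2 x := by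
  have hl' : -l ∈ sectorMinus := by simpa [sectorMinus] using hl
  have h := isLeftSol_leftSol hu hl
  have h2 : IsLeftSol u (-l) (leftSol u l).1 (fun x => -(leftSol u l).2 x) := by
    refine ⟨fun x => (h.deriv_fst x).congr_deriv (by ring),
      fun x => (h.deriv_snd x).neg.congr_deriv (by ring), h.lim_fst, by simpa using h.lim_snd.neg⟩
  have e := (isLeftSol_leftSol hu hl').unique hu hl' h2
  exact ⟨by rw [e.1], by rw [e.2]⟩

theorem conj_mem_sectorMinus {l : ℂ} : conj l ∈ sectorMinus ↔ l ∈ sectorPlus := by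
  simp [sectorMinus, sectorPlus]

theorem conj_mem_sectorPlus {l : ℂ} : conj l ∈ sectorPlus ↔ l ∈ sectorMinus := by
  simp [sectorMinus, sectorPlus]

theorem conj_mem_Dminus {l : ℂ} : conj l ∈ Dminus ↔ l ∈ Dplus := by
  simp [Dminus, Dplus]

end LeftSol

variable {q : ℝ → ℝ → ℂ}

theorem theta_conj (l : ℂ) (x t : ℝ) : theta (conj l) x t = conj (theta l x t) := by
  simp only [theta, map_mul, map_add, map_pow, conj_ofReal, map_ofNat]

theorem existsUnique_jostColumn_minus_one (hq : IsDecayingSolution q) {l : ℂ}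
    (hl : l ∈ sectorMinus) (t : ℝ) : ∃! f, IsJostColumn q atBot 0 l t f := by
  have hu := hq.isPotential t
  have h := isLeftSol_leftSol hu hl
  refine ⟨fun x => exp (I * theta l x t) •
    ![(leftSol (fun x => q x t) l).1 x, (leftSol (fun x => q x t) l).2 x], ?_, fun f hf => ?_⟩
  · change IsJostColumn _ _ _ _ _ _
    rw [isJostColumn_minus_one_iff]
    simpa [← mul_assoc, ← exp_add] using h
  · replace hf := isJostColumn_minus_one_iff.1 hf
    obtain ⟨h1, h2⟩ := hf.unique hu hl h
    funext x
    rw [← h1, ← h2]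
    funext i
    fin_cases i <;> simp [← mul_assoc, ← exp_add]

theorem existsUnique_jostColumn_plus_two (hq : IsDecayingSolution q) {l : ℂ}
    (hl : l ∈ sectorMinus) (t : ℝ) : ∃! f, IsJostColumn q atTop 1 l t f := by
  have hu := (hq.isPotential t).reflect
  have h := isLeftSol_leftSol hu hl
  refine ⟨fun x => exp (-(I * theta l x t)) •
    ![(leftSol (reflectPotential fun x => q x t) l).2 (-x),
      (leftSol (reflectPotential fun x => q x t) l).1 (-x)], ?_, fun f hf => ?_⟩
  · change IsJostColumn _ _ _ _ _ _
    rw [isJostColumn_plus_two_iff]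
    simpa [← mul_assoc, ← exp_add] using h
  · replace hf := isJostColumn_plus_two_iff.1 hf
    obtain ⟨h1, h2⟩ := hf.unique hu hl h
    funext x
    rw [← h1, ← h2]
    funext i
    fin_cases i <;> simp [← mul_assoc, ← exp_add]

theorem existsUnique_jostColumn_minus_two (hq : IsDecayingSolution q) {l : ℂ}
    (hl : l ∈ sectorPlus) (t : ℝ) : ∃! f, IsJostColumn q atBot 1 l t f := by
  have hu := hq.isPotential t
  have hl' := conj_mem_sectorMinus.2 hl
  have h := isLeftSol_leftSol hu hl'
  refine ⟨fun x => exp (-(I * theta l x t)) •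
    ![-conj ((leftSol (fun x => q x t) (conj l)).2 x),
      conj ((leftSol (fun x => q x t) (conj l)).1 x)], ?_, fun f hf => ?_⟩
  · change IsJostColumn _ _ _ _ _ _
    rw [isJostColumn_minus_two_iff]
    simpa [← mul_assoc, ← exp_add, exp_mul_exp_neg, -map_mul] using h
  · replace hf := isJostColumn_minus_two_iff.1 hf
    obtain ⟨h1, h2⟩ := hf.unique hu hl' h
    funext x
    rw [← h1, ← h2]
    funext i
    fin_cases i <;> simp [← mul_assoc, ← exp_add, -map_mul]

theorem existsUnique_jostColumn_plus_one (hq : IsDecayingSolution q) {l : ℂ}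
    (hl : l ∈ sectorPlus) (t : ℝ) : ∃! f, IsJostColumn q atTop 0 l t f := by
  have hu := (hq.isPotential t).reflect
  have hl' := conj_mem_sectorMinus.2 hl
  have h := isLeftSol_leftSol hu hl'
  refine ⟨fun x => exp (I * theta l x t) •
    ![conj ((leftSol (reflectPotential fun x => q x t) (conj l)).1 (-x)),
      -conj ((leftSol (reflectPotential fun x => q x t) (conj l)).2 (-x))], ?_, fun f hf => ?_⟩
  · change IsJostColumn _ _ _ _ _ _
    rw [isJostColumn_plus_one_iff]
    simpa [← mul_assoc, ← exp_add, exp_mul_exp_neg, -map_mul] using h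
  · replace hf := isJostColumn_plus_one_iff.1 hf
    obtain ⟨h1, h2⟩ := hf.unique hu hl' h
    funext x
    rw [← h1, ← h2]
    funext i
    fin_cases i <;> simp [← mul_assoc, ← exp_add, -map_mul]

theorem isJostColumn_jost {F : Filter ℝ} {j : Fin 2} {l : ℂ} {t : ℝ}
    (h : ∃! f, IsJostColumn q F j l t f) : IsJostColumn q F j l t fun x => jost q F j l x t :=
  Classical.epsilon_spec h.exists

theorem psiMinus1_eq (hq : IsDecayingSolution q) {l : ℂ} (hl : l ∈ sectorMinus) (x t : ℝ) :
    psiMinus1 q l x t = exp (I * theta l x t) •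
      ![(leftSol (fun x => q x t) l).1 x, (leftSol (fun x => q x t) l).2 x] := by
  have hE := existsUnique_jostColumn_minus_one hq hl t
  have h := isJostColumn_minus_one_iff.1 (isJostColumn_jost hE)
  obtain ⟨h1, h2⟩ := h.unique (hq.isPotential t) hl (isLeftSol_leftSol (hq.isPotential t) hl)
  rw [← h1, ← h2]
  funext i
  fin_cases i <;> simp [psiMinus1, ← mul_assoc, ← exp_add]

theorem psiPlus2_eq (hq : IsDecayingSolution q) {l : ℂ} (hl : l ∈ sectorMinus) (x t : ℝ) :
    psiPlus2 q l x t = exp (-(I * theta l x t)) •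
      ![(leftSol (reflectPotential fun x => q x t) l).2 (-x),
        (leftSol (reflectPotential fun x => q x t) l).1 (-x)] := by
  have hE := existsUnique_jostColumn_plus_two hq hl t
  have hu := (hq.isPotential t).reflect
  have h := isJostColumn_plus_two_iff.1 (isJostColumn_jost hE)
  obtain ⟨h1, h2⟩ := h.unique hu hl (isLeftSol_leftSol hu hl)
  rw [← h1, ← h2]
  funext i
  fin_cases i <;> simp [psiPlus2, ← mul_assoc, ← exp_add]

/-- The symmetry `ψ₋₂(λ) = σ ψ₋₁(λ^*)^*`. -/
theorem psiMinus2_eq (hq : IsDecayingSolution q) {l : ℂ} (hl : l ∈ sectorPlus) (x t : ℝ) :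
    psiMinus2 q l x t =
      ![-conj (psiMinus1 q (conj l) x t 1), conj (psiMinus1 q (conj l) x t 0)] := by
  have hE := existsUnique_jostColumn_minus_two hq hl t
  have hl' := conj_mem_sectorMinus.2 hl
  have h := isJostColumn_minus_two_iff.1 (isJostColumn_jost hE)
  have hu := hq.isPotential t
  obtain ⟨h1, h2⟩ := h.unique hu hl' (isLeftSol_leftSol hu hl')
  rw [psiMinus1_eq hq hl', ← h1, ← h2]
  funext i
  fin_cases i <;> simp [psiMinus2, ← mul_assoc, ← exp_add, theta_conj, ← exp_conj]

/-- The symmetry `ψ₊₁(λ) = -σ ψ₊₂(λ^*)^*`. -/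
theorem psiPlus1_eq (hq : IsDecayingSolution q) {l : ℂ} (hl : l ∈ sectorPlus) (x t : ℝ) :
    psiPlus1 q l x t =
      ![conj (psiPlus2 q (conj l) x t 1), -conj (psiPlus2 q (conj l) x t 0)] := by
  have hE := existsUnique_jostColumn_plus_one hq hl t
  have hl' := conj_mem_sectorMinus.2 hl
  have h := isJostColumn_plus_one_iff.1 (isJostColumn_jost hE)
  have hu := (hq.isPotential t).reflect
  obtain ⟨h1, h2⟩ := h.unique hu hl' (isLeftSol_leftSol hu hl')
  rw [psiPlus2_eq hq hl', ← h1, ← h2]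
  funext i
  fin_cases i <;> simp [psiPlus1, ← mul_assoc, ← exp_add, theta_conj, ← exp_conj]

/-! ### Compatible pairs of linear differential equations -/

section Compatible

variable {E : Type*} [NormedAddCommGroup E] [NormedSpace ℝ E]

theorem norm_le_of_norm_deriv_le_right {g g' : ℝ → E} {t₀ t K ε : ℝ} (ht : t₀ ≤ t)
    (hg : ∀ s ∈ Set.Icc t₀ t, HasDerivAt g (g' s) s) (hK : 1 ≤ K) (hε : 0 ≤ ε)
    (hb : ∀ s ∈ Set.Icc t₀ t, ‖g' s‖ ≤ K * ‖g s‖ + ε) :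
    ‖g t‖ ≤ (‖g t₀‖ + ε) * Real.exp (K * (t - t₀)) := by
  have h := norm_le_gronwallBound_of_norm_deriv_right_le (f := g) (f' := g') (δ := ‖g t₀‖)
    (K := K) (ε := ε) (a := t₀) (b := t)
    (fun s hs => (hg s hs).continuousAt.continuousWithinAt)
    (fun s hs => (hg s (Set.Ico_subset_Icc_self hs)).hasDerivWithinAt) le_rfl
    (fun s hs => hb s (Set.Ico_subset_Icc_self hs)) t ⟨ht, le_rfl⟩
  refine h.trans ?_
  rw [gronwallBound_of_K_ne_0 (by positivity)]
  have h1 : ε / K ≤ ε := div_le_self hε hK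
  have h2 : 1 ≤ Real.exp (K * (t - t₀)) :=
    Real.one_le_exp (mul_nonneg (by linarith) (sub_nonneg.2 ht))
  have h3 : ε / K * (Real.exp (K * (t - t₀)) - 1) ≤ ε * (Real.exp (K * (t - t₀)) - 1) :=
    mul_le_mul_of_nonneg_right h1 (by linarith)
  nlinarith

/-- Grönwall's inequality on both sides of the initial time. -/
theorem norm_le_of_norm_deriv_le {g g' : ℝ → E} {t₀ δ K ε : ℝ}
    (hg : ∀ t, |t - t₀| < δ → HasDerivAt g (g' t) t) (hK : 1 ≤ K) (hε : 0 ≤ ε)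
    (hb : ∀ t, |t - t₀| < δ → ‖g' t‖ ≤ K * ‖g t‖ + ε) {t : ℝ} (ht : |t - t₀| < δ) :
    ‖g t‖ ≤ (‖g t₀‖ + ε) * Real.exp (K * δ) := by
  have key : ‖g t‖ ≤ (‖g t₀‖ + ε) * Real.exp (K * |t - t₀|) := by
    rcases le_total t₀ t with h | h
    · rw [abs_of_nonneg (sub_nonneg.2 h)] at ht ⊢
      have hs : ∀ s ∈ Set.Icc t₀ t, |s - t₀| < δ := fun s hs => by
        rw [abs_of_nonneg (sub_nonneg.2 hs.1)]; linarith [hs.2]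
      exact norm_le_of_norm_deriv_le_right h (fun s h => hg s (hs s h)) hK hε
        fun s h => hb s (hs s h)
    · rw [abs_of_nonpos (sub_nonpos.2 h)] at ht ⊢
      have hs : ∀ s ∈ Set.Icc (-t₀) (-t), |-s - t₀| < δ := fun s hs => by
        rw [abs_of_nonpos (by linarith [hs.1])]; linarith [hs.2]
      have := norm_le_of_norm_deriv_le_right (g := fun s => g (-s)) (g' := fun s => -g' (-s))
        (neg_le_neg h) (fun s h => by
          have := (hg _ (hs s h)).scomp s (hasDerivAt_neg s)
          simpa [Function.comp_def] using this) hK hε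
        (fun s h => by rw [norm_neg]; exact hb _ (hs s h))
      simp only [neg_neg] at this
      refine this.trans (le_of_eq ?_)
      congr 2
      ring
  refine key.trans (mul_le_mul_of_nonneg_left (Real.exp_le_exp.2 ?_) (by positivity))
  exact mul_le_mul_of_nonneg_left ht.le (by linarith)

/-- A linear differential equation with bounded coefficient is solvable on an interval whose length
depends only on the bound. -/
theorem exists_linear_solution [CompleteSpace E] {T : ℝ → E →L[ℝ] E} {t₀ δ K : ℝ}
    (hT : Continuous T) (hδ : 0 < δ) (hK : 0 ≤ K) (hKδ : 2 * (K * δ) ≤ 1)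
    (hb : ∀ t, |t - t₀| ≤ δ → ‖T t‖ ≤ K) (v : E) :
    ∃ g : ℝ → E, g t₀ = v ∧ ∀ t, |t - t₀| < δ → HasDerivAt g (T t (g t)) t := by
  have hm : ∀ t ∈ Set.Icc (t₀ - δ) (t₀ + δ), ‖T t‖ ≤ K := fun t ht =>
    hb t (abs_le.2 ⟨by linarith [ht.1], by linarith [ht.2]⟩)
  have hP : IsPicardLindelof (fun t w => T t w) (tmin := t₀ - δ) (tmax := t₀ + δ)
      ⟨t₀, by constructor <;> linarith⟩ v ‖v‖₊ 0 (⟨K, hK⟩ * (2 * ‖v‖₊)) ⟨K, hK⟩ := by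
    refine ⟨fun t ht => ?_, fun x _ => ?_, fun t ht x hx => ?_, ?_⟩
    · refine ((T t).lipschitz.weaken (K' := ⟨K, hK⟩) ?_).lipschitzOnWith
      exact hm t ht
    · exact (hT.clm_apply continuous_const).continuousOn
    · have h1 : ‖x‖ ≤ 2 * ‖v‖ := by
        have := norm_le_norm_add_norm_sub v x
        have h2 : ‖x - v‖ ≤ ‖v‖ := by simpa [dist_eq_norm] using hx
        rw [norm_sub_rev] at h2
        linarith [norm_sub_norm_le x v, norm_sub_rev x v]
      exact ((T t).le_of_opNorm_le (hm t ht) x).trans (mul_le_mul_of_nonneg_left h1 hK)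
    · simp only [add_sub_cancel_left, sub_sub_cancel, max_self, NNReal.coe_zero, sub_zero]
      change K * (2 * ‖v‖) * δ ≤ ‖v‖
      nlinarith [norm_nonneg v]
  obtain ⟨g, h0, hg⟩ := hP.exists_eq_forall_mem_Icc_hasDerivWithinAt₀
  refine ⟨g, h0, fun t ht => ?_⟩
  rw [abs_lt] at ht
  exact (hg t ⟨by linarith, by linarith⟩).hasDerivAt
    (Icc_mem_nhds (by linarith) (by linarith))

/-- Compatible linear systems: if `X_t + X T = T_x + T X`, a family of solutions of `f_t = T f`
that solves `f_x = X f` at one time solves it at all times. -/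
theorem hasDerivAt_of_compatible {X Xt T Tx : ℝ → ℝ → E →L[ℝ] E}
    (hX : ∀ x t, HasDerivAt (fun t => X x t) (Xt x t) t)
    (hT : ∀ x t, HasDerivAt (fun x => T x t) (Tx x t) x)
    (hTc : Continuous fun p : ℝ × ℝ => T p.1 p.2)
    (hTxc : Continuous fun p : ℝ × ℝ => Tx p.1 p.2)
    (hz : ∀ x t v, Xt x t v + X x t (T x t v) = Tx x t v + T x t (X x t v))
    {f : ℝ → ℝ → E} {t₀ δ : ℝ}
    (hft : ∀ x t, |t - t₀| < δ → HasDerivAt (fun t => f x t) (T x t (f x t)) t)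
    (hfx : ∀ x, HasDerivAt (fun x => f x t₀) (X x t₀ (f x t₀)) x)
    (x₀ : ℝ) {t : ℝ} (ht : |t - t₀| < δ) :
    HasDerivAt (fun x => f x t) (X x₀ t (f x₀ t)) x₀ := by
  obtain ⟨δ', h1, h2⟩ := exists_between ht
  have hδ' : 0 ≤ δ' := (abs_nonneg _).trans h1.le
  have hin : ∀ s, |s - t₀| < δ' → |s - t₀| < δ := fun s hs => hs.trans h2
  have hcpt : IsCompact (Set.Icc (t₀ - δ') (t₀ + δ')) := isCompact_Icc
  have hmem : ∀ s, |s - t₀| < δ' → s ∈ Set.Icc (t₀ - δ') (t₀ + δ') := fun s hs => by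
    rw [abs_lt] at hs; constructor <;> linarith
  have hXc : ∀ x, Continuous fun t => X x t := fun x =>
    continuous_iff_continuousAt.2 fun t => (hX x t).continuousAt
  have hfc : ContinuousOn (fun s => f x₀ s) (Set.Icc (t₀ - δ') (t₀ + δ')) := fun s hs =>
    (hft x₀ s (lt_of_le_of_lt (abs_le.2 ⟨by linarith [hs.1], by linarith [hs.2]⟩)
      h2)).continuousAt.continuousWithinAt
  obtain ⟨F, hF⟩ := (hcpt.image_of_continuousOn hfc.norm).bddAbove
  obtain ⟨Y, hY⟩ := (hcpt.image_of_continuousOn (hXc x₀).norm.continuousOn).bddAbove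
  have hF' : ∀ s, |s - t₀| < δ' → ‖f x₀ s‖ ≤ F := fun s hs => hF ⟨s, hmem s hs, rfl⟩
  have hY' : ∀ s, |s - t₀| < δ' → ‖X x₀ s‖ ≤ Y := fun s hs => hY ⟨s, hmem s hs, rfl⟩
  have hF0 : 0 ≤ F := (norm_nonneg _).trans (hF' t h1)
  have hY0 : 0 ≤ Y := (norm_nonneg _).trans (hY' t h1)
  obtain ⟨B, hB⟩ := (((isCompact_Icc (a := x₀ - 1) (b := x₀ + 1)).prod hcpt).image
    hTc.norm).bddAbove
  set K := max B 1 with hKdef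
  have hK1 : 1 ≤ K := le_max_right _ _
  have hTK : ∀ x s, |x - x₀| ≤ 1 → |s - t₀| < δ' → ‖T x s‖ ≤ K := fun x s hx hs => by
    rw [abs_le] at hx
    exact (hB ⟨(x, s), ⟨⟨by linarith, by linarith⟩, hmem s hs⟩, rfl⟩).trans (le_max_left _ _)
  -- uniformly in time, `T` and `T_x` are continuous at `x₀`
  have hunif : ∀ (S : ℝ → ℝ → E →L[ℝ] E), Continuous (fun p : ℝ × ℝ => S p.1 p.2) → ∀ η > 0,
      ∃ r > 0, ∀ x s, |x - x₀| < r → |s - t₀| < δ' → ‖S x s - S x₀ s‖ ≤ η := by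
    intro S hS η hη
    have hev := hcpt.eventually_forall_of_forall_eventually (x₀ := x₀)
      (P := fun x s => ‖S x s - S x₀ s‖ < η) (fun s hs => by
        have hc : Continuous fun p : ℝ × ℝ => ‖S p.1 p.2 - S x₀ p.2‖ :=
          (hS.sub (hS.comp (continuous_const.prodMk continuous_snd))).norm
        have := hc.tendsto (x₀, s)
        simp only [sub_self, norm_zero] at this
        exact this.eventually (gt_mem_nhds hη))
    obtain ⟨r, hr, hrr⟩ := Metric.eventually_nhds_iff.1 hev
    exact ⟨r, hr, fun x s hx hs => (hrr (by rwa [Real.dist_eq]) s (hmem s hs)).le⟩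
  rw [hasDerivAt_iff_isLittleO, Asymptotics.isLittleO_iff]
  intro c hc
  set M := Real.exp (K * δ') with hM
  have hM0 : 0 < M := Real.exp_pos _
  set η := c / (M * (1 + F + Y * F)) with hη
  have hη0 : 0 < η := by positivity
  obtain ⟨r1, hr1, hTx'⟩ := hunif Tx hTxc η hη0
  obtain ⟨r2, hr2, hT'⟩ := hunif T hTc η hη0
  have hfx' := (hasDerivAt_iff_isLittleO.1 (hfx x₀)).bound hη0
  filter_upwards [hfx', Metric.ball_mem_nhds x₀ hr1, Metric.ball_mem_nhds x₀ hr2,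
    Metric.closedBall_mem_nhds x₀ one_pos] with x hx hx1 hx2 hx3
  rw [Metric.mem_ball, Real.dist_eq] at hx1 hx2
  rw [Metric.mem_closedBall, Real.dist_eq] at hx3
  -- the remainder solves an equation in time with a small right hand side
  have hg : ∀ s, |s - t₀| < δ' → HasDerivAt
      (fun s => f x s - f x₀ s - (x - x₀) • X x₀ s (f x₀ s))
      (T x s (f x s) - T x₀ s (f x₀ s) - (x - x₀) • (Xt x₀ s (f x₀ s) +
        X x₀ s (T x₀ s (f x₀ s)))) s := fun s hs =>
    ((hft x s (hin s hs)).sub (hft x₀ s (hin s hs))).sub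
      (((hX x₀ s).clm_apply (hft x₀ s (hin s hs))).const_smul _)
  have hT1 : ∀ s, |s - t₀| < δ' → ‖T x s - T x₀ s - (x - x₀) • Tx x₀ s‖ ≤ η * |x - x₀| := by
    intro s hs
    have := Convex.norm_image_sub_le_of_norm_hasDerivWithin_le (s := Metric.ball x₀ r1)
      (f := fun y => T y s - (y - x₀) • Tx x₀ s) (f' := fun y => Tx y s - Tx x₀ s) (C := η)
      (x := x₀) (y := x) (fun y _ => by
        have := ((hasDerivAt_id y).sub_const x₀).smul_const (Tx x₀ s)
        rw [one_smul] at this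
        exact ((hT y s).sub this).hasDerivWithinAt)
      (fun y hy => hTx' y s (by rwa [Metric.mem_ball, Real.dist_eq] at hy) hs)
      (convex_ball x₀ r1) (Metric.mem_ball_self hr1) (by rwa [Metric.mem_ball, Real.dist_eq])
    simpa [sub_right_comm] using this
  have hbd : ∀ s, |s - t₀| < δ' → ‖T x s (f x s) - T x₀ s (f x₀ s) - (x - x₀) •
      (Xt x₀ s (f x₀ s) + X x₀ s (T x₀ s (f x₀ s)))‖ ≤
      K * ‖f x s - f x₀ s - (x - x₀) • X x₀ s (f x₀ s)‖ + η * |x - x₀| * (F + Y * F) := by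
    intro s hs
    have e : T x s (f x s) - T x₀ s (f x₀ s) - (x - x₀) •
        (Xt x₀ s (f x₀ s) + X x₀ s (T x₀ s (f x₀ s))) =
        T x s (f x s - f x₀ s - (x - x₀) • X x₀ s (f x₀ s)) +
        ((T x s - T x₀ s - (x - x₀) • Tx x₀ s) (f x₀ s) +
          (x - x₀) • (T x s - T x₀ s) (X x₀ s (f x₀ s))) := by
      rw [hz]
      simp only [map_sub, map_smul, _root_.sub_apply, _root_.smul_apply,
        smul_add, smul_sub]
      abel
    rw [e]
    refine (norm_add_le _ _).trans (add_le_add ((T x s).le_of_opNorm_le (hTK x s hx3 hs) _)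
      ((norm_add_le _ _).trans ?_))
    rw [mul_add]
    have h3 : ‖X x₀ s (f x₀ s)‖ ≤ Y * F := (X x₀ s).le_of_opNorm_le_of_le (hY' s hs) (hF' s hs)
    refine add_le_add (ContinuousLinearMap.le_of_opNorm_le_of_le _ (hT1 s hs) (hF' s hs)) ?_
    rw [norm_smul, Real.norm_eq_abs, mul_comm η, mul_assoc]
    exact mul_le_mul_of_nonneg_left
      (ContinuousLinearMap.le_of_opNorm_le_of_le _ (hT' x s hx2 hs) h3) (abs_nonneg _)
  have hfin := norm_le_of_norm_deriv_le hg hK1 (by positivity) hbd h1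
  refine hfin.trans ?_
  rw [Real.norm_eq_abs] at hx ⊢
  calc _ ≤ (η * |x - x₀| + η * |x - x₀| * (F + Y * F)) * M :=
        mul_le_mul_of_nonneg_right (add_le_add hx le_rfl) hM0.le
    _ = η * (M * (1 + F + Y * F)) * |x - x₀| := by ring
    _ = c * |x - x₀| := by rw [hη, div_mul_cancel₀ _ (by positivity)]

/-- Solutions of linear equations depending on a parameter `x`, whose data tend to zero along a
filter, tend to zero. -/
theorem tendsto_zero_of_linear {F : Filter ℝ} {S : ℝ → ℝ → E →L[ℝ] E} {r k : ℝ → ℝ → E}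
    {t₀ δ K : ℝ} (hK : ∀ᶠ x in F, ∀ t, |t - t₀| < δ → ‖S x t‖ ≤ K)
    (hr : ∀ ε > 0, ∀ᶠ x in F, ∀ t, |t - t₀| < δ → ‖r x t‖ ≤ ε)
    (hk : ∀ x t, |t - t₀| < δ → HasDerivAt (fun t => k x t) (S x t (k x t) + r x t) t)
    (h0 : Tendsto (fun x => k x t₀) F (𝓝 0)) {t : ℝ} (ht : |t - t₀| < δ) :
    Tendsto (fun x => k x t) F (𝓝 0) := by
  rw [NormedAddGroup.tendsto_nhds_zero] at h0 ⊢
  intro ε hε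
  set M := Real.exp (max K 1 * δ)
  have hM0 : 0 < M := Real.exp_pos _
  filter_upwards [hK, hr (ε / (3 * M)) (by positivity), h0 (ε / (3 * M)) (by positivity)]
    with x h1 h2 h3
  have := norm_le_of_norm_deriv_le (hk x) (le_max_right K 1) (by positivity : 0 ≤ ε / (3 * M))
    (fun s hs => (norm_add_le _ _).trans (add_le_add
      ((S x s).le_of_opNorm_le ((h1 s hs).trans (le_max_left _ _)) _) (h2 s hs))) ht
  refine this.trans_lt ?_
  have h4 : (‖k x t₀‖ + ε / (3 * M)) * M ≤ (ε / (3 * M) + ε / (3 * M)) * M :=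
    mul_le_mul_of_nonneg_right (by linarith) hM0.le
  refine h4.trans_lt ?_
  have : (ε / (3 * M) + ε / (3 * M)) * M = 2 / 3 * ε := by field_simp; ring
  rw [this]
  linarith

end Compatible

/-! ### Time evolution of the Jost columns -/

/-- A complex matrix as a real-linear operator on `ℂ²`. -/
noncomputable def matOp (M : Matrix (Fin 2) (Fin 2) ℂ) : (Fin 2 → ℂ) →L[ℝ] (Fin 2 → ℂ) :=
  (M.mulVecLin.restrictScalars ℝ).toContinuousLinearMap

/-- The traceless matrix with rows `(a, b)` and `(c, -a)`, as a real-linear operator on `ℂ²`. -/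
noncomputable def traceless (a b c : ℂ) : (Fin 2 → ℂ) →L[ℝ] (Fin 2 → ℂ) :=
  a • matOp !![1, 0; 0, -1] + b • matOp !![0, 1; 0, 0] + c • matOp !![0, 0; 1, 0]

theorem traceless_apply (a b c : ℂ) (v : Fin 2 → ℂ) :
    traceless a b c v = ![a * v 0 + b * v 1, c * v 0 - a * v 1] := by
  funext i
  fin_cases i <;> simp [traceless, matOp, dotProduct, Fin.sum_univ_two]
  ring

theorem continuous_traceless {X : Type*} [TopologicalSpace X] {a b c : X → ℂ} (ha : Continuous a)
    (hb : Continuous b) (hc : Continuous c) : Continuous fun p => traceless (a p) (b p) (c p) := by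
  unfold traceless
  exact ((ha.smul continuous_const).add (hb.smul continuous_const)).add (hc.smul continuous_const)

theorem hasDerivAt_traceless {a b c : ℝ → ℂ} {a' b' c' : ℂ} {x : ℝ} (ha : HasDerivAt a a' x)
    (hb : HasDerivAt b b' x) (hc : HasDerivAt c c' x) :
    HasDerivAt (fun x => traceless (a x) (b x) (c x)) (traceless a' b' c') x := by
  unfold traceless
  exact ((ha.smul_const (matOp !![1, 0; 0, -1])).add (hb.smul_const (matOp !![0, 1; 0, 0]))).add
    (hc.smul_const (matOp !![0, 0; 1, 0]))

section XDeriv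

/-- The `k`-th derivative in `x`. -/
noncomputable def xDeriv (q : ℝ → ℝ → ℂ) (k : ℕ) (x t : ℝ) : ℂ :=
  iteratedDeriv k (fun y => q y t) x

variable {q : ℝ → ℝ → ℂ}

theorem contDiff_xDeriv {n : ℕ} (h : ContDiff ℝ n fun p : ℝ × ℝ => q p.1 p.2) {k m : ℕ}
    (hk : k + m ≤ n) : ContDiff ℝ m fun p : ℝ × ℝ => xDeriv q k p.1 p.2 := by
  induction k generalizing m with
  | zero =>
    simp only [xDeriv, iteratedDeriv_zero]
    exact h.of_le (by exact_mod_cast (by omega : m ≤ n))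
  | succ k ih =>
    have h1 : ContDiff ℝ (m + 1 : ℕ) fun p : ℝ × ℝ => xDeriv q k p.1 p.2 := ih (by omega)
    have h2 : ∀ p : ℝ × ℝ, xDeriv q (k + 1) p.1 p.2 =
        fderiv ℝ (fun p : ℝ × ℝ => xDeriv q k p.1 p.2) p (1, 0) := fun p => by
      have hd := (h1.differentiable (by simp) p).hasFDerivAt
      have hc : HasDerivAt (fun x : ℝ => (x, p.2)) (1, 0) p.1 :=
        (hasDerivAt_id p.1).prodMk (hasDerivAt_const _ _)
      have := hd.comp_hasDerivAt p.1 hc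
      unfold xDeriv at this ⊢
      rw [iteratedDeriv_succ]
      exact this.deriv
    simp_rw [h2]
    exact (h1.fderiv_right (by norm_cast)).clm_apply contDiff_const

theorem hasDerivAt_xDeriv {n : ℕ} (h : ContDiff ℝ n fun p : ℝ × ℝ => q p.1 p.2) {k : ℕ}
    (hk : k < n) (x t : ℝ) :
    HasDerivAt (fun x => xDeriv q k x t) (xDeriv q (k + 1) x t) x := by
  have h1 : ContDiff ℝ (1 : ℕ) fun p : ℝ × ℝ => xDeriv q k p.1 p.2 := contDiff_xDeriv h (by omega)
  have h2 : ContDiff ℝ (1 : ℕ) fun x : ℝ => xDeriv q k x t :=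
    h1.comp (contDiff_id.prodMk contDiff_const)
  have := (h2.differentiable (by simp) x).hasDerivAt
  unfold xDeriv at this ⊢
  rwa [iteratedDeriv_succ]

end XDeriv

/-- The upper left entry of the time part of the Lax pair, as a function of `λ` and of the jet of
`q`. -/
noncomputable def timeDiag (l q q₁ : ℂ) : ℂ :=
  4 * I * l ^ 6 - 2 * I * q * conj q * l ^ 4 +
    l ^ 2 * (3 * I / 2 * q ^ 2 * conj q ^ 2 + q * conj q₁ - q₁ * conj q)

/-- The upper right entry of the time part of the Lax pair. -/
noncomputable def timeUpper (l q q₁ q₂ : ℂ) : ℂ :=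
  4 * l ^ 5 * q + l ^ 3 * (-2 * q ^ 2 * conj q - 2 * I * q₁) +
    l * (3 / 2 * q ^ 3 * conj q ^ 2 + 3 * I * q * conj q * q₁ - q₂)

/-- The lower left entry of the time part of the Lax pair. -/
noncomputable def timeLower (l q q₁ q₂ : ℂ) : ℂ :=
  -4 * l ^ 5 * conj q + l ^ 3 * (2 * q * conj q ^ 2 - 2 * I * conj q₁) +
    l * (-(3 / 2) * q ^ 2 * conj q ^ 3 + 3 * I * q * conj q * conj q₁ + conj q₂)

/-- The time part of the Lax pair. -/
noncomputable def laxT (q : ℝ → ℝ → ℂ) (l : ℂ) (x t : ℝ) : (Fin 2 → ℂ) →L[ℝ] (Fin 2 → ℂ) :=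
  traceless (timeDiag l (q x t) (xDeriv q 1 x t))
    (timeUpper l (q x t) (xDeriv q 1 x t) (xDeriv q 2 x t))
    (timeLower l (q x t) (xDeriv q 1 x t) (xDeriv q 2 x t))

variable {q : ℝ → ℝ → ℂ}

theorem laxX_eq_traceless (l : ℂ) (x t : ℝ) (v : Fin 2 → ℂ) :
    (laxX q l x t).mulVec v =
      traceless (I * l ^ 2) (l * q x t) (-(l * conj (q x t))) v := by
  rw [laxX_mulVec, traceless_apply]

theorem IsDecayingSolution.hasDerivAt_zero (hq : IsDecayingSolution q) (x t : ℝ) :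
    HasDerivAt (fun x => q x t) (xDeriv q 1 x t) x := by
  have := hasDerivAt_xDeriv (n := 3) hq.contDiff (k := 0) (by norm_num) x t
  simpa only [xDeriv, iteratedDeriv_zero] using this

theorem IsDecayingSolution.hasDerivAt_time (hq : IsDecayingSolution q) (x t : ℝ) :
    HasDerivAt (fun t => q x t) (deriv (fun t => q x t) t) t := by
  have h2 : ContDiff ℝ 3 fun s : ℝ => q x s := hq.contDiff.comp (contDiff_const.prodMk contDiff_id)
  exact (h2.differentiable (by norm_num) t).hasDerivAt

/-- The flow equation with the products differentiated. -/
theorem IsDecayingSolution.time_deriv (hq : IsDecayingSolution q) (x t : ℝ) :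
    deriv (fun t => q x t) t = -xDeriv q 3 x t +
      3 * I * (xDeriv q 1 x t ^ 2 * conj (q x t) + q x t * conj (xDeriv q 1 x t) * xDeriv q 1 x t
        + q x t * conj (q x t) * xDeriv q 2 x t) +
      3 / 2 * (3 * q x t ^ 2 * conj (q x t) ^ 2 * xDeriv q 1 x t +
        2 * q x t ^ 3 * conj (q x t) * conj (xDeriv q 1 x t)) := by
  have h0 := hq.hasDerivAt_zero x t
  have h1 := hasDerivAt_xDeriv (n := 3) hq.contDiff (k := 1) (by norm_num) x t
  have hc : HasDerivAt (fun x => conj (q x t)) (conj (xDeriv q 1 x t)) x := h0.star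
  have hn : ∀ z : ℂ, (‖z‖ : ℂ) ^ 2 = z * conj z := fun z => by rw [mul_conj']
  have e1 : (fun y => (‖q y t‖ : ℂ) ^ 2 * deriv (fun w => q w t) y) =
      fun y => q y t * conj (q y t) * xDeriv q 1 y t := by
    funext y
    rw [hn, (hq.hasDerivAt_zero y t).deriv]
  have e2 : (fun y => (‖q y t‖ : ℂ) ^ 4 * q y t) =
      fun y => q y t ^ 3 * conj (q y t) ^ 2 := by
    funext y
    rw [show (‖q y t‖ : ℂ) ^ 4 = ((‖q y t‖ : ℂ) ^ 2) ^ 2 by ring, hn]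
    ring
  have d1 := ((h0.mul hc).mul h1).deriv
  have d2 := ((h0.pow 3).mul (hc.pow 2)).deriv
  have h := hq.equation x t
  rw [e1, e2] at h
  change _ = _ at d1 d2
  have d1' : deriv (fun y => q y t * conj (q y t) * xDeriv q 1 y t) x = _ := d1
  have d2' : deriv (fun y => q y t ^ 3 * conj (q y t) ^ 2) x = _ := d2
  rw [d1', d2'] at h
  simp only [Pi.mul_apply, Pi.pow_apply] at h
  change deriv (fun t => q x t) t + xDeriv q 3 x t - _ - _ = 0 at h
  push_cast at h
  linear_combination h

/-- The time part of the Lax pair depends continuously on the jet of `q`. -/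
theorem continuous_timePart {X : Type*} [TopologicalSpace X] {l q₀ q₁ q₂ : X → ℂ}
    (hl : Continuous l) (h0 : Continuous q₀) (h1 : Continuous q₁) (h2 : Continuous q₂) :
    Continuous fun p => traceless (timeDiag (l p) (q₀ p) (q₁ p))
      (timeUpper (l p) (q₀ p) (q₁ p) (q₂ p)) (timeLower (l p) (q₀ p) (q₁ p) (q₂ p)) := by
  have k0 : Continuous fun p => conj (q₀ p) := continuous_conj.comp h0
  have k1 : Continuous fun p => conj (q₁ p) := continuous_conj.comp h1
  have k2 : Continuous fun p => conj (q₂ p) := continuous_conj.comp h2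
  refine continuous_traceless ?_ ?_ ?_
  · unfold timeDiag; fun_prop
  · unfold timeUpper; fun_prop
  · unfold timeLower; fun_prop

theorem continuous_laxT (hq : IsDecayingSolution q) (l : ℂ) :
    Continuous fun p : ℝ × ℝ => laxT q l p.1 p.2 := by
  have h0 : Continuous fun p : ℝ × ℝ => q p.1 p.2 := hq.contDiff.continuous
  have h1 : Continuous fun p : ℝ × ℝ => xDeriv q 1 p.1 p.2 :=
    (contDiff_xDeriv (n := 3) hq.contDiff (k := 1) (m := 0) (by norm_num)).continuous
  have h2 : Continuous fun p : ℝ × ℝ => xDeriv q 2 p.1 p.2 :=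
    (contDiff_xDeriv (n := 3) hq.contDiff (k := 2) (m := 0) (by norm_num)).continuous
  exact continuous_timePart (l := fun _ => l) continuous_const h0 h1 h2

/-- The derivative of the time part in `x`, together with its continuity and the zero curvature
condition `X_t + X T = T_x + T X`. -/
theorem exists_zero_curvature (hq : IsDecayingSolution q) (l : ℂ) :
    ∃ Tx : ℝ → ℝ → (Fin 2 → ℂ) →L[ℝ] (Fin 2 → ℂ),
      (∀ x t, HasDerivAt (fun x => laxT q l x t) (Tx x t) x) ∧
      (Continuous fun p : ℝ × ℝ => Tx p.1 p.2) ∧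
      ∀ x t v, traceless 0 (l * deriv (fun t => q x t) t) (-(l * conj (deriv (fun t => q x t) t))) v +
          traceless (I * l ^ 2) (l * q x t) (-(l * conj (q x t))) (laxT q l x t v) =
        Tx x t v +
          laxT q l x t (traceless (I * l ^ 2) (l * q x t) (-(l * conj (q x t))) v) := by
  refine ⟨fun x t =>
    let q₀ := q x t
    let q₁ := xDeriv q 1 x t
    let q₂ := xDeriv q 2 x t
    let q₃ := xDeriv q 3 x t
    traceless
      (-(2 * I * (q₁ * conj q₀ + q₀ * conj q₁) * l ^ 4) +
        l ^ 2 * (3 * I * (q₀ * q₁ * conj q₀ ^ 2 + q₀ ^ 2 * conj q₀ * conj q₁) + q₀ * conj q₂ -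
          q₂ * conj q₀))
      (4 * l ^ 5 * q₁ + l ^ 3 * (-4 * q₀ * q₁ * conj q₀ - 2 * q₀ ^ 2 * conj q₁ - 2 * I * q₂) +
        l * (9 / 2 * q₀ ^ 2 * q₁ * conj q₀ ^ 2 + 3 * q₀ ^ 3 * conj q₀ * conj q₁ +
          3 * I * (q₁ * conj q₀ * q₁ + q₀ * conj q₁ * q₁ + q₀ * conj q₀ * q₂) - q₃))
      (-4 * l ^ 5 * conj q₁ + l ^ 3 * (2 * q₁ * conj q₀ ^ 2 + 4 * q₀ * conj q₀ * conj q₁ -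
          2 * I * conj q₂) +
        l * (-(3 * q₀ * q₁ * conj q₀ ^ 3 + 9 / 2 * q₀ ^ 2 * conj q₀ ^ 2 * conj q₁) +
          3 * I * (q₁ * conj q₀ * conj q₁ + q₀ * conj q₁ * conj q₁ + q₀ * conj q₀ * conj q₂) +
          conj q₃)), fun x t => ?_, ?_, fun x t v => ?_⟩
  · have h0 := hq.hasDerivAt_zero x t
    have h1 := hasDerivAt_xDeriv (n := 3) hq.contDiff (k := 1) (by norm_num) x t
    have h2 := hasDerivAt_xDeriv (n := 3) hq.contDiff (k := 2) (by norm_num) x t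
    have c0 : HasDerivAt (fun x => conj (q x t)) (conj (xDeriv q 1 x t)) x := h0.star
    have c1 : HasDerivAt (fun x => conj (xDeriv q 1 x t)) (conj (xDeriv q 2 x t)) x := h1.star
    have c2 : HasDerivAt (fun x => conj (xDeriv q 2 x t)) (conj (xDeriv q 3 x t)) x := h2.star
    refine hasDerivAt_traceless ?_ ?_ ?_
    · refine (((((h0.const_mul (2 * I)).mul c0).mul_const (l ^ 4)).const_sub (4 * I * l ^ 6)).add
        ((((((h0.pow 2).const_mul (3 * I / 2)).mul (c0.pow 2)).add (h0.mul c1)).sub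
          (h1.mul c0)).const_mul (l ^ 2))).congr_deriv ?_
      simp only [Pi.pow_apply]
      push_cast
      ring
    · refine (((h0.const_mul (4 * l ^ 5)).add (((((h0.pow 2).const_mul (-2)).mul c0).sub
        (h1.const_mul (2 * I))).const_mul (l ^ 3))).add
        (((((h0.pow 3).const_mul (3 / 2)).mul (c0.pow 2)).add
          (((h0.const_mul (3 * I)).mul c0).mul h1) |>.sub h2).const_mul l)).congr_deriv ?_
      simp only [Pi.pow_apply, Pi.mul_apply]
      push_cast
      ring
    · refine (((c0.const_mul (-4 * l ^ 5)).add ((((h0.const_mul 2).mul (c0.pow 2)).sub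
        (c1.const_mul (2 * I))).const_mul (l ^ 3))).add
        (((((h0.pow 2).const_mul (-(3 / 2))).mul (c0.pow 3)).add
          (((h0.const_mul (3 * I)).mul c0).mul c1) |>.add c2).const_mul l)).congr_deriv ?_
      simp only [Pi.pow_apply, Pi.mul_apply]
      push_cast
      ring
  · have h0 : Continuous fun p : ℝ × ℝ => q p.1 p.2 := hq.contDiff.continuous
    have h1 : Continuous fun p : ℝ × ℝ => xDeriv q 1 p.1 p.2 :=
      (contDiff_xDeriv (n := 3) hq.contDiff (k := 1) (m := 0) (by norm_num)).continuous
    have h2 : Continuous fun p : ℝ × ℝ => xDeriv q 2 p.1 p.2 :=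
      (contDiff_xDeriv (n := 3) hq.contDiff (k := 2) (m := 0) (by norm_num)).continuous
    have h3 : Continuous fun p : ℝ × ℝ => xDeriv q 3 p.1 p.2 :=
      (contDiff_xDeriv (n := 3) hq.contDiff (k := 3) (m := 0) (by norm_num)).continuous
    have k0 := continuous_conj.comp h0
    have k1 := continuous_conj.comp h1
    have k2 := continuous_conj.comp h2
    have k3 := continuous_conj.comp h3
    simp only [Function.comp_def] at k0 k1 k2 k3
    exact continuous_traceless (by fun_prop) (by fun_prop) (by fun_prop)
  · have ht := hq.time_deriv x t
    have htc := congrArg conj ht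
    simp only [map_add, map_mul, map_neg, map_pow, map_div₀, conj_conj, conj_I, map_ofNat] at htc
    simp only [laxT, traceless_apply]
    rw [htc, ht]
    unfold timeDiag timeUpper timeLower
    have hI : I ^ 2 = -1 := I_sq
    funext i
    fin_cases i
    · simp only [Pi.add_apply, Fin.zero_eta, Matrix.cons_val_zero, Matrix.cons_val_one]
      ring_nf
      simp only [hI]
      ring
    · simp only [Pi.add_apply, Fin.mk_one, Matrix.cons_val_zero, Matrix.cons_val_one]
      ring_nf
      simp only [hI]
      ring

/-- At spatial infinity the time part tends to `4 i λ⁶ σ₃`, locally uniformly in time. -/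
theorem laxT_eventually_near (hq : IsDecayingSolution q) (l : ℂ) {K : Set ℝ} (hK : IsCompact K)
    {ε : ℝ} (hε : 0 < ε) :
    ∀ᶠ x in cocompact ℝ, ∀ t ∈ K, ‖laxT q l x t - traceless (4 * I * l ^ 6) 0 0‖ < ε := by
  have key : ∀ t₀ ∈ K, {p : ℝ × ℝ | ‖laxT q l p.1 p.2 - traceless (4 * I * l ^ 6) 0 0‖ < ε} ∈
      cocompact ℝ ×ˢ 𝓝 t₀ := by
    intro t₀ _
    have h0 : Tendsto (fun p : ℝ × ℝ => q p.1 p.2) (cocompact ℝ ×ˢ 𝓝 t₀) (𝓝 0) := by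
      simpa only [iteratedDeriv_zero] using hq.tendsto_zero 0 (by norm_num) t₀
    have h1 : Tendsto (fun p : ℝ × ℝ => xDeriv q 1 p.1 p.2) (cocompact ℝ ×ˢ 𝓝 t₀) (𝓝 0) :=
      hq.tendsto_zero 1 (by norm_num) t₀
    have h2 : Tendsto (fun p : ℝ × ℝ => xDeriv q 2 p.1 p.2) (cocompact ℝ ×ˢ 𝓝 t₀) (𝓝 0) :=
      hq.tendsto_zero 2 (by norm_num) t₀
    have hc : Continuous fun p : ℂ × ℂ × ℂ => traceless (timeDiag l p.1 p.2.1)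
        (timeUpper l p.1 p.2.1 p.2.2) (timeLower l p.1 p.2.1 p.2.2) :=
      continuous_timePart (l := fun _ => l) continuous_const continuous_fst (continuous_fst.comp continuous_snd)
        (continuous_snd.comp continuous_snd)
    have h := (hc.tendsto (0, 0, 0)).comp (h0.prodMk_nhds (h1.prodMk_nhds h2))
    have e : traceless (timeDiag l 0 0) (timeUpper l 0 0 0) (timeLower l 0 0 0) =
        traceless (4 * I * l ^ 6) 0 0 := by
      simp [timeDiag, timeUpper, timeLower]
    simp only [e] at h
    have := (tendsto_iff_norm_sub_tendsto_zero.1 h).eventually (gt_mem_nhds hε)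
    exact this
  have h1 := hK.mem_prod_nhdsSet_of_forall key
  have h2 : ∀ᶠ p in cocompact ℝ ×ˢ 𝓟 K,
      ‖laxT q l p.1 p.2 - traceless (4 * I * l ^ 6) 0 0‖ < ε :=
    (Filter.prod_mono le_rfl principal_le_nhdsSet) h1
  exact eventually_prod_principal_iff.1 h2

theorem exists_laxT_bound (hq : IsDecayingSolution q) (l : ℂ) {K : Set ℝ} (hK : IsCompact K) :
    ∃ C : ℝ, ∀ x, ∀ t ∈ K, ‖laxT q l x t‖ ≤ C := by
  obtain ⟨S, hS, hS'⟩ := mem_cocompact.1 (laxT_eventually_near hq l hK one_pos)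
  obtain ⟨B, hB⟩ := ((hS.prod hK).image (continuous_laxT hq l).norm).bddAbove
  refine ⟨max B (1 + ‖traceless (4 * I * l ^ 6) 0 0‖), fun x t ht => ?_⟩
  by_cases hx : x ∈ S
  · exact (hB ⟨(x, t), ⟨hx, ht⟩, rfl⟩).trans (le_max_left _ _)
  · have h1 := hS' hx t ht
    have h2 := norm_add_le (laxT q l x t - traceless (4 * I * l ^ 6) 0 0)
      (traceless (4 * I * l ^ 6) 0 0)
    rw [sub_add_cancel] at h2
    exact (h2.trans (by linarith)).trans (le_max_right _ _)

attribute [irreducible] traceless timeDiag timeUpper timeLower xDeriv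

variable {q : ℝ → ℝ → ℂ}

theorem hasDerivAt_theta_time (l : ℂ) (x t : ℝ) :
    HasDerivAt (fun t => theta l x t) (4 * l ^ 6) t := by
  have := ((((hasDerivAt_id t).ofReal_comp).const_mul (4 * l ^ 4)).const_add (x : ℂ)).const_mul
    (l ^ 2)
  refine this.congr_deriv ?_
  simp
  ring

theorem laxT_smul (l : ℂ) (x t : ℝ) (c : ℂ) (v : Fin 2 → ℂ) :
    laxT q l x t (c • v) = c • laxT q l x t v := by
  simp only [laxT, traceless_apply]
  funext i
  fin_cases i <;> simp <;> ring

/-- The time part of the Lax pair preserves the normalisation of a Jost column at infinity. -/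
theorem tendsto_normalized_of_time_evolution (hq : IsDecayingSolution q) {F : Filter ℝ}
    (hF : F ≤ cocompact ℝ) {j : Fin 2} {l : ℂ} {f : ℝ → ℝ → Fin 2 → ℂ} {t₀ δ : ℝ}
    (hft : ∀ x t, |t - t₀| < δ → HasDerivAt (fun t => f x t) (laxT q l x t (f x t)) t)
    (hδ : δ ≤ 1)
    (h0 : Tendsto (fun x : ℝ => exp (-(I * theta l x t₀ * sigma3 j j)) • f x t₀) F
      (𝓝 (Pi.single j (1 : ℂ)))) {t : ℝ} (ht : |t - t₀| < δ) :
    Tendsto (fun x : ℝ => exp (-(I * theta l x t * sigma3 j j)) • f x t) F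
      (𝓝 (Pi.single j (1 : ℂ))) := by
  obtain ⟨C, hC⟩ := exists_laxT_bound hq l (isCompact_Icc (a := t₀ - 1) (b := t₀ + 1))
  have hmem : ∀ t, |t - t₀| < δ → t ∈ Set.Icc (t₀ - 1) (t₀ + 1) := fun t ht => by
    rw [abs_lt] at ht; constructor <;> linarith
  set e : Fin 2 → ℂ := Pi.single j 1 with he
  set m : ℂ := 4 * I * l ^ 6 * sigma3 j j with hm
  have hme : traceless (4 * I * l ^ 6) 0 0 e = m • e := by
    rw [traceless_apply, hm, he]
    funext i
    fin_cases j <;> fin_cases i <;> simp [sigma3]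
  have hexp : ∀ x s, HasDerivAt (fun s : ℝ => exp (-(I * theta l x s * sigma3 j j)))
      (exp (-(I * theta l x s * sigma3 j j)) * -m) s := fun x s => by
    refine (((hasDerivAt_theta_time l x s).const_mul I).mul_const (sigma3 j j)).fun_neg.cexp
      |>.congr_deriv ?_
    rw [hm]
    ring
  have hr : ∀ ε > 0, ∀ᶠ x in F, ∀ t, |t - t₀| < δ →
      ‖laxT q l x t e - m • e‖ ≤ ε := fun ε hε => by
    have h1 := laxT_eventually_near hq l (isCompact_Icc (a := t₀ - 1) (b := t₀ + 1))
      (show 0 < ε / (‖e‖ + 1) by positivity)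
    filter_upwards [hF h1] with x hx t ht
    rw [← hme, ← _root_.sub_apply]
    refine (ContinuousLinearMap.le_of_opNorm_le _ (hx t (hmem t ht)).le e).trans ?_
    rw [div_mul_eq_mul_div, div_le_iff₀ (by positivity)]
    nlinarith
  have hk : ∀ x s, |s - t₀| < δ → HasDerivAt
      (fun s => exp (-(I * theta l x s * sigma3 j j)) • f x s - e)
      ((laxT q l x s - m • ContinuousLinearMap.id ℝ (Fin 2 → ℂ))
        (exp (-(I * theta l x s * sigma3 j j)) • f x s - e) + (laxT q l x s e - m • e)) s := by
    intro x s hs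
    refine (((hexp x s).smul (hft x s hs)).sub_const e).congr_deriv ?_
    simp only [_root_.sub_apply, _root_.smul_apply, ContinuousLinearMap.id_apply, map_sub,
      laxT_smul, smul_smul]
    rw [mul_neg, neg_smul, mul_comm _ m]
    abel
  have key := tendsto_zero_of_linear (F := F)
    (K := C + ‖m • ContinuousLinearMap.id ℝ (Fin 2 → ℂ)‖)
    (Eventually.of_forall fun x t ht => (norm_sub_le _ _).trans
      (add_le_add (hC x t (hmem t ht)) le_rfl)) hr hk
    (by
      have := h0.sub_const e
      rwa [sub_self] at this) ht
  simpa using key.add_const e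

/-- Each Jost column that is determined by its asymptotics solves the time part of the Lax pair: the
solution of the time part starting from the Jost column at one time has, by the zero curvature
condition, the properties that characterise the Jost column at all nearby times. -/
theorem hasDerivAt_jost_time (hq : IsDecayingSolution q) {F : Filter ℝ} (hF : F ≤ cocompact ℝ)
    {j : Fin 2} {l : ℂ} (hE : ∀ t, ∃! f, IsJostColumn q F j l t f) (x t₀ : ℝ) :
    HasDerivAt (fun t => jost q F j l x t) (laxT q l x t₀ (jost q F j l x t₀)) t₀ := by
  obtain ⟨C, hC⟩ := exists_laxT_bound hq l (isCompact_Icc (a := t₀ - 1) (b := t₀ + 1))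
  have hC0 : 0 ≤ C := (norm_nonneg _).trans (hC 0 t₀ (by simp))
  set δ : ℝ := 1 / (2 * (C + 1)) with hδ
  have hδ0 : 0 < δ := by positivity
  have hδ1 : δ ≤ 1 := by
    rw [hδ, div_le_one (by positivity)]; linarith
  have hCδ : 2 * (C * δ) ≤ 1 := by
    rw [hδ, mul_one_div, ← mul_div_assoc, div_le_one (by positivity)]; linarith
  have hmem : ∀ t, |t - t₀| ≤ δ → t ∈ Set.Icc (t₀ - 1) (t₀ + 1) := fun t ht => by
    rw [abs_le] at ht; constructor <;> linarith
  have hTc := continuous_laxT hq l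
  have hsol : ∀ x, ∃ g : ℝ → Fin 2 → ℂ, g t₀ = jost q F j l x t₀ ∧
      ∀ t, |t - t₀| < δ → HasDerivAt g (laxT q l x t (g t)) t := fun x =>
    exists_linear_solution (T := fun t => laxT q l x t)
      (hTc.comp (continuous_const.prodMk continuous_id)) hδ0 hC0 hCδ
      (fun t ht => hC x t (hmem t ht)) _
  choose f hf0 hft using hsol
  obtain ⟨Tx, hTx, hTxc, hz⟩ := exists_zero_curvature hq l
  have hJ := isJostColumn_jost (hE t₀)
  have hfx : ∀ t, |t - t₀| < δ → ∀ x, HasDerivAt (fun x => f x t)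
      (traceless (I * l ^ 2) (l * q x t) (-(l * conj (q x t))) (f x t)) x := fun t ht x =>
    hasDerivAt_of_compatible
      (X := fun x t => traceless (I * l ^ 2) (l * q x t) (-(l * conj (q x t))))
      (Xt := fun x t => traceless 0 (l * deriv (fun t => q x t) t)
        (-(l * conj (deriv (fun t => q x t) t)))) (T := laxT q l) (Tx := Tx)
      (fun x t => hasDerivAt_traceless (hasDerivAt_const _ _)
        ((hq.hasDerivAt_time x t).const_mul l) (((hq.hasDerivAt_time x t).star.const_mul l).neg))
      hTx hTc hTxc hz (fun x t => hft x t) (fun x => by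
        have := hJ.1 x
        rw [laxX_eq_traceless] at this
        simpa only [hf0] using this) x ht
  have hlim : ∀ t, |t - t₀| < δ → Tendsto (fun x : ℝ => exp (-(I * theta l x t * sigma3 j j)) •
      f x t) F (𝓝 (Pi.single j (1 : ℂ))) := fun t ht =>
    tendsto_normalized_of_time_evolution hq hF hft hδ1 (by simpa only [hf0] using hJ.2) ht
  have heq : ∀ t, |t - t₀| < δ → f x t = jost q F j l x t := fun t ht => by
    have h1 : IsJostColumn q F j l t fun x => f x t := by
      refine ⟨fun x => ?_, hlim t ht⟩
      rw [laxX_eq_traceless]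
      exact hfx t ht x
    exact congrFun ((hE t).unique h1 (isJostColumn_jost (hE t))) x
  have h := hft x t₀ (by simpa using hδ0)
  rw [hf0] at h
  refine h.congr_of_eventuallyEq ?_
  filter_upwards [Metric.ball_mem_nhds t₀ hδ0] with t ht
  exact (heq t (by rwa [Metric.mem_ball, Real.dist_eq] at ht)).symm

/-- `f` solves both equations of the Lax pair. -/
structure IsLaxSolution (q : ℝ → ℝ → ℂ) (l : ℂ) (f : ℝ → ℝ → Fin 2 → ℂ) : Prop where
  deriv_space : ∀ x t, HasDerivAt (fun x => f x t)
    (traceless (I * l ^ 2) (l * q x t) (-(l * conj (q x t))) (f x t)) x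
  deriv_time : ∀ x t, HasDerivAt (fun t => f x t) (laxT q l x t (f x t)) t

theorem isLaxSolution_jost (hq : IsDecayingSolution q) {F : Filter ℝ} (hF : F ≤ cocompact ℝ)
    {j : Fin 2} {l : ℂ} (hE : ∀ t, ∃! f, IsJostColumn q F j l t f) :
    IsLaxSolution q l fun x t => jost q F j l x t := by
  refine ⟨fun x t => ?_, fun x t => hasDerivAt_jost_time hq hF hE x t⟩
  have := (isJostColumn_jost (hE t)).1 x
  rwa [laxX_eq_traceless] at this

theorem isLaxSolution_psiMinus1 (hq : IsDecayingSolution q) {l : ℂ} (hl : l ∈ sectorMinus) :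
    IsLaxSolution q l (psiMinus1 q l) :=
  isLaxSolution_jost hq atBot_le_cocompact (existsUnique_jostColumn_minus_one hq hl)

theorem isLaxSolution_psiPlus2 (hq : IsDecayingSolution q) {l : ℂ} (hl : l ∈ sectorMinus) :
    IsLaxSolution q l (psiPlus2 q l) :=
  isLaxSolution_jost hq atTop_le_cocompact (existsUnique_jostColumn_plus_two hq hl)

theorem isLaxSolution_psiMinus2 (hq : IsDecayingSolution q) {l : ℂ} (hl : l ∈ sectorPlus) :
    IsLaxSolution q l (psiMinus2 q l) :=
  isLaxSolution_jost hq atBot_le_cocompact (existsUnique_jostColumn_minus_two hq hl)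

theorem isLaxSolution_psiPlus1 (hq : IsDecayingSolution q) {l : ℂ} (hl : l ∈ sectorPlus) :
    IsLaxSolution q l (psiPlus1 q l) :=
  isLaxSolution_jost hq atTop_le_cocompact (existsUnique_jostColumn_plus_one hq hl)

theorem detCols_eq (u v : Fin 2 → ℂ) : detCols u v = u 0 * v 1 - v 0 * u 1 := by
  simp only [detCols, Matrix.det_transpose, Matrix.det_fin_two, Matrix.of_apply,
    Matrix.cons_val_zero, Matrix.cons_val_one]
  ring

theorem hasDerivAt_detCols {f g : ℝ → Fin 2 → ℂ} {a b c : ℂ} {x : ℝ}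
    (hf : HasDerivAt f (traceless a b c (f x)) x) (hg : HasDerivAt g (traceless a b c (g x)) x) :
    HasDerivAt (fun x => detCols (f x) (g x)) 0 x := by
  simp only [detCols_eq]
  rw [traceless_apply, hasDerivAt_pi, Fin.forall_fin_two] at hf hg
  simp only [Matrix.cons_val_zero, Matrix.cons_val_one] at hf hg
  refine ((hf.1.mul hg.2).sub (hg.1.mul hf.2)).congr_deriv ?_
  ring

/-- Wronskians of solutions of the Lax pair are constant. -/
theorem IsLaxSolution.detCols_eq {l : ℂ} {f g : ℝ → ℝ → Fin 2 → ℂ} (hf : IsLaxSolution q l f)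
    (hg : IsLaxSolution q l g) (x t : ℝ) :
    detCols (f x t) (g x t) = detCols (f 0 0) (g 0 0) := by
  have h1 : detCols (f x t) (g x t) = detCols (f 0 t) (g 0 t) :=
    is_const_of_deriv_eq_zero
      (fun x => (hasDerivAt_detCols (hf.deriv_space x t) (hg.deriv_space x t)).differentiableAt)
      (fun x => (hasDerivAt_detCols (hf.deriv_space x t) (hg.deriv_space x t)).deriv) x 0
  have h2 : detCols (f 0 t) (g 0 t) = detCols (f 0 0) (g 0 0) :=
    is_const_of_deriv_eq_zero (f := fun t => detCols (f 0 t) (g 0 t))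
      (fun t => (hasDerivAt_detCols (hf.deriv_time 0 t) (hg.deriv_time 0 t)).differentiableAt)
      (fun t => (hasDerivAt_detCols (hf.deriv_time 0 t) (hg.deriv_time 0 t)).deriv) t 0
  rw [h1, h2]

theorem IsLaxSolution.sub_smul {l c : ℂ} {f g : ℝ → ℝ → Fin 2 → ℂ} (hf : IsLaxSolution q l f)
    (hg : IsLaxSolution q l g) : IsLaxSolution q l fun x t => f x t - c • g x t := by
  have h1 : ∀ a b d v, traceless a b d (c • v) = c • traceless a b d v := fun a b d v => by
    simp only [traceless_apply]
    funext i
    fin_cases i <;> simp <;> ring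
  refine ⟨fun x t => ((hf.deriv_space x t).sub ((hg.deriv_space x t).const_smul c)).congr_deriv ?_,
    fun x t => ((hf.deriv_time x t).sub ((hg.deriv_time x t).const_smul c)).congr_deriv ?_⟩
  · rw [map_sub, h1]
  · rw [map_sub, laxT, h1]

/-- Solutions of a linear equation with coefficient bounded by `K` grow at most exponentially. -/
theorem norm_le_of_linear {E : Type*} [NormedAddCommGroup E] [NormedSpace ℝ E] {g : ℝ → E}
    {T : ℝ → E →L[ℝ] E} {K R : ℝ} (hg : ∀ t, HasDerivAt g (T t (g t)) t) (hK : 1 ≤ K)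
    (hT : ∀ t, |t| < R → ‖T t‖ ≤ K) {t : ℝ} (ht : |t| < R) :
    ‖g t‖ ≤ ‖g 0‖ * Real.exp (K * R) := by
  have := norm_le_of_norm_deriv_le (t₀ := 0) (δ := R) (fun t _ => hg t) hK le_rfl
    (fun t ht => by
      rw [add_zero]
      exact (T t).le_of_opNorm_le (hT t (by simpa using ht)) _) (t := t) (by simpa using ht)
  simpa using this

/-- A solution of the Lax pair is controlled by its value at the origin, uniformly for `λ` in a
compact set. -/
theorem exists_isLaxSolution_bound (hq : IsDecayingSolution q) (x t R : ℝ) :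
    ∃ C : ℝ, ∀ l ∈ Metric.closedBall (0 : ℂ) R, ∀ f, IsLaxSolution q l f →
      ‖f x t‖ ≤ C * ‖f 0 0‖ := by
  have hc0 : Continuous fun p : ℝ × ℝ => q p.1 p.2 := hq.contDiff.continuous
  have hc1 : Continuous fun p : ℝ × ℝ => xDeriv q 1 p.1 p.2 :=
    (contDiff_xDeriv (n := 3) hq.contDiff (k := 1) (m := 0) (by norm_num)).continuous
  have hc2 : Continuous fun p : ℝ × ℝ => xDeriv q 2 p.1 p.2 :=
    (contDiff_xDeriv (n := 3) hq.contDiff (k := 2) (m := 0) (by norm_num)).continuous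
  have hTc : Continuous fun p : ℂ × ℝ => laxT q p.1 0 p.2 := by
    have a0 : Continuous fun p : ℂ × ℝ => q 0 p.2 :=
      hc0.comp (continuous_const.prodMk continuous_snd)
    have a1 : Continuous fun p : ℂ × ℝ => xDeriv q 1 0 p.2 :=
      hc1.comp (continuous_const.prodMk continuous_snd)
    have a2 : Continuous fun p : ℂ × ℝ => xDeriv q 2 0 p.2 :=
      hc2.comp (continuous_const.prodMk continuous_snd)
    exact continuous_timePart continuous_fst a0 a1 a2
  have hXc : Continuous fun p : ℂ × ℝ =>
      traceless (I * p.1 ^ 2) (p.1 * q p.2 t) (-(p.1 * conj (q p.2 t))) := by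
    have a0 : Continuous fun p : ℂ × ℝ => q p.2 t :=
      hc0.comp (continuous_snd.prodMk continuous_const)
    have k0 : Continuous fun p : ℂ × ℝ => conj (q p.2 t) := continuous_conj.comp a0
    exact continuous_traceless (by fun_prop) (by fun_prop) (by fun_prop)
  obtain ⟨B₁, hB₁⟩ := (((isCompact_closedBall (0 : ℂ) R).prod
    (isCompact_Icc (a := -(|t| + 1)) (b := |t| + 1))).image hTc.norm).bddAbove
  obtain ⟨B₂, hB₂⟩ := (((isCompact_closedBall (0 : ℂ) R).prod
    (isCompact_Icc (a := -(|x| + 1)) (b := |x| + 1))).image hXc.norm).bddAbove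
  refine ⟨Real.exp (max B₁ 1 * (|t| + 1)) * Real.exp (max B₂ 1 * (|x| + 1)), fun l hl f hf => ?_⟩
  have h1 : ‖f 0 t‖ ≤ ‖f 0 0‖ * Real.exp (max B₁ 1 * (|t| + 1)) :=
    norm_le_of_linear (T := fun t => laxT q l 0 t) (hf.deriv_time 0) (le_max_right _ _)
      (fun s hs => (hB₁ ⟨(l, s), ⟨hl, abs_le.1 hs.le⟩, rfl⟩).trans (le_max_left _ _)) (by simp)
  have h2 : ‖f x t‖ ≤ ‖f 0 t‖ * Real.exp (max B₂ 1 * (|x| + 1)) :=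
    norm_le_of_linear (g := fun x => f x t)
      (T := fun x => traceless (I * l ^ 2) (l * q x t) (-(l * conj (q x t))))
      (fun x => hf.deriv_space x t) (le_max_right _ _)
      (fun s hs => (hB₂ ⟨(l, s), ⟨hl, abs_le.1 hs.le⟩, rfl⟩).trans (le_max_left _ _)) (by simp)
  calc ‖f x t‖ ≤ ‖f 0 t‖ * Real.exp (max B₂ 1 * (|x| + 1)) := h2
    _ ≤ (‖f 0 0‖ * Real.exp (max B₁ 1 * (|t| + 1))) * Real.exp (max B₂ 1 * (|x| + 1)) :=
      mul_le_mul_of_nonneg_right h1 (Real.exp_pos _).le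
    _ = _ := by ring

/-! ### The Riemann-Hilbert problem with triple poles -/

/-- The meromorphic factor `A (1 + D ε + F ε²) / ε³`, `ε = λ - z₀`, in the jump of the principal
parts at a triple pole. -/
noncomputable def poleCoef (A D F z₀ l : ℂ) : ℂ :=
  A * (1 + D * (l - z₀) + F * (l - z₀) ^ 2) / (l - z₀) ^ 3

theorem mem_contour_iff {l : ℂ} : l ∈ contour ↔ l.re * l.im = 0 := by
  rw [mul_eq_zero, or_comm]
  rfl

theorem notMem_contour_of_Dplus {l : ℂ} (h : l ∈ Dplus) : l ∉ contour := by
  rw [mem_contour_iff]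
  exact (show 0 < l.re * l.im from h).ne'

theorem notMem_contour_of_Dminus {l : ℂ} (h : l ∈ Dminus) : l ∉ contour := by
  rw [mem_contour_iff]
  exact (show l.re * l.im < 0 from h).ne

theorem ne_of_Dplus_of_Dminus {l w : ℂ} (hl : l ∈ Dplus) (hw : w ∈ Dminus) : l ≠ w := by
  rintro rfl
  exact lt_asymm (show 0 < l.re * l.im from hl) hw

theorem mul_sub_mul_isBigO {f g f' g' c : ℂ → ℂ} {z₀ : ℂ}
    (h : (fun l => f l - c l * g l) =O[𝓝[≠] z₀] fun _ => (1 : ℂ))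
    (h' : (fun l => f' l - c l * g' l) =O[𝓝[≠] z₀] fun _ => (1 : ℂ))
    (hg : ContinuousAt g z₀) (hg' : ContinuousAt g' z₀) :
    (fun l => f l * g' l - g l * f' l) =O[𝓝[≠] z₀] fun _ => (1 : ℂ) := by
  have h1 := h.mul (isBigO_one_of_continuousAt hg')
  have h2 := (isBigO_one_of_continuousAt hg).mul h'
  have h3 := h1.sub h2
  simp only [mul_one] at h3
  exact h3.congr_left fun l => by ring

section PoleSum

variable {ι : Type} [Fintype ι] {A D F w : ι → ℂ}

theorem poleSum_jet_sub_isBigO (hw : Function.Injective w) {g : ℂ → ℂ} {k : ι}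
    (hg : AnalyticAt ℂ g (w k)) :
    (fun l => poleSum A D F w (fun r => jet g (w r.2) r.1) l -
      poleCoef (A k) (D k) (F k) (w k) l * g l) =O[𝓝[≠] (w k)] fun _ => (1 : ℂ) := by
  classical
  refine ((poleSum_sub_polePart_isBigO A D F w hw (fun r => jet g (w r.2) r.1) k).sub
    (sub_polePart_isBigO hg (A k) (D k) (F k))).congr_left fun l => ?_
  simp only [jet, poleCoef, iteratedDeriv_zero, Fin.val_zero, Fin.val_one, Fin.val_two]
  ring

/-- A function with prescribed principal parts at finitely many triple poles, continuous across the
contour and bounded at infinity, is a constant plus the sum of its principal parts. -/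
theorem exists_eq_const_add_poleSum (hw : Function.Injective w) {f g : ℂ → ℂ}
    (hc : ContinuousOn f (Set.range w)ᶜ)
    (hd : ∀ l, l ∉ contour → (∀ n, l ≠ w n) → DifferentiableAt ℂ f l)
    (hg : ∀ k, AnalyticAt ℂ g (w k))
    (hp : ∀ k, (fun l => f l - poleCoef (A k) (D k) (F k) (w k) l * g l) =O[𝓝[≠] (w k)]
      fun _ => (1 : ℂ))
    (hinf : f =O[cocompact ℂ] fun _ => (1 : ℂ)) :
    ∃ c, ∀ l, (∀ n, l ≠ w n) →
      f l = c + poleSum A D F w (fun r => jet g (w r.2) r.1) l := by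
  have hne : ∀ l ∉ Set.range w, ∀ n, l ≠ w n := fun l hl n h => hl ⟨n, h.symm⟩
  obtain ⟨c, h⟩ := exists_const_of_off_contour
    (f := fun l => f l - poleSum A D F w (fun r => jet g (w r.2) r.1) l) (Set.finite_range w)
    (hc.sub fun l hl => (differentiableAt_poleSum A D F w _
      (hne l hl)).continuousAt.continuousWithinAt)
    (fun l hl hl' => (hd l hl' (hne l hl)).sub (differentiableAt_poleSum A D F w _ (hne l hl)))
    (by
      rintro _ ⟨k, rfl⟩
      refine ((hp k).sub (poleSum_jet_sub_isBigO (A := A) (D := D) (F := F) hw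
        (hg k))).congr_left fun l => ?_
      ring)
    (hinf.sub ((tendsto_poleSum_cocompact A D F w _).isBigO_one ℂ))
  refine ⟨c, fun l hl => ?_⟩
  rw [← h l (by rintro ⟨n, rfl⟩; exact hl n rfl)]
  ring

end PoleSum

section RiemannHilbert

variable {ι : Type}

/-- `(M₁, M₂)` is a matrix function with unit determinant that is holomorphic off the contour,
continuous across it, bounded at infinity, and whose columns have triple poles at the `ζ_n` and the
`ζ_n^*` respectively, with principal parts determined by the other column. -/
structure IsRHSolution (A B C : ℂ → ℂ) (z : ι → ℂ) (x t : ℝ) (M₁ M₂ : ℂ → Fin 2 → ℂ) : Prop where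
  cont₁ : ∀ i, ContinuousOn (fun l => M₁ l i) (Set.range z)ᶜ
  cont₂ : ∀ i, ContinuousOn (fun l => M₂ l i) (Set.range fun n => conj (z n))ᶜ
  diff₁ : ∀ i l, l ∉ contour → (∀ n, l ≠ z n) → DifferentiableAt ℂ (fun l => M₁ l i) l
  diff₂ : ∀ i l, l ∉ contour → (∀ n, l ≠ conj (z n)) → DifferentiableAt ℂ (fun l => M₂ l i) l
  pole₁ : ∀ i n, (fun l => M₁ l i - poleCoef (A (z n) * exp (-2 * I * theta (z n) x t))
    (dF B z x t n) (fF B C z x t n) (z n) l * M₂ l i) =O[𝓝[≠] (z n)] fun _ => (1 : ℂ)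
  pole₂ : ∀ i n, (fun l => M₂ l i - poleCoef (A (conj (z n)) *
    exp (2 * I * theta (conj (z n)) x t)) (dHat B z x t n) (fHat B C z x t n) (conj (z n)) l *
      M₁ l i) =O[𝓝[≠] (conj (z n))] fun _ => (1 : ℂ)
  det_eq : ∀ l, (∀ n, l ≠ z n) → (∀ n, l ≠ conj (z n)) → M₁ l 0 * M₂ l 1 - M₂ l 0 * M₁ l 1 = 1
  bdd₁ : ∀ i, (fun l => M₁ l i) =O[cocompact ℂ] fun _ => (1 : ℂ)
  bdd₂ : ∀ i, (fun l => M₂ l i) =O[cocompact ℂ] fun _ => (1 : ℂ)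

variable {A B C : ℂ → ℂ} {z : ι → ℂ} {x t : ℝ} {M₁ M₂ : ℂ → Fin 2 → ℂ}

theorem IsRHSolution.analyticAt₁ (h : IsRHSolution A B C z x t M₁ M₂) (hz : ∀ n, z n ∈ Dplus)
    (i : Fin 2) (n : ι) : AnalyticAt ℂ (fun l => M₁ l i) (conj (z n)) := by
  have hd : DifferentiableOn ℂ (fun l => M₁ l i) Dminus := fun l hl =>
    (h.diff₁ i l (notMem_contour_of_Dminus hl) fun m =>
      (ne_of_Dplus_of_Dminus (hz m) hl).symm).differentiableWithinAt
  exact hd.analyticAt (isOpen_Dminus.mem_nhds (conj_mem_Dminus.2 (hz n)))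

theorem IsRHSolution.analyticAt₂ (h : IsRHSolution A B C z x t M₁ M₂) (hz : ∀ n, z n ∈ Dplus)
    (i : Fin 2) (n : ι) : AnalyticAt ℂ (fun l => M₂ l i) (z n) := by
  have hd : DifferentiableOn ℂ (fun l => M₂ l i) Dplus := fun l hl =>
    (h.diff₂ i l (notMem_contour_of_Dplus hl) fun m =>
      ne_of_Dplus_of_Dminus hl (conj_mem_Dminus.2 (hz m))).differentiableWithinAt
  exact hd.analyticAt (isOpen_Dplus.mem_nhds (hz n))

theorem conj_ne_of_Dplus (hz : ∀ n, z n ∈ Dplus) (n s : ι) : conj (z n) ≠ z s :=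
  (ne_of_Dplus_of_Dminus (hz s) (conj_mem_Dminus.2 (hz n))).symm

theorem injective_conj (hinj : Function.Injective z) : Function.Injective fun n => conj (z n) :=
  fun _ _ h => hinj ((starRingEnd ℂ).injective h)

variable [Fintype ι]

theorem analyticAt_sumZ (p : Fin 3 × ι → ℂ) {l : ℂ} (hl : ∀ n, l ≠ z n) :
    AnalyticAt ℂ (sumZ A B C z x t p) l := by
  have hd : DifferentiableOn ℂ (sumZ A B C z x t p) {l | ∀ n, l ≠ z n} := fun l hl =>
    (differentiableAt_poleSum _ _ _ _ _ hl).differentiableWithinAt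
  exact hd.analyticAt (eventually_ne_points z hl)

theorem analyticAt_sumW (p : Fin 3 × ι → ℂ) {l : ℂ} (hl : ∀ n, l ≠ conj (z n)) :
    AnalyticAt ℂ (sumW A B C z x t p) l := by
  have hd : DifferentiableOn ℂ (sumW A B C z x t p) {l | ∀ n, l ≠ conj (z n)} := fun l hl =>
    (differentiableAt_poleSum _ _ _ _ _ hl).differentiableWithinAt
  exact hd.analyticAt (eventually_ne_points _ hl)

/-- A row with the same principal parts as `(M₁, M₂)` that vanishes at infinity is zero: multiplied
by the inverse of `(M₁, M₂)` it becomes entire. -/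
theorem IsRHSolution.eq_zero_of_mulVec_eq (h : IsRHSolution A B C z x t M₁ M₂)
    (hz : ∀ n, z n ∈ Dplus) (hinj : Function.Injective z) {p : Fin 3 × ι → ℂ}
    (hp : (matG A B C z x t).mulVec p = p) : p = 0 := by
  have hne := conj_ne_of_Dplus hz
  set n₂ : ℂ → ℂ := sumW A B C z x t p with hn₂
  set n₁ : ℂ → ℂ := sumZ A B C z x t fun r => jet n₂ (z r.2) r.1 with hn₁
  have hjet : ∀ i n, jet n₁ (conj (z n)) i = p (i, n) := fun i n => by
    rw [hn₁, ← matG_mulVec A B C z x t hne, hp]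
  have ha₁ : ∀ l, (∀ n, l ≠ z n) → AnalyticAt ℂ n₁ l := fun l hl => analyticAt_sumZ _ hl
  have ha₂ : ∀ l, (∀ n, l ≠ conj (z n)) → AnalyticAt ℂ n₂ l := fun l hl => analyticAt_sumW _ hl
  have hpole₁ := fun k => poleSum_jet_sub_isBigO (A := fun n => A (z n) *
    exp (-2 * I * theta (z n) x t)) (D := dF B z x t) (F := fF B C z x t) hinj
    (ha₂ (z k) fun n => (hne n k).symm)
  have hpole₂ := fun k => poleSum_jet_sub_isBigO (A := fun n => A (conj (z n)) *
    exp (2 * I * theta (conj (z n)) x t)) (D := dHat B z x t) (F := fHat B C z x t)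
    (injective_conj hinj) (ha₁ (conj (z k)) fun n => hne k n)
  have hp' : (fun r : Fin 3 × ι => jet n₁ (conj (z r.2)) r.1) = p := funext fun r => hjet r.1 r.2
  rw [hp'] at hpole₂
  have hzero : ∀ i l, (∀ n, l ≠ z n) → (∀ n, l ≠ conj (z n)) →
      n₁ l * M₂ l i - n₂ l * M₁ l i = 0 := by
    intro i
    have hS : (Set.range z ∪ Set.range fun n => conj (z n)).Finite :=
      (Set.finite_range z).union (Set.finite_range _)
    have hn1 : ∀ l ∉ Set.range z ∪ Set.range fun n => conj (z n), ∀ n, l ≠ z n :=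
      fun l hl n h => hl (Or.inl ⟨n, h.symm⟩)
    have hn2 : ∀ l ∉ Set.range z ∪ Set.range fun n => conj (z n), ∀ n, l ≠ conj (z n) :=
      fun l hl n h => hl (Or.inr ⟨n, h.symm⟩)
    have hlim : Tendsto (fun l => n₁ l * M₂ l i - n₂ l * M₁ l i) (cocompact ℂ) (𝓝 0) := by
      have h1 := ((Asymptotics.isLittleO_one_iff ℂ).2
        (tendsto_poleSum_cocompact (fun n => A (z n) * exp (-2 * I * theta (z n) x t))
          (dF B z x t) (fF B C z x t) z fun r => jet n₂ (z r.2) r.1)).mul_isBigO (h.bdd₂ i)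
      have h2 := ((Asymptotics.isLittleO_one_iff ℂ).2
        (tendsto_poleSum_cocompact (fun n => A (conj (z n)) *
          exp (2 * I * theta (conj (z n)) x t)) (dHat B z x t) (fHat B C z x t)
          (fun n => conj (z n)) p)).mul_isBigO (h.bdd₁ i)
      have h3 := h1.sub h2
      simp only [mul_one] at h3
      exact (Asymptotics.isLittleO_one_iff ℂ).1 h3
    obtain ⟨c, hc⟩ := exists_const_of_off_contour (f := fun l => n₁ l * M₂ l i - n₂ l * M₁ l i) hS
      (ContinuousOn.sub
        (ContinuousOn.mul (fun l hl => (ha₁ l (hn1 l hl)).continuousAt.continuousWithinAt)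
          ((h.cont₂ i).mono fun l hl hl' => hl (Or.inr hl')))
        (ContinuousOn.mul (fun l hl => (ha₂ l (hn2 l hl)).continuousAt.continuousWithinAt)
          ((h.cont₁ i).mono fun l hl hl' => hl (Or.inl hl'))))
      (fun l hl hl' => ((ha₁ l (hn1 l hl)).differentiableAt.mul (h.diff₂ i l hl' (hn2 l hl))).sub
        ((ha₂ l (hn2 l hl)).differentiableAt.mul (h.diff₁ i l hl' (hn1 l hl))))
      (by
        rintro _ (⟨k, rfl⟩ | ⟨k, rfl⟩)
        · exact mul_sub_mul_isBigO (hpole₁ k) (h.pole₁ i k)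
            (ha₂ _ fun n => (hne n k).symm).continuousAt (h.analyticAt₂ hz i k).continuousAt
        · refine (mul_sub_mul_isBigO (hpole₂ k) (h.pole₂ i k)
            (ha₁ _ fun n => hne k n).continuousAt
            (h.analyticAt₁ hz i k).continuousAt).neg_left.congr_left fun l => ?_
          change -(n₂ l * _ - _) = _
          ring)
      (hlim.isBigO_one ℂ)
    have hc0 : c = 0 := by
      refine tendsto_nhds_unique (tendsto_const_nhds.congr' ?_) hlim
      filter_upwards [hS.isCompact.compl_mem_cocompact] with l hl using (hc l hl).symm
    intro l h1 h2
    rw [hc l (by rintro (⟨n, rfl⟩ | ⟨n, rfl⟩); exacts [h1 n rfl, h2 n rfl]), hc0]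
  have hn₁0 : ∀ l, (∀ n, l ≠ z n) → (∀ n, l ≠ conj (z n)) → n₁ l = 0 := fun l h1 h2 => by
    linear_combination (-(n₁ l)) * h.det_eq l h1 h2 + M₁ l 0 * hzero 1 l h1 h2 -
      M₁ l 1 * hzero 0 l h1 h2
  funext r
  obtain ⟨i, n⟩ := r
  have hev : n₁ =ᶠ[𝓝 (conj (z n))] fun _ => 0 := by
    refine ((ha₁ _ fun m => hne n m).continuousAt.eventuallyEq_nhds_iff_eventuallyEq_nhdsNE
      continuousAt_const).1 ?_
    have h1 : ∀ᶠ l in 𝓝[≠] (conj (z n)), ∀ m, l ≠ z m :=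
      nhdsWithin_le_nhds (eventually_ne_points z fun m => hne n m)
    have h2 : ∀ᶠ l in 𝓝[≠] (conj (z n)), ∀ m, l ≠ conj (z m) := by
      refine eventually_all.2 fun m => ?_
      by_cases hm : conj (z n) = conj (z m)
      · rw [← hm]
        exact self_mem_nhdsWithin
      · exact nhdsWithin_le_nhds (isOpen_ne.mem_nhds hm)
    filter_upwards [h1, h2] with l h1 h2 using hn₁0 l h1 h2
  rw [← hjet i n, jet, hev.iteratedDeriv_eq]
  simp

/-- The solution of the Riemann-Hilbert problem in closed form: the linear system for the jets of
`M₁` at the points `ζ_n^*` is uniquely solvable, and its solution gives the leading coefficient of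
`M₂` at infinity. -/
theorem IsRHSolution.det_ne_zero_and_det_matR [DecidableEq ι]
    (h : IsRHSolution A B C z x t M₁ M₂) (hz : ∀ n, z n ∈ Dplus) (hinj : Function.Injective z)
    {F₁ F₂ : Filter ℂ} [F₁.NeBot] [F₂.NeBot] (hF₁ : F₁ ≤ cocompact ℂ) (hF₂ : F₂ ≤ cocompact ℂ)
    {c κ : ℂ} (hc : c ≠ 0) (h₁ : Tendsto (fun l => M₁ l 0) F₁ (𝓝 c))
    (h₂ : Tendsto (fun l => M₂ l 0) F₂ (𝓝 0))
    (h₂' : Tendsto (fun l => l * M₂ l 0) F₂ (𝓝 κ)) :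
    (1 - matG A B C z x t).det ≠ 0 ∧
      (matR A B C z x t).det / (1 - matG A B C z x t).det = -(κ / c) := by
  have hne := conj_ne_of_Dplus hz
  set p : Fin 3 × ι → ℂ := fun r => jet (fun l => M₁ l 0) (conj (z r.2)) r.1 with hp
  have hdet : (1 - matG A B C z x t).det ≠ 0 := fun h0 => by
    obtain ⟨v, hv, hv'⟩ := Matrix.exists_mulVec_eq_zero_iff.2 h0
    rw [Matrix.sub_mulVec, Matrix.one_mulVec, sub_eq_zero] at hv'
    exact hv (h.eq_zero_of_mulVec_eq hz hinj hv'.symm)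
  obtain ⟨c₂, hM₂⟩ := exists_eq_const_add_poleSum (injective_conj hinj) (h.cont₂ 0) (h.diff₂ 0)
    (h.analyticAt₁ hz 0) (h.pole₂ 0) (h.bdd₂ 0)
  change ∀ l, (∀ n, l ≠ conj (z n)) → M₂ l 0 = c₂ + sumW A B C z x t p l at hM₂
  obtain ⟨c₁, hM₁⟩ := exists_eq_const_add_poleSum hinj (h.cont₁ 0) (h.diff₁ 0)
    (h.analyticAt₂ hz 0) (h.pole₁ 0) (h.bdd₁ 0)
  change ∀ l, (∀ n, l ≠ z n) → M₁ l 0 = c₁ + sumZ A B C z x t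
    (fun r => jet (fun l => M₂ l 0) (z r.2) r.1) l at hM₁
  have hev₁ : ∀ᶠ l in cocompact ℂ, ∀ n, l ≠ z n := by
    filter_upwards [(Set.finite_range z).isCompact.compl_mem_cocompact] with l hl n h
      using hl ⟨n, h.symm⟩
  have hev₂ : ∀ᶠ l in cocompact ℂ, ∀ n, l ≠ conj (z n) := by
    filter_upwards [(Set.finite_range fun n => conj (z n)).isCompact.compl_mem_cocompact]
      with l hl n h using hl ⟨n, h.symm⟩
  have hc₁ : c₁ = c := by
    refine tendsto_nhds_unique ?_ h₁
    have := ((tendsto_poleSum_cocompact (fun n => A (z n) * exp (-2 * I * theta (z n) x t))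
      (dF B z x t) (fF B C z x t) z
      (fun r => jet (fun l => M₂ l 0) (z r.2) r.1)).mono_left hF₁).const_add c₁
    rw [add_zero] at this
    refine this.congr' ?_
    filter_upwards [hF₁ hev₁] with l hl using (hM₁ l hl).symm
  have hc₂ : c₂ = 0 := by
    refine tendsto_nhds_unique ?_ h₂
    have := ((tendsto_poleSum_cocompact (fun n => A (conj (z n)) *
      exp (2 * I * theta (conj (z n)) x t)) (dHat B z x t) (fHat B C z x t)
      (fun n => conj (z n)) p).mono_left hF₂).const_add c₂
    rw [add_zero] at this
    refine this.congr' ?_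
    filter_upwards [hF₂ hev₂] with l hl using (hM₂ l hl).symm
  simp only [hc₁, hc₂, zero_add] at hM₁ hM₂
  have hα : dotProduct (vecAlpha A B C z x t) p = κ := by
    refine tendsto_nhds_unique ?_ h₂'
    have := (tendsto_mul_poleSum_cocompact (fun n => A (conj (z n)) *
      exp (2 * I * theta (conj (z n)) x t)) (dHat B z x t) (fHat B C z x t)
      (fun n => conj (z n)) p).mono_left hF₂
    have e : dotProduct (vecAlpha A B C z x t) p = ∑ j, A (conj (z j)) *
        exp (2 * I * theta (conj (z j)) x t) * (fHat B C z x t j * p (0, j) +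
          dHat B z x t j * p (1, j) + p (2, j) / 2) := by
      rw [dotProduct, Fintype.sum_prod_type, Finset.sum_comm]
      refine Finset.sum_congr rfl fun j _ => ?_
      simp [Fin.sum_univ_three, vecAlpha]
      ring
    rw [e]
    refine this.congr' ?_
    filter_upwards [hF₂ hev₂] with l hl
    rw [hM₂ l hl, sumW]
  have hjet₂ : (fun r : Fin 3 × ι => jet (fun l => M₂ l 0) (z r.2) r.1) =
      fun r => jet (sumW A B C z x t p) (z r.2) r.1 := by
    funext r
    refine Filter.EventuallyEq.iteratedDeriv_eq _ ?_
    filter_upwards [eventually_ne_points _ fun n => (hne n r.2).symm] with l hl using hM₂ l hl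
  have hsys : (1 - matG A B C z x t).mulVec p = c • vecTau := by
    funext r
    obtain ⟨i, n⟩ := r
    have h1 : p (i, n) = jet (fun l => c + sumZ A B C z x t
        (fun r => jet (sumW A B C z x t p) (z r.2) r.1) l) (conj (z n)) i := by
      rw [← hjet₂]
      refine Filter.EventuallyEq.iteratedDeriv_eq _ ?_
      filter_upwards [eventually_ne_points z fun m => hne n m] with l hl using hM₁ l hl
    rw [Matrix.sub_mulVec, Matrix.one_mulVec, Pi.sub_apply, matG_mulVec A B C z x t hne, h1]
    simp only [sumZ]
    rw [jet_const_add_poleSum _ _ _ _ _ _ (fun m => hne n m),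
      jet_poleSum _ _ _ _ _ (fun m => hne n m)]
    fin_cases i <;> simp [vecTau]
  refine ⟨hdet, ?_⟩
  have hU : IsUnit (1 - matG A B C z x t).det := isUnit_iff_ne_zero.2 hdet
  have hinv : (1 - matG A B C z x t)⁻¹.mulVec vecTau = c⁻¹ • p := by
    have := congrArg (fun v => c⁻¹ • (1 - matG A B C z x t)⁻¹.mulVec v) hsys
    simp only [Matrix.mulVec_mulVec, Matrix.nonsing_inv_mul _ hU, Matrix.one_mulVec,
      Matrix.mulVec_smul, smul_smul, inv_mul_cancel₀ hc, one_smul] at this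
    exact this.symm
  have : Invertible (1 - matG A B C z x t) := Matrix.invertibleOfIsUnitDet _ hU
  rw [matR, Matrix.det_fromBlocks₂₂, mul_div_cancel_left₀ _ hdet, Matrix.det_unique, zero_sub,
    Matrix.neg_apply, Matrix.invOf_eq_nonsing_inv, Matrix.mul_assoc]
  congr 1
  have e2 : ((Matrix.of fun _ p => vecAlpha A B C z x t p : Matrix Unit (Fin 3 × ι) ℂ) *
      ((1 - matG A B C z x t)⁻¹ * (Matrix.of fun p _ => vecTau p : Matrix (Fin 3 × ι) Unit ℂ)))
        default default =
      dotProduct (vecAlpha A B C z x t) ((1 - matG A B C z x t)⁻¹.mulVec vecTau) := by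
    simp [Matrix.mul_apply, dotProduct, Matrix.mulVec]
  rw [e2, hinv, dotProduct_smul, hα, smul_eq_mul]
  field_simp

end RiemannHilbert

/-! ### Normalised columns -/

/-- Functions that are continuous on the closed sector `S`, holomorphic on its interior `D` and
bounded at infinity. -/
structure IsSectorFun (S D : Set ℂ) (f : ℂ → ℂ) : Prop where
  cont : ContinuousOn f S
  diff : ∀ l ∈ D, DifferentiableAt ℂ f l
  bdd : f =O[cocompact ℂ ⊓ 𝓟 S] fun _ => (1 : ℂ)

namespace IsSectorFun

variable {S D : Set ℂ} {f g : ℂ → ℂ}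

theorem mul (hf : IsSectorFun S D f) (hg : IsSectorFun S D g) :
    IsSectorFun S D fun l => f l * g l :=
  ⟨hf.cont.mul hg.cont, fun l hl => (hf.diff l hl).mul (hg.diff l hl), by
    simpa using hf.bdd.mul hg.bdd⟩

theorem sub (hf : IsSectorFun S D f) (hg : IsSectorFun S D g) :
    IsSectorFun S D fun l => f l - g l :=
  ⟨hf.cont.sub hg.cont, fun l hl => (hf.diff l hl).sub (hg.diff l hl), hf.bdd.sub hg.bdd⟩

theorem neg (hf : IsSectorFun S D f) : IsSectorFun S D fun l => -f l :=
  ⟨hf.cont.neg, fun l hl => (hf.diff l hl).neg, hf.bdd.neg_left⟩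

theorem congr (hf : IsSectorFun S D f) (hD : IsOpen D) (hDS : D ⊆ S) (h : ∀ l ∈ S, g l = f l) :
    IsSectorFun S D g := by
  refine ⟨hf.cont.congr h, fun l hl => (hf.diff l hl).congr_of_eventuallyEq ?_,
    hf.bdd.congr' ?_ EventuallyEq.rfl⟩
  · filter_upwards [hD.mem_nhds hl] with z hz using h z (hDS hz)
  · filter_upwards [mem_inf_of_right (mem_principal_self S)] with z hz using (h z hz).symm

theorem analyticAt (hf : IsSectorFun S D f) (hD : IsOpen D) {l : ℂ} (hl : l ∈ D) :
    AnalyticAt ℂ f l :=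
  DifferentiableOn.analyticAt (fun z hz => (hf.diff z hz).differentiableWithinAt)
    (hD.mem_nhds hl)

end IsSectorFun

theorem tendsto_conj_cocompact : Tendsto (fun l : ℂ => conj l) (cocompact ℂ ⊓ 𝓟 sectorPlus)
    (cocompact ℂ ⊓ 𝓟 sectorMinus) := by
  refine tendsto_inf.2 ⟨?_, ?_⟩
  · have : Tendsto (fun l : ℂ => conj l) (cocompact ℂ) (cocompact ℂ) :=
      conjCLE.toHomeomorph.isClosedEmbedding.tendsto_cocompact
    exact this.mono_left inf_le_left
  · exact tendsto_principal.2 (mem_inf_of_right fun l hl => conj_mem_sectorMinus.2 hl)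

theorem IsSectorFun.conj {f : ℂ → ℂ} (hf : IsSectorFun sectorMinus Dminus f) :
    IsSectorFun sectorPlus Dplus fun l => conj (f (conj l)) := by
  refine ⟨?_, fun l hl => ?_, ?_⟩
  · exact continuous_conj.comp_continuousOn (hf.cont.comp continuous_conj.continuousOn
      fun l hl => conj_mem_sectorMinus.2 hl)
  · exact differentiableAt_conj_conj_iff.2 (hf.diff _ (conj_mem_Dminus.2 hl))
  · have h := hf.bdd.comp_tendsto tendsto_conj_cocompact
    rw [← Asymptotics.isBigO_norm_left] at h ⊢
    exact h.congr_left fun l => by simp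

theorem isBigO_one_of_forall_norm_le {S : Set ℂ} {f : ℂ → ℂ} {C : ℝ}
    (h : ∀ l ∈ S, 1 ≤ ‖l‖ → ‖f l‖ ≤ C) : f =O[cocompact ℂ ⊓ 𝓟 S] fun _ => (1 : ℂ) := by
  refine Asymptotics.IsBigO.of_bound C ?_
  have h1 : ∀ᶠ l : ℂ in cocompact ℂ ⊓ 𝓟 S, 1 ≤ ‖l‖ :=
    (tendsto_norm_cocompact_atTop.eventually_ge_atTop 1).filter_mono inf_le_left
  filter_upwards [h1, mem_inf_of_right (mem_principal_self S)] with l h1 h2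
  simpa using h l h2 h1

variable {q : ℝ → ℝ → ℂ}

/-- `e^{-iθ} ψ₋₁`. -/
noncomputable def colMinus1 (q : ℝ → ℝ → ℂ) (x t : ℝ) (l : ℂ) : Fin 2 → ℂ :=
  exp (-(I * theta l x t)) • psiMinus1 q l x t

/-- `e^{iθ} ψ₊₂`. -/
noncomputable def colPlus2 (q : ℝ → ℝ → ℂ) (x t : ℝ) (l : ℂ) : Fin 2 → ℂ :=
  exp (I * theta l x t) • psiPlus2 q l x t

/-- `e^{iθ} ψ₋₂`. -/
noncomputable def colMinus2 (q : ℝ → ℝ → ℂ) (x t : ℝ) (l : ℂ) : Fin 2 → ℂ :=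
  exp (I * theta l x t) • psiMinus2 q l x t

/-- `e^{-iθ} ψ₊₁`. -/
noncomputable def colPlus1 (q : ℝ → ℝ → ℂ) (x t : ℝ) (l : ℂ) : Fin 2 → ℂ :=
  exp (-(I * theta l x t)) • psiPlus1 q l x t

theorem colMinus1_eq (hq : IsDecayingSolution q) {l : ℂ} (hl : l ∈ sectorMinus) (x t : ℝ) :
    colMinus1 q x t l = ![(leftSol (fun x => q x t) l).1 x, (leftSol (fun x => q x t) l).2 x] := by
  rw [colMinus1, psiMinus1_eq hq hl, smul_smul, ← exp_add, neg_add_cancel, exp_zero, one_smul]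

theorem colPlus2_eq (hq : IsDecayingSolution q) {l : ℂ} (hl : l ∈ sectorMinus) (x t : ℝ) :
    colPlus2 q x t l = ![(leftSol (reflectPotential fun x => q x t) l).2 (-x),
      (leftSol (reflectPotential fun x => q x t) l).1 (-x)] := by
  rw [colPlus2, psiPlus2_eq hq hl, smul_smul, ← exp_add, add_neg_cancel, exp_zero, one_smul]

theorem colMinus2_eq (hq : IsDecayingSolution q) {l : ℂ} (hl : l ∈ sectorPlus) (x t : ℝ) :
    colMinus2 q x t l =
      ![-conj (colMinus1 q x t (conj l) 1), conj (colMinus1 q x t (conj l) 0)] := by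
  rw [colMinus2, psiMinus2_eq hq hl]
  funext i
  fin_cases i <;> simp [colMinus1, theta_conj, ← exp_conj]

theorem colPlus1_eq (hq : IsDecayingSolution q) {l : ℂ} (hl : l ∈ sectorPlus) (x t : ℝ) :
    colPlus1 q x t l =
      ![conj (colPlus2 q x t (conj l) 1), -conj (colPlus2 q x t (conj l) 0)] := by
  rw [colPlus1, psiPlus1_eq hq hl]
  funext i
  fin_cases i <;> simp [colPlus2, theta_conj, ← exp_conj]

theorem isSectorFun_leftSol {u : ℝ → ℂ} (hu : IsPotential u) (x : ℝ) :
    IsSectorFun sectorMinus Dminus (fun l => (leftSol u l).1 x) ∧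
      IsSectorFun sectorMinus Dminus fun l => (leftSol u l).2 x := by
  obtain ⟨⟨⟨C, hC⟩, -⟩, -⟩ := IsLeftSol.asymptotics hu (a := fun l => (leftSol u l).1)
    (b := fun l => (leftSol u l).2) (fun l hl => isLeftSol_leftSol hu hl) x
  exact ⟨⟨(continuousOn_leftSol hu x).1, fun l hl => (differentiableAt_leftSol hu hl x).1,
      isBigO_one_of_forall_norm_le fun l hl h => (hC l hl h).1⟩,
    ⟨(continuousOn_leftSol hu x).2, fun l hl => (differentiableAt_leftSol hu hl x).2,
      isBigO_one_of_forall_norm_le fun l hl h => (hC l hl h).2⟩⟩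

theorem isSectorFun_colMinus1 (hq : IsDecayingSolution q) (x t : ℝ) (i : Fin 2) :
    IsSectorFun sectorMinus Dminus fun l => colMinus1 q x t l i := by
  have h := isSectorFun_leftSol (hq.isPotential t) x
  fin_cases i
  · exact h.1.congr isOpen_Dminus Dminus_subset fun l hl => by rw [colMinus1_eq hq hl]; rfl
  · exact h.2.congr isOpen_Dminus Dminus_subset fun l hl => by rw [colMinus1_eq hq hl]; rfl

theorem isSectorFun_colPlus2 (hq : IsDecayingSolution q) (x t : ℝ) (i : Fin 2) :
    IsSectorFun sectorMinus Dminus fun l => colPlus2 q x t l i := by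
  have h := isSectorFun_leftSol (hq.isPotential t).reflect (-x)
  fin_cases i
  · exact h.2.congr isOpen_Dminus Dminus_subset fun l hl => by rw [colPlus2_eq hq hl]; rfl
  · exact h.1.congr isOpen_Dminus Dminus_subset fun l hl => by rw [colPlus2_eq hq hl]; rfl

theorem isSectorFun_colMinus2 (hq : IsDecayingSolution q) (x t : ℝ) (i : Fin 2) :
    IsSectorFun sectorPlus Dplus fun l => colMinus2 q x t l i := by
  fin_cases i
  · exact (isSectorFun_colMinus1 hq x t 1).conj.neg.congr isOpen_Dplus Dplus_subset fun l hl => by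
      rw [colMinus2_eq hq hl]; rfl
  · exact (isSectorFun_colMinus1 hq x t 0).conj.congr isOpen_Dplus Dplus_subset fun l hl => by
      rw [colMinus2_eq hq hl]; rfl

theorem isSectorFun_colPlus1 (hq : IsDecayingSolution q) (x t : ℝ) (i : Fin 2) :
    IsSectorFun sectorPlus Dplus fun l => colPlus1 q x t l i := by
  fin_cases i
  · exact (isSectorFun_colPlus2 hq x t 1).conj.congr isOpen_Dplus Dplus_subset fun l hl => by
      rw [colPlus1_eq hq hl]; rfl
  · exact (isSectorFun_colPlus2 hq x t 0).conj.neg.congr isOpen_Dplus Dplus_subset fun l hl => by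
      rw [colPlus1_eq hq hl]; rfl

/-! ### Limits of the normalised columns at infinity -/

theorem tendsto_zero_of_tendsto_mul {F : Filter ℂ} (hF : F ≤ cocompact ℂ) {f : ℂ → ℂ} {c : ℂ}
    (h : Tendsto (fun l => l * f l) F (𝓝 c)) : Tendsto f F (𝓝 0) := by
  have h1 : Tendsto (fun l : ℂ => l⁻¹) F (𝓝 0) := by
    refine tendsto_inv₀_cobounded.mono_left ?_
    rwa [Metric.cobounded_eq_cocompact]
  have h2 := h1.mul h
  rw [zero_mul] at h2
  refine h2.congr' ?_
  filter_upwards [hF (isCompact_singleton (x := (0 : ℂ))).compl_mem_cocompact] with l hl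
  have : l ≠ 0 := hl
  field_simp

theorem tendsto_colMinus1 (hq : IsDecayingSolution q) (x t : ℝ) :
    Tendsto (fun l => colMinus1 q x t l 0) (cocompact ℂ ⊓ 𝓟 sectorMinus)
        (𝓝 (exp (I * nuMinus q x t))) ∧
      Tendsto (fun l => l * colMinus1 q x t l 1) (cocompact ℂ ⊓ 𝓟 sectorMinus)
        (𝓝 (I / 2 * conj (q x t) * exp (I * nuMinus q x t))) := by
  have hu := hq.isPotential t
  obtain ⟨⟨-, h1⟩, h2⟩ := IsLeftSol.asymptotics hu (a := fun l => (leftSol (fun x => q x t) l).1)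
    (b := fun l => (leftSol (fun x => q x t) l).2) (fun l hl => isLeftSol_leftSol hu hl) x
  have hS := mem_inf_of_right (f := cocompact ℂ) (mem_principal_self sectorMinus)
  refine ⟨h1.congr' ?_, h2.congr' ?_⟩
  · filter_upwards [hS] with l hl
    rw [colMinus1_eq hq hl]; rfl
  · filter_upwards [hS] with l hl
    rw [colMinus1_eq hq hl]; rfl

theorem tendsto_mul_colMinus2 (hq : IsDecayingSolution q) (x t : ℝ) :
    Tendsto (fun l => l * colMinus2 q x t l 0) (cocompact ℂ ⊓ 𝓟 sectorPlus)
      (𝓝 (I / 2 * q x t * exp (-(I * nuMinus q x t)))) := by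
  have h := ((continuous_conj.tendsto _).comp
    ((tendsto_colMinus1 hq x t).2.comp tendsto_conj_cocompact)).neg
  have e : -conj (I / 2 * conj (q x t) * exp (I * nuMinus q x t)) =
      I / 2 * q x t * exp (-(I * nuMinus q x t)) := by
    simp only [map_mul, map_div₀, conj_I, map_ofNat, conj_conj, ← exp_conj, conj_ofReal, neg_mul]
    ring
  rw [e] at h
  refine h.congr' ?_
  filter_upwards [mem_inf_of_right (mem_principal_self sectorPlus)] with l hl
  rw [colMinus2_eq hq hl]
  simp

theorem tendsto_colPlus2 (hq : IsDecayingSolution q) (x t : ℝ) :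
    ∃ c ≠ 0, Tendsto (fun l => colPlus2 q x t l 1) (cocompact ℂ ⊓ 𝓟 sectorMinus) (𝓝 c) ∧
      Tendsto (fun l => colPlus2 q x t l 0) (cocompact ℂ ⊓ 𝓟 sectorMinus) (𝓝 0) := by
  have hu := (hq.isPotential t).reflect
  obtain ⟨⟨-, h1⟩, h2⟩ := IsLeftSol.asymptotics hu
    (a := fun l => (leftSol (reflectPotential fun x => q x t) l).1)
    (b := fun l => (leftSol (reflectPotential fun x => q x t) l).2)
    (fun l hl => isLeftSol_leftSol hu hl) (-x)
  have hS := mem_inf_of_right (f := cocompact ℂ) (mem_principal_self sectorMinus)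
  refine ⟨_, exp_ne_zero _, h1.congr' ?_, (tendsto_zero_of_tendsto_mul inf_le_left h2).congr' ?_⟩
  · filter_upwards [hS] with l hl
    rw [colPlus2_eq hq hl]; rfl
  · filter_upwards [hS] with l hl
    rw [colPlus2_eq hq hl]; rfl

/-! ### Scattering coefficients -/

theorem detCols_smul_smul {c d : ℂ} (h : c * d = 1) (u v : Fin 2 → ℂ) :
    detCols (c • u) (d • v) = detCols u v := by
  simp only [detCols_eq, Pi.smul_apply, smul_eq_mul]
  linear_combination (u 0 * v 1 - v 0 * u 1) * h

theorem s22_eq (hq : IsDecayingSolution q) {l : ℂ} (hl : l ∈ sectorMinus) (x t : ℝ) :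
    s22 q l = detCols (colMinus1 q x t l) (colPlus2 q x t l) := by
  rw [colMinus1, colPlus2, detCols_smul_smul (by rw [← exp_add, neg_add_cancel, exp_zero]), s22,
    (isLaxSolution_psiMinus1 hq hl).detCols_eq (isLaxSolution_psiPlus2 hq hl) x t]

theorem s11_eq (hq : IsDecayingSolution q) {l : ℂ} (hl : l ∈ sectorPlus) (x t : ℝ) :
    s11 q l = detCols (colPlus1 q x t l) (colMinus2 q x t l) := by
  rw [colPlus1, colMinus2, detCols_smul_smul (by rw [← exp_add, neg_add_cancel, exp_zero]), s11,
    (isLaxSolution_psiPlus1 hq hl).detCols_eq (isLaxSolution_psiMinus2 hq hl) x t]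

/-- The symmetry `s₁₁(λ) = s₂₂(λ^*)^*`. -/
theorem s11_eq_conj (hq : IsDecayingSolution q) {l : ℂ} (hl : l ∈ sectorPlus) :
    s11 q l = conj (s22 q (conj l)) := by
  rw [s11_eq hq hl 0 0, s22_eq hq (conj_mem_sectorMinus.2 hl) 0 0, colPlus1_eq hq hl,
    colMinus2_eq hq hl]
  simp only [detCols_eq, map_sub, map_mul, Matrix.cons_val_zero, Matrix.cons_val_one]
  ring

theorem s22_eq_conj (hq : IsDecayingSolution q) {l : ℂ} (hl : l ∈ sectorMinus) :
    s22 q l = conj (s11 q (conj l)) := by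
  rw [s11_eq_conj hq (conj_mem_sectorPlus.2 hl), conj_conj, conj_conj]

theorem s22_neg (hq : IsDecayingSolution q) {l : ℂ} (hl : l ∈ sectorMinus) :
    s22 q (-l) = s22 q l := by
  have hl' : -l ∈ sectorMinus := by simpa [sectorMinus] using hl
  rw [s22_eq hq hl 0 0, s22_eq hq hl' 0 0, colMinus1_eq hq hl, colPlus2_eq hq hl,
    colMinus1_eq hq hl', colPlus2_eq hq hl']
  have h1 := leftSol_neg (hq.isPotential 0) hl 0
  have h2 := leftSol_neg (hq.isPotential 0).reflect hl (-0)
  simp only [detCols_eq, Matrix.cons_val_zero, Matrix.cons_val_one]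
  rw [h1.1, h1.2, h2.1, h2.2]
  ring

theorem s11_neg (hq : IsDecayingSolution q) {l : ℂ} (hl : l ∈ sectorPlus) :
    s11 q (-l) = s11 q l := by
  have hl' : -l ∈ sectorPlus := by simpa [sectorPlus] using hl
  rw [s11_eq_conj hq hl, s11_eq_conj hq hl', map_neg, s22_neg hq (conj_mem_sectorMinus.2 hl)]

theorem isSectorFun_s22 (hq : IsDecayingSolution q) :
    IsSectorFun sectorMinus Dminus (s22 q) := by
  refine (((isSectorFun_colMinus1 hq 0 0 0).mul (isSectorFun_colPlus2 hq 0 0 1)).sub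
    ((isSectorFun_colPlus2 hq 0 0 0).mul (isSectorFun_colMinus1 hq 0 0 1))).congr isOpen_Dminus
    Dminus_subset fun l hl => ?_
  rw [s22_eq hq hl 0 0, detCols_eq]

theorem isSectorFun_s11 (hq : IsDecayingSolution q) :
    IsSectorFun sectorPlus Dplus (s11 q) :=
  (isSectorFun_s22 hq).conj.congr isOpen_Dplus Dplus_subset fun _ hl => s11_eq_conj hq hl

theorem tendsto_s22 (hq : IsDecayingSolution q) :
    ∃ c ≠ 0, Tendsto (s22 q) (cocompact ℂ ⊓ 𝓟 sectorMinus) (𝓝 c) := by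
  obtain ⟨c, hc, h1, h0⟩ := tendsto_colPlus2 hq 0 0
  obtain ⟨h2, h3⟩ := tendsto_colMinus1 hq 0 0
  have h := (h2.mul h1).sub (h0.mul (tendsto_zero_of_tendsto_mul inf_le_left h3))
  refine ⟨_, ?_, h.congr' ?_⟩
  · rw [mul_zero, sub_zero]
    exact mul_ne_zero (exp_ne_zero _) hc
  · filter_upwards [mem_inf_of_right (mem_principal_self sectorMinus)] with l hl
    rw [s22_eq hq hl 0 0, detCols_eq]

theorem tendsto_s11 (hq : IsDecayingSolution q) :
    ∃ c ≠ 0, Tendsto (s11 q) (cocompact ℂ ⊓ 𝓟 sectorPlus) (𝓝 c) := by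
  obtain ⟨c, hc, h⟩ := tendsto_s22 hq
  refine ⟨conj c, (map_ne_zero _).2 hc,
    ((continuous_conj.tendsto _).comp (h.comp tendsto_conj_cocompact)).congr' ?_⟩
  filter_upwards [mem_inf_of_right (mem_principal_self sectorPlus)] with l hl
  rw [s11_eq_conj hq hl]; rfl

theorem iteratedDeriv_conj_conj (f : ℂ → ℂ) (k : ℕ) (l : ℂ) :
    iteratedDeriv k (fun l => conj (f (conj l))) l = conj (iteratedDeriv k f (conj l)) := by
  induction k generalizing l with
  | zero => simp
  | succ k ih =>
    rw [iteratedDeriv_succ, iteratedDeriv_succ, funext ih]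
    exact congrFun (deriv_conj_conj (f := iteratedDeriv k f)) l

theorem iteratedDeriv_s22 (hq : IsDecayingSolution q) (k : ℕ) {l : ℂ} (hl : l ∈ Dminus) :
    iteratedDeriv k (s22 q) l = conj (iteratedDeriv k (s11 q) (conj l)) := by
  rw [← iteratedDeriv_conj_conj]
  refine Filter.EventuallyEq.iteratedDeriv_eq k ?_
  filter_upwards [isOpen_Dminus.mem_nhds hl] with w hw using s22_eq_conj hq (Dminus_subset hw)

theorem iteratedDeriv_s11_neg (hq : IsDecayingSolution q) (k : ℕ) {l : ℂ} (hl : l ∈ Dplus) :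
    iteratedDeriv k (s11 q) (-l) = (-1) ^ k * iteratedDeriv k (s11 q) l := by
  have h1 : iteratedDeriv k (s11 q) l = iteratedDeriv k (fun l => s11 q (-l)) l := by
    refine Filter.EventuallyEq.iteratedDeriv_eq k ?_
    filter_upwards [isOpen_Dplus.mem_nhds hl] with w hw
      using (s11_neg hq (Dplus_subset hw)).symm
  rw [h1, iteratedDeriv_comp_neg, smul_eq_mul, ← mul_assoc, ← mul_pow]
  simp

section Zeros

variable {N : ℕ} {lam : Fin N → ℂ}

theorem HasTripleZeros.zeta_mem (h : HasTripleZeros q lam) (n : Fin N ⊕ Fin N) :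
    zeta lam n ∈ Dplus := by
  rcases n with n | n
  · exact mul_pos (h.re_pos n) (h.im_pos n)
  · have := mul_pos (h.re_pos n) (h.im_pos n)
    simpa [zeta, Dplus] using this

theorem HasTripleZeros.injective_zeta (h : HasTripleZeros q lam) :
    Function.Injective (zeta lam) := by
  have key : ∀ m n, lam m ≠ -lam n := fun m n e => by
    have := congrArg re e
    rw [neg_re] at this
    linarith [h.re_pos m, h.re_pos n]
  rintro (m | m) (n | n) e
  · exact congrArg _ (h.injective e)
  · exact absurd e (key m n)
  · exact absurd e.symm (key n m)
  · exact congrArg _ (h.injective (neg_injective e))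

theorem HasTripleZeros.s11_eq_zero_iff (h : HasTripleZeros q lam) (hq : IsDecayingSolution q)
    (hns : NoSpectralSingularity q) {l : ℂ} (hl : l ∈ sectorPlus) :
    s11 q l = 0 ↔ ∃ n, l = zeta lam n := by
  constructor
  · intro h0
    by_cases hc : l ∈ contour
    · exact absurd h0 (hns l hc).1
    have hpos : 0 < l.re * l.im :=
      lt_of_le_of_ne hl fun e => hc (mem_contour_iff.2 e.symm)
    rcases pos_and_pos_or_neg_and_neg_of_mul_pos hpos with ⟨h1, h2⟩ | ⟨h1, h2⟩
    · obtain ⟨n, rfl⟩ := (h.zero_iff l h1 h2).1 h0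
      exact ⟨Sum.inl n, rfl⟩
    · obtain ⟨n, hn⟩ := (h.zero_iff (-l) (by simpa using h1) (by simpa using h2)).1
        (by rw [s11_neg hq hl, h0])
      exact ⟨Sum.inr n, by rw [zeta, Sum.elim_inr, ← hn, neg_neg]⟩
  · rintro ⟨n | n, rfl⟩
    · exact (h.zero_iff _ (h.re_pos n) (h.im_pos n)).2 ⟨n, rfl⟩
    · refine (s11_neg hq (Dplus_subset (h.zeta_mem (Sum.inl n)))).trans ?_
      exact (h.zero_iff _ (h.re_pos n) (h.im_pos n)).2 ⟨n, rfl⟩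

theorem HasTripleZeros.s22_eq_zero_iff (h : HasTripleZeros q lam) (hq : IsDecayingSolution q)
    (hns : NoSpectralSingularity q) {l : ℂ} (hl : l ∈ sectorMinus) :
    s22 q l = 0 ↔ ∃ n, l = conj (zeta lam n) := by
  rw [s22_eq_conj hq hl, map_eq_zero, h.s11_eq_zero_iff hq hns (conj_mem_sectorPlus.2 hl)]
  refine exists_congr fun n => ⟨fun e => by rw [← e, conj_conj], fun e => by rw [e, conj_conj]⟩

/-- `f` has a triple zero at `z₀`. -/
structure HasTripleZeroAt (f : ℂ → ℂ) (z₀ : ℂ) : Prop where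
  zero : f z₀ = 0
  one : iteratedDeriv 1 f z₀ = 0
  two : iteratedDeriv 2 f z₀ = 0
  three : iteratedDeriv 3 f z₀ ≠ 0

theorem HasTripleZeros.s11_triple (h : HasTripleZeros q lam) (hq : IsDecayingSolution q)
    (n : Fin N ⊕ Fin N) : HasTripleZeroAt (s11 q) (zeta lam n) := by
  have key : ∀ n, HasTripleZeroAt (s11 q) (lam n) := fun n =>
    ⟨(h.zero_iff _ (h.re_pos n) (h.im_pos n)).2 ⟨n, rfl⟩, h.deriv_one n, h.deriv_two n,
      h.deriv_three n⟩
  rcases n with n | n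
  · exact key n
  · have hl := h.zeta_mem (Sum.inl n)
    change lam n ∈ Dplus at hl
    refine ⟨?_, ?_, ?_, ?_⟩
    · exact (s11_neg hq (Dplus_subset hl)).trans (key n).zero
    · exact (iteratedDeriv_s11_neg hq 1 hl).trans (by rw [(key n).one, mul_zero])
    · exact (iteratedDeriv_s11_neg hq 2 hl).trans (by rw [(key n).two, mul_zero])
    · rw [show zeta lam (Sum.inr n) = -lam n from rfl, iteratedDeriv_s11_neg hq 3 hl]
      exact mul_ne_zero (by norm_num) (key n).three

theorem HasTripleZeros.s22_triple (h : HasTripleZeros q lam) (hq : IsDecayingSolution q)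
    (n : Fin N ⊕ Fin N) : HasTripleZeroAt (s22 q) (conj (zeta lam n)) := by
  have hl := conj_mem_Dminus.2 (h.zeta_mem n)
  have k := h.s11_triple hq n
  refine ⟨?_, ?_, ?_, ?_⟩
  · rw [s22_eq_conj hq (Dminus_subset hl), conj_conj, k.zero, map_zero]
  · rw [iteratedDeriv_s22 hq _ hl, conj_conj, k.one, map_zero]
  · rw [iteratedDeriv_s22 hq _ hl, conj_conj, k.two, map_zero]
  · rw [iteratedDeriv_s22 hq _ hl, conj_conj]
    exact (map_ne_zero _).2 k.three

end Zeros

/-! ### Norming constants and principal parts -/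

/-- The Taylor polynomial `b + d ε + h ε² / 2`, `ε = λ - z₀`, formed by norming constants. -/
noncomputable def normingPoly (b d h z₀ l : ℂ) : ℂ := b + d * (l - z₀) + h / 2 * (l - z₀) ^ 2

theorem tendsto_sub_nhdsNE (z₀ : ℂ) : Tendsto (fun z => z - z₀) (𝓝[≠] z₀) (𝓝 0) := by
  have : Continuous fun z : ℂ => z - z₀ := by fun_prop
  simpa using (this.tendsto z₀).mono_left nhdsWithin_le_nhds

theorem eq_zero_of_isBigO_pow {r : ℂ → ℂ} {c z₀ : ℂ} {n : ℕ}
    (h : (fun z => c + (z - z₀) * r z) =O[𝓝[≠] z₀] fun z => (z - z₀) ^ (n + 1))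
    (hr : ContinuousAt r z₀) : c = 0 ∧ r =O[𝓝[≠] z₀] fun z => (z - z₀) ^ n := by
  have hε := tendsto_sub_nhdsNE z₀
  have h1 : Tendsto (fun z => (z - z₀) ^ (n + 1)) (𝓝[≠] z₀) (𝓝 0) := by
    simpa using hε.pow (n + 1)
  have h2 := h.trans_tendsto h1
  have h3 : Tendsto (fun z => c + (z - z₀) * r z) (𝓝[≠] z₀) (𝓝 c) := by
    simpa using (hε.mul (hr.tendsto.mono_left nhdsWithin_le_nhds)).const_add c
  have hc := tendsto_nhds_unique h3 h2
  refine ⟨hc, ?_⟩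
  rw [hc] at h
  have h4 := h.mul (Asymptotics.isBigO_refl (fun z => (z - z₀)⁻¹) (𝓝[≠] z₀))
  refine h4.congr' ?_ ?_
  · filter_upwards [sub_ne_zero_eventually z₀] with z hz
    field_simp
    ring
  · filter_upwards [sub_ne_zero_eventually z₀] with z hz
    rw [pow_succ, mul_assoc, mul_inv_cancel₀ hz, mul_one]

theorem eq_zero_of_quadratic_isBigO {c₀ c₁ c₂ z₀ : ℂ}
    (h : (fun z => c₀ + c₁ * (z - z₀) + c₂ * (z - z₀) ^ 2) =O[𝓝[≠] z₀] fun z => (z - z₀) ^ 3) :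
    c₀ = 0 ∧ c₁ = 0 ∧ c₂ = 0 := by
  have h0 := eq_zero_of_isBigO_pow (r := fun z => c₁ + (z - z₀) * c₂) (c := c₀) (n := 2)
    (h.congr_left fun z => by ring) (by fun_prop)
  have h1 := eq_zero_of_isBigO_pow (r := fun _ => c₂) (n := 1) h0.2 (by fun_prop)
  have h2 := eq_zero_of_isBigO_pow (r := fun _ => 0) (c := c₂) (n := 0)
    (by simpa using h1.2) (by fun_prop)
  exact ⟨h0.1, h1.1, h2.1⟩

theorem taylor_two {f : ℂ → ℂ} {z₀ : ℂ} (hf : AnalyticAt ℂ f z₀) :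
    (fun z => f z - (f z₀ + iteratedDeriv 1 f z₀ * (z - z₀) +
      iteratedDeriv 2 f z₀ / 2 * (z - z₀) ^ 2)) =O[𝓝[≠] z₀] fun z => (z - z₀) ^ 3 := by
  have ht := (taylor_isBigO hf 3).mono (nhdsWithin_le_nhds (s := {z₀}ᶜ))
  refine ht.congr_left fun z => ?_
  simp [Finset.sum_range_succ, Nat.factorial]

theorem mul_cube_isBigO {f : ℂ → ℂ} {z₀ : ℂ} (hf : ContinuousAt f z₀) :
    (fun z => f z * (z - z₀) ^ 3) =O[𝓝[≠] z₀] fun z => (z - z₀) ^ 3 := by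
  simpa using (isBigO_one_of_continuousAt hf).mul
    (Asymptotics.isBigO_refl (fun z : ℂ => (z - z₀) ^ 3) (𝓝[≠] z₀))

/-- The product of the Taylor polynomial of an analytic function with a quadratic polynomial. -/
theorem quadratic_mul_isBigO {g : ℂ → ℂ} {z₀ : ℂ} (hg : AnalyticAt ℂ g z₀) (b d h : ℂ) :
    (fun z => normingPoly b d h z₀ z * g z - (b * g z₀ +
      (d * g z₀ + b * iteratedDeriv 1 g z₀) * (z - z₀) +
      (h / 2 * g z₀ + d * iteratedDeriv 1 g z₀ + b * (iteratedDeriv 2 g z₀ / 2)) * (z - z₀) ^ 2))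
      =O[𝓝[≠] z₀] fun z => (z - z₀) ^ 3 := by
  have hP : ContinuousAt (normingPoly b d h z₀) z₀ := by unfold normingPoly; fun_prop
  have h1 := (isBigO_one_of_continuousAt hP).mul (taylor_two hg)
  simp only [one_mul] at h1
  have h2 := mul_cube_isBigO (z₀ := z₀) (f := fun z => d * (iteratedDeriv 2 g z₀ / 2) +
    h / 2 * iteratedDeriv 1 g z₀ + h / 2 * (iteratedDeriv 2 g z₀ / 2) * (z - z₀)) (by fun_prop)
  refine (h1.add h2).congr_left fun z => ?_
  simp only [normingPoly]
  ring

/-- The norming relations say that `f - (b + d ε + h ε² / 2) g` vanishes to third order. -/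
theorem sub_normingPoly_isBigO_iff {f g : ℂ → ℂ} {z₀ : ℂ} (hf : AnalyticAt ℂ f z₀)
    (hg : AnalyticAt ℂ g z₀) (b d h : ℂ) :
    ((fun z => f z - normingPoly b d h z₀ z * g z) =O[𝓝[≠] z₀] fun z => (z - z₀) ^ 3) ↔
      f z₀ = b * g z₀ ∧ iteratedDeriv 1 f z₀ - b * iteratedDeriv 1 g z₀ = d * g z₀ ∧
        iteratedDeriv 2 f z₀ - b * iteratedDeriv 2 g z₀ - 2 * d * iteratedDeriv 1 g z₀ =
          h * g z₀ := by
  have hT := (taylor_two hf).sub (quadratic_mul_isBigO hg b d h)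
  constructor
  · intro H
    obtain ⟨h0, h1, h2⟩ := eq_zero_of_quadratic_isBigO (z₀ := z₀) (c₀ := f z₀ - b * g z₀)
      (c₁ := iteratedDeriv 1 f z₀ - (d * g z₀ + b * iteratedDeriv 1 g z₀))
      (c₂ := iteratedDeriv 2 f z₀ / 2 - (h / 2 * g z₀ + d * iteratedDeriv 1 g z₀ +
        b * (iteratedDeriv 2 g z₀ / 2))) ((H.sub hT).congr_left fun z => by ring)
    exact ⟨by linear_combination h0, by linear_combination h1, by linear_combination 2 * h2⟩
  · rintro ⟨h0, h1, h2⟩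
    refine hT.congr_left fun z => ?_
    linear_combination (-1) * h0 - (z - z₀) * h1 - (z - z₀) ^ 2 / 2 * h2

theorem HasTripleZeroAt.isBigO {s : ℂ → ℂ} {z₀ : ℂ} (h : HasTripleZeroAt s z₀)
    (hs : AnalyticAt ℂ s z₀) : s =O[𝓝[≠] z₀] fun z => (z - z₀) ^ 3 :=
  (taylor_two hs).congr_left fun z => by rw [h.zero, h.one, h.two]; ring

theorem HasTripleZeroAt.cube_div_isBigO {s : ℂ → ℂ} {z₀ : ℂ} (h : HasTripleZeroAt s z₀)
    (hs : AnalyticAt ℂ s z₀) :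
    (fun z => (z - z₀) ^ 3 / s z) =O[𝓝[≠] z₀] fun _ => (1 : ℂ) := by
  have := div_sub_isBigO_of_triple_zero hs h.zero h.one h.two h.three (A := 0) (D := 0) (F := 0)
    (b₀ := 0) (b₁ := 0) (b₂ := 0) (β := fun z => (z - z₀) ^ 3)
    (by simpa using Asymptotics.isBigO_refl _ _) (by simp) (by simp) (by simp)
  simpa using this

theorem iteratedDeriv_apply {F : ℂ → Fin 2 → ℂ} (k : ℕ) {l : ℂ}
    (hF : ∀ i, AnalyticAt ℂ (fun l => F l i) l) (i : Fin 2) :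
    iteratedDeriv k F l i = iteratedDeriv k (fun l => F l i) l := by
  suffices h : ∀ k : ℕ, ∀ l, (∀ i, AnalyticAt ℂ (fun l => F l i) l) →
      iteratedDeriv k F l = fun i => iteratedDeriv k (fun l => F l i) l by rw [h k l hF]
  intro k
  induction k with
  | zero => intro l _; simp
  | succ k ih =>
    intro l hl
    have hev : ∀ᶠ z in 𝓝 l, ∀ i, AnalyticAt ℂ (fun l => F l i) z :=
      eventually_all.2 fun i => (hl i).eventually_analyticAt
    have h1 : iteratedDeriv k F =ᶠ[𝓝 l] fun z i => iteratedDeriv k (fun l => F l i) z :=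
      hev.mono fun z hz => ih z hz
    rw [iteratedDeriv_succ, h1.deriv_eq, deriv_pi]
    · simp [iteratedDeriv_succ]
    · intro i
      have := (hl i).iterated_deriv k
      rw [← iteratedDeriv_eq_iterate] at this
      exact this.differentiableAt

/-- Two analytic vectors in `ℂ²` that are linearly dependent to third order. -/
theorem exists_sub_normingPoly_isBigO {f g : ℂ → Fin 2 → ℂ} {z₀ : ℂ}
    (hf : ∀ i, AnalyticAt ℂ (fun l => f l i) z₀) (hg : ∀ i, AnalyticAt ℂ (fun l => g l i) z₀)
    (hg0 : g z₀ ≠ 0)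
    (hdet : (fun l => detCols (f l) (g l)) =O[𝓝[≠] z₀] fun l => (l - z₀) ^ 3) :
    ∃ b d h, ∀ i, (fun l => f l i - normingPoly b d h z₀ l * g l i) =O[𝓝[≠] z₀]
      fun l => (l - z₀) ^ 3 := by
  obtain ⟨i, hi⟩ := Function.ne_iff.1 hg0
  have hr : AnalyticAt ℂ (fun l => f l i / g l i) z₀ := (hf i).div (hg i) hi
  have hne : ∀ᶠ l in 𝓝[≠] z₀, g l i ≠ 0 :=
    nhdsWithin_le_nhds ((hg i).continuousAt.eventually_ne hi)
  set b := f z₀ i / g z₀ i with hb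
  set d := iteratedDeriv 1 (fun l => f l i / g l i) z₀ with hd
  set h := iteratedDeriv 2 (fun l => f l i / g l i) z₀ with hh
  have hi' : (fun l => f l i - normingPoly b d h z₀ l * g l i) =O[𝓝[≠] z₀]
      fun l => (l - z₀) ^ 3 := by
    have h1 := (taylor_two hr).mul (isBigO_one_of_continuousAt (hg i).continuousAt)
    simp only [mul_one] at h1
    refine h1.congr' ?_ EventuallyEq.rfl
    filter_upwards [hne] with l hl
    rw [← hb, ← hd, ← hh, normingPoly]
    field_simp
  refine ⟨b, d, h, fun j => ?_⟩
  by_cases hj : j = i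
  · rw [hj]; exact hi'
  have hD : (fun l => f l j * g l i - f l i * g l j) =O[𝓝[≠] z₀] fun l => (l - z₀) ^ 3 := by
    have : (i = 0 ∧ j = 1) ∨ (i = 1 ∧ j = 0) := by revert hj; fin_cases i <;> fin_cases j <;> simp
    rcases this with ⟨rfl, rfl⟩ | ⟨rfl, rfl⟩
    · refine hdet.neg_left.congr_left fun l => ?_
      rw [detCols_eq]; ring
    · refine hdet.congr_left fun l => ?_
      rw [detCols_eq]; ring
  have h1 := hi'.mul (isBigO_one_of_continuousAt (hg j).continuousAt)
  simp only [mul_one] at h1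
  have h2 := (hD.add h1).mul (isBigO_one_of_continuousAt ((hg i).continuousAt.inv₀ hi))
  simp only [mul_one] at h2
  refine h2.congr' ?_ EventuallyEq.rfl
  filter_upwards [hne] with l hl
  simp only [Pi.inv_apply]
  field_simp
  ring

variable {q : ℝ → ℝ → ℂ}

/-- Families of solutions of the Lax pair near `z₀` whose Wronskian has a triple zero at `z₀`. -/
structure IsSpectralPair (q : ℝ → ℝ → ℂ) (f g : ℂ → ℝ → ℝ → Fin 2 → ℂ) (z₀ : ℂ) : Prop where
  lax_fst : ∀ᶠ l in 𝓝 z₀, IsLaxSolution q l (f l)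
  lax_snd : ∀ᶠ l in 𝓝 z₀, IsLaxSolution q l (g l)
  analytic_fst : ∀ x t i, AnalyticAt ℂ (fun l => f l x t i) z₀
  analytic_snd : ∀ x t i, AnalyticAt ℂ (fun l => g l x t i) z₀
  ne_fst : f z₀ 0 0 ≠ 0
  ne_snd : g z₀ 0 0 ≠ 0
  det_isBigO : (fun l => detCols (f l 0 0) (g l 0 0)) =O[𝓝[≠] z₀] fun l => (l - z₀) ^ 3

/-- The norming relations at a single point `z₀`. -/
structure IsNormingAt (f g : ℂ → ℝ → ℝ → Fin 2 → ℂ) (b d h z₀ : ℂ) : Prop where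
  zero : ∀ x t, f z₀ x t = b • g z₀ x t
  one : ∀ x t, iteratedDeriv 1 (fun l => f l x t) z₀ - b • iteratedDeriv 1 (fun l => g l x t) z₀ =
    d • g z₀ x t
  two : ∀ x t, iteratedDeriv 2 (fun l => f l x t) z₀ - b • iteratedDeriv 2 (fun l => g l x t) z₀ -
    (2 * d) • iteratedDeriv 1 (fun l => g l x t) z₀ = h • g z₀ x t

namespace IsSpectralPair

variable {f g : ℂ → ℝ → ℝ → Fin 2 → ℂ} {z₀ : ℂ}

theorem isNormingAt_iff (hp : IsSpectralPair q f g z₀) {b d h : ℂ} :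
    IsNormingAt f g b d h z₀ ↔ ∀ x t i,
      (fun l => f l x t i - normingPoly b d h z₀ l * g l x t i) =O[𝓝[≠] z₀]
        fun l => (l - z₀) ^ 3 := by
  have e : ∀ (k : ℕ) x t i, iteratedDeriv k (fun l => f l x t) z₀ i =
      iteratedDeriv k (fun l => f l x t i) z₀ := fun k x t i =>
    iteratedDeriv_apply k (fun i => hp.analytic_fst x t i) i
  have e' : ∀ (k : ℕ) x t i, iteratedDeriv k (fun l => g l x t) z₀ i =
      iteratedDeriv k (fun l => g l x t i) z₀ := fun k x t i =>
    iteratedDeriv_apply k (fun i => hp.analytic_snd x t i) i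
  have key := fun x t i => sub_normingPoly_isBigO_iff (hp.analytic_fst x t i)
    (hp.analytic_snd x t i) b d h
  constructor
  · intro H x t i
    refine (key x t i).2 ⟨?_, ?_, ?_⟩
    · simpa using congrFun (H.zero x t) i
    · simpa [e, e', -iteratedDeriv_one] using congrFun (H.one x t) i
    · simpa [e, e', -iteratedDeriv_one] using congrFun (H.two x t) i
  · intro H
    refine ⟨fun x t => funext fun i => ?_, fun x t => funext fun i => ?_,
      fun x t => funext fun i => ?_⟩
    · simpa using ((key x t i).1 (H x t i)).1
    · simpa [e, e', -iteratedDeriv_one] using ((key x t i).1 (H x t i)).2.1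
    · simpa [e, e', -iteratedDeriv_one] using ((key x t i).1 (H x t i)).2.2

/-- Norming constants exist: they are read off at `(x, t) = (0, 0)`, and third order vanishing
there propagates to all `(x, t)` because solutions of the Lax pair are controlled by their values at
the origin. -/
theorem exists_isNormingAt (hp : IsSpectralPair q f g z₀) (hq : IsDecayingSolution q) :
    ∃ b d h, IsNormingAt f g b d h z₀ := by
  obtain ⟨b, d, h, H⟩ := exists_sub_normingPoly_isBigO (f := fun l => f l 0 0)
    (g := fun l => g l 0 0) (hp.analytic_fst 0 0) (hp.analytic_snd 0 0) hp.ne_snd hp.det_isBigO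
  refine ⟨b, d, h, hp.isNormingAt_iff.2 fun x t i => ?_⟩
  obtain ⟨C, hC⟩ := exists_isLaxSolution_bound hq x t (‖z₀‖ + 1)
  have h0 : (fun l => f l 0 0 - normingPoly b d h z₀ l • g l 0 0) =O[𝓝[≠] z₀]
      fun l => (l - z₀) ^ 3 := Asymptotics.isBigO_pi.2 fun i => H i
  refine Asymptotics.IsBigO.trans (Asymptotics.IsBigO.of_bound C ?_) h0
  have hb : ∀ᶠ l in 𝓝 z₀, l ∈ Metric.closedBall (0 : ℂ) (‖z₀‖ + 1) :=
    Metric.closedBall_mem_nhds_of_mem (by simp)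
  filter_upwards [nhdsWithin_le_nhds hb, nhdsWithin_le_nhds hp.lax_fst,
    nhdsWithin_le_nhds hp.lax_snd] with l hl hlf hlg
  refine le_trans ?_ (hC l hl _ (hlf.sub_smul (c := normingPoly b d h z₀ l) hlg))
  exact norm_le_pi_norm (f l x t - normingPoly b d h z₀ l • g l x t) i

theorem ne_zero (hp : IsSpectralPair q f g z₀) {b d h : ℂ} (H : IsNormingAt f g b d h z₀) :
    b ≠ 0 := fun hb => hp.ne_fst (by rw [H.zero, hb, zero_smul])

end IsSpectralPair

theorem iteratedDeriv_exp_two_mul {φ : ℂ → ℂ} {z₀ : ℂ} (hφ : AnalyticAt ℂ φ z₀) :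
    iteratedDeriv 1 (fun l => exp (2 * φ l)) z₀ = 2 * iteratedDeriv 1 φ z₀ * exp (2 * φ z₀) ∧
      iteratedDeriv 2 (fun l => exp (2 * φ l)) z₀ =
        2 * (iteratedDeriv 2 φ z₀ + 2 * iteratedDeriv 1 φ z₀ ^ 2) * exp (2 * φ z₀) := by
  have h1 : ∀ l, AnalyticAt ℂ φ l →
      HasDerivAt (fun l => exp (2 * φ l)) (2 * deriv φ l * exp (2 * φ l)) l := fun l hl =>
    (hl.differentiableAt.hasDerivAt.const_mul 2).cexp.congr_deriv (by ring)
  refine ⟨by rw [iteratedDeriv_one, iteratedDeriv_one, (h1 z₀ hφ).deriv], ?_⟩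
  have h2 : deriv (fun l => exp (2 * φ l)) =ᶠ[𝓝 z₀] fun l => 2 * deriv φ l * exp (2 * φ l) :=
    hφ.eventually_analyticAt.mono fun l hl => (h1 l hl).deriv
  have h3 := (hφ.deriv.differentiableAt.hasDerivAt.const_mul 2).mul (h1 z₀ hφ)
  have e : ∀ f : ℂ → ℂ, iteratedDeriv 2 f z₀ = deriv (deriv f) z₀ := fun f => by
    rw [iteratedDeriv_succ, iteratedDeriv_one]
  rw [e, e, h2.deriv_eq, iteratedDeriv_one]
  refine Eq.trans (HasDerivAt.deriv h3) ?_
  ring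

/-- The principal part of `f / s` at a triple zero of `s`, in terms of `g` and the norming
constants. The factors `e^{±φ}` are those that normalise the two columns. -/
theorem IsSpectralPair.div_sub_poleCoef_isBigO {f g : ℂ → ℝ → ℝ → Fin 2 → ℂ} {z₀ : ℂ}
    (hp : IsSpectralPair q f g z₀) {b d h : ℂ} (H : IsNormingAt f g b d h z₀) {s : ℂ → ℂ}
    (hs : AnalyticAt ℂ s z₀) (hs3 : HasTripleZeroAt s z₀) {φ : ℂ → ℂ} (hφ : AnalyticAt ℂ φ z₀)
    {A B C : ℂ} (hA : A = 6 * b / iteratedDeriv 3 s z₀)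
    (hB : B = d / b - iteratedDeriv 4 s z₀ / (4 * iteratedDeriv 3 s z₀))
    (hC : C = h / (2 * b) - d * iteratedDeriv 4 s z₀ / (4 * b * iteratedDeriv 3 s z₀)
      + iteratedDeriv 4 s z₀ ^ 2 / (16 * iteratedDeriv 3 s z₀ ^ 2)
      - iteratedDeriv 5 s z₀ / (20 * iteratedDeriv 3 s z₀)) (x t : ℝ) (i : Fin 2) :
    (fun l => exp (φ l) * f l x t i / s l - poleCoef (A * exp (2 * φ z₀))
      (B + 2 * iteratedDeriv 1 φ z₀)
      (C + (iteratedDeriv 2 φ z₀ + 2 * iteratedDeriv 1 φ z₀ ^ 2) + 2 * iteratedDeriv 1 φ z₀ * B)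
      z₀ l * (exp (-φ l) * g l x t i)) =O[𝓝[≠] z₀] fun _ => (1 : ℂ) := by
  have hb := hp.ne_zero H
  have h3 := hs3.three
  have hE : AnalyticAt ℂ (fun l => exp (2 * φ l)) z₀ := (analyticAt_const.mul hφ).cexp
  obtain ⟨e1, e2⟩ := iteratedDeriv_exp_two_mul hφ
  have hβ := quadratic_mul_isBigO hE b d h
  rw [e1, e2] at hβ
  have h1 := div_sub_isBigO_of_triple_zero hs hs3.zero hs3.one hs3.two h3 hβ
    (A := A * exp (2 * φ z₀)) (D := B + 2 * iteratedDeriv 1 φ z₀)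
    (F := C + (iteratedDeriv 2 φ z₀ + 2 * iteratedDeriv 1 φ z₀ ^ 2) + 2 * iteratedDeriv 1 φ z₀ * B)
    (by rw [hA]; field_simp) (by rw [hA, hB]; field_simp; ring)
    (by rw [hA, hB, hC]; field_simp; ring)
  have hcφ : ContinuousAt (fun l => exp (φ l)) z₀ := hφ.cexp.continuousAt
  have hcg : ContinuousAt (fun l => exp (-φ l) * g l x t i) z₀ :=
    (hφ.neg.cexp.mul (hp.analytic_snd x t i)).continuousAt
  have h2 := h1.mul (isBigO_one_of_continuousAt hcg)
  have h4 := ((isBigO_one_of_continuousAt hcφ).mul (hp.isNormingAt_iff.1 H x t i)).mul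
    (Asymptotics.isBigO_refl (fun l => (s l)⁻¹) (𝓝[≠] z₀))
  have h5 := h4.trans ((hs3.cube_div_isBigO hs).congr_left fun l => by
    rw [div_eq_mul_inv, one_mul])
  simp only [mul_one] at h2
  refine (h5.add h2).congr_left fun l => ?_
  have e : exp (2 * φ l) * exp (-φ l) = exp (φ l) := by rw [← exp_add]; congr 1; ring
  rw [poleCoef, div_eq_mul_inv _ (s l), div_eq_mul_inv _ (s l)]
  linear_combination (normingPoly b d h z₀ l * g l x t i * (s l)⁻¹) * e

/-! ### Norming constants of a decaying solution -/

variable {q : ℝ → ℝ → ℂ}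

theorem IsLaxSolution.eq_zero (hq : IsDecayingSolution q) {l : ℂ} {f : ℝ → ℝ → Fin 2 → ℂ}
    (hf : IsLaxSolution q l f) (h0 : f 0 0 = 0) (x t : ℝ) : f x t = 0 := by
  obtain ⟨C, hC⟩ := exists_isLaxSolution_bound hq x t ‖l‖
  have := hC l (by simp) f hf
  rwa [h0, norm_zero, mul_zero, norm_le_zero_iff] at this

theorem jost_ne_zero (hq : IsDecayingSolution q) {F : Filter ℝ} [F.NeBot] (hF : F ≤ cocompact ℝ)
    {j : Fin 2} {l : ℂ} (hE : ∀ t, ∃! f, IsJostColumn q F j l t f) : jost q F j l 0 0 ≠ 0 := by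
  intro h0
  have h := (isJostColumn_jost (hE 0)).2
  have hz := fun x => (isLaxSolution_jost hq hF hE).eq_zero hq h0 x 0
  simp only [hz, smul_zero] at h
  have := congrFun (tendsto_nhds_unique tendsto_const_nhds h) j
  simp at this

theorem differentiable_theta (x t : ℝ) : Differentiable ℂ fun l => theta l x t := by
  unfold theta
  fun_prop

theorem analyticAt_theta (l : ℂ) (x t : ℝ) : AnalyticAt ℂ (fun l => theta l x t) l :=
  (differentiable_theta x t).analyticAt l

theorem psiMinus1_eq_col (l : ℂ) (x t : ℝ) :
    psiMinus1 q l x t = exp (I * theta l x t) • colMinus1 q x t l := by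
  rw [colMinus1, smul_smul, ← exp_add, add_neg_cancel, exp_zero, one_smul]

theorem psiPlus2_eq_col (l : ℂ) (x t : ℝ) :
    psiPlus2 q l x t = exp (-(I * theta l x t)) • colPlus2 q x t l := by
  rw [colPlus2, smul_smul, ← exp_add, neg_add_cancel, exp_zero, one_smul]

theorem psiMinus2_eq_col (l : ℂ) (x t : ℝ) :
    psiMinus2 q l x t = exp (-(I * theta l x t)) • colMinus2 q x t l := by
  rw [colMinus2, smul_smul, ← exp_add, neg_add_cancel, exp_zero, one_smul]

theorem psiPlus1_eq_col (l : ℂ) (x t : ℝ) :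
    psiPlus1 q l x t = exp (I * theta l x t) • colPlus1 q x t l := by
  rw [colPlus1, smul_smul, ← exp_add, add_neg_cancel, exp_zero, one_smul]

theorem analyticAt_psiMinus1 (hq : IsDecayingSolution q) {l : ℂ} (hl : l ∈ Dminus) (x t : ℝ)
    (i : Fin 2) : AnalyticAt ℂ (fun l => psiMinus1 q l x t i) l := by
  simp only [psiMinus1_eq_col]
  exact (analyticAt_const.mul (analyticAt_theta l x t)).cexp.mul
    ((isSectorFun_colMinus1 hq x t i).analyticAt isOpen_Dminus hl)

theorem analyticAt_psiPlus2 (hq : IsDecayingSolution q) {l : ℂ} (hl : l ∈ Dminus) (x t : ℝ)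
    (i : Fin 2) : AnalyticAt ℂ (fun l => psiPlus2 q l x t i) l := by
  simp only [psiPlus2_eq_col]
  exact (analyticAt_const.mul (analyticAt_theta l x t)).neg.cexp.mul
    ((isSectorFun_colPlus2 hq x t i).analyticAt isOpen_Dminus hl)

theorem analyticAt_psiMinus2 (hq : IsDecayingSolution q) {l : ℂ} (hl : l ∈ Dplus) (x t : ℝ)
    (i : Fin 2) : AnalyticAt ℂ (fun l => psiMinus2 q l x t i) l := by
  simp only [psiMinus2_eq_col]
  exact (analyticAt_const.mul (analyticAt_theta l x t)).neg.cexp.mul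
    ((isSectorFun_colMinus2 hq x t i).analyticAt isOpen_Dplus hl)

theorem analyticAt_psiPlus1 (hq : IsDecayingSolution q) {l : ℂ} (hl : l ∈ Dplus) (x t : ℝ)
    (i : Fin 2) : AnalyticAt ℂ (fun l => psiPlus1 q l x t i) l := by
  simp only [psiPlus1_eq_col]
  exact (analyticAt_const.mul (analyticAt_theta l x t)).cexp.mul
    ((isSectorFun_colPlus1 hq x t i).analyticAt isOpen_Dplus hl)

section Norming

variable {N : ℕ} {lam : Fin N → ℂ}

theorem isSpectralPair_plus (hq : IsDecayingSolution q) (h : HasTripleZeros q lam)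
    (n : Fin N ⊕ Fin N) :
    IsSpectralPair q (psiPlus1 q) (psiMinus2 q) (zeta lam n) := by
  have hl := h.zeta_mem n
  have hev := isOpen_Dplus.mem_nhds hl
  refine ⟨?_, ?_, analyticAt_psiPlus1 hq hl, analyticAt_psiMinus2 hq hl, ?_, ?_, ?_⟩
  · filter_upwards [hev] with l hl using isLaxSolution_psiPlus1 hq (Dplus_subset hl)
  · filter_upwards [hev] with l hl using isLaxSolution_psiMinus2 hq (Dplus_subset hl)
  · exact jost_ne_zero hq atTop_le_cocompact
      (existsUnique_jostColumn_plus_one hq (Dplus_subset hl))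
  · exact jost_ne_zero hq atBot_le_cocompact
      (existsUnique_jostColumn_minus_two hq (Dplus_subset hl))
  · exact (h.s11_triple hq n).isBigO ((isSectorFun_s11 hq).analyticAt isOpen_Dplus hl)

theorem isSpectralPair_minus (hq : IsDecayingSolution q) (h : HasTripleZeros q lam)
    (n : Fin N ⊕ Fin N) :
    IsSpectralPair q (psiPlus2 q) (psiMinus1 q) (conj (zeta lam n)) := by
  have hl := conj_mem_Dminus.2 (h.zeta_mem n)
  have hev := isOpen_Dminus.mem_nhds hl
  refine ⟨?_, ?_, analyticAt_psiPlus2 hq hl, analyticAt_psiMinus1 hq hl, ?_, ?_, ?_⟩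
  · filter_upwards [hev] with l hl using isLaxSolution_psiPlus2 hq (Dminus_subset hl)
  · filter_upwards [hev] with l hl using isLaxSolution_psiMinus1 hq (Dminus_subset hl)
  · exact jost_ne_zero hq atTop_le_cocompact
      (existsUnique_jostColumn_plus_two hq (Dminus_subset hl))
  · exact jost_ne_zero hq atBot_le_cocompact
      (existsUnique_jostColumn_minus_one hq (Dminus_subset hl))
  · refine ((h.s22_triple hq n).isBigO ((isSectorFun_s22 hq).analyticAt isOpen_Dminus
      hl)).neg_left.congr_left fun l => ?_
    simp only [s22, detCols_eq]
    ring

theorem isNorming_iff {b d h : ℂ → ℂ} :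
    IsNorming q lam b d h ↔ ∀ n,
      IsNormingAt (psiPlus1 q) (psiMinus2 q) (b (zeta lam n)) (d (zeta lam n)) (h (zeta lam n))
        (zeta lam n) ∧
      IsNormingAt (psiPlus2 q) (psiMinus1 q) (b (conj (zeta lam n))) (d (conj (zeta lam n)))
        (h (conj (zeta lam n))) (conj (zeta lam n)) := by
  refine ⟨fun H n => ⟨⟨fun x t => H.b_plus n x t _ rfl, fun x t => H.d_plus n x t _ rfl,
    fun x t => H.h_plus n x t _ rfl⟩, ⟨fun x t => H.b_minus n x t _ rfl,
    fun x t => H.d_minus n x t _ rfl, fun x t => H.h_minus n x t _ rfl⟩⟩, fun H => ?_⟩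
  refine ⟨?_, ?_, ?_, ?_, ?_, ?_⟩ <;> rintro n x t _ rfl
  exacts [(H n).1.zero x t, (H n).2.zero x t, (H n).1.one x t, (H n).2.one x t, (H n).1.two x t,
    (H n).2.two x t]

theorem exists_isNorming (hq : IsDecayingSolution q) (hz : HasTripleZeros q lam) :
    ∃ b d h, IsNorming q lam b d h := by
  have key : ∀ l₀ : ℂ, ∃ b d h : ℂ,
      (∀ n, l₀ = zeta lam n → IsNormingAt (psiPlus1 q) (psiMinus2 q) b d h l₀) ∧
      ∀ n, l₀ = conj (zeta lam n) → IsNormingAt (psiPlus2 q) (psiMinus1 q) b d h l₀ := by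
    intro l₀
    have hne : ∀ n m, zeta lam n ≠ conj (zeta lam m) := fun n m =>
      (conj_ne_of_Dplus hz.zeta_mem m n).symm
    by_cases h1 : ∃ n, l₀ = zeta lam n
    · obtain ⟨n, rfl⟩ := h1
      obtain ⟨b, d, h, H⟩ := (isSpectralPair_plus hq hz n).exists_isNormingAt hq
      exact ⟨b, d, h, fun _ _ => H, fun m e => absurd e (hne n m)⟩
    · by_cases h2 : ∃ n, l₀ = conj (zeta lam n)
      · obtain ⟨n, rfl⟩ := h2
        obtain ⟨b, d, h, H⟩ := (isSpectralPair_minus hq hz n).exists_isNormingAt hq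
        exact ⟨b, d, h, fun m e => absurd e.symm (hne m n), fun _ _ => H⟩
      · exact ⟨0, 0, 0, fun n e => absurd ⟨n, e⟩ h1, fun n e => absurd ⟨n, e⟩ h2⟩
  choose b d h H using key
  exact ⟨b, d, h, isNorming_iff.2 fun n => ⟨(H _).1 n rfl, (H _).2 n rfl⟩⟩

end Norming

/-! ### The Jost columns solve the Riemann-Hilbert problem -/

theorem contour_subset_sectorMinus {l : ℂ} (hl : l ∈ contour) : l ∈ sectorMinus :=
  (mem_contour_iff.1 hl).le

theorem contour_subset_sectorPlus {l : ℂ} (hl : l ∈ contour) : l ∈ sectorPlus :=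
  (mem_contour_iff.1 hl).ge

theorem mem_contour_of_sectors {l : ℂ} (h₁ : l ∈ sectorMinus) (h₂ : l ∈ sectorPlus) :
    l ∈ contour := mem_contour_iff.2 (le_antisymm h₁ h₂)

theorem isClosed_sectorPlus : IsClosed sectorPlus :=
  isClosed_le continuous_const (by fun_prop)

theorem sectorMinus_union_sectorPlus : sectorMinus ∪ sectorPlus = Set.univ :=
  Set.eq_univ_of_forall fun l => le_total (l.re * l.im) 0

theorem detCols_psiMinus (hq : IsDecayingSolution q) {l : ℂ} (hl : l ∈ contour) (x t : ℝ) :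
    detCols (psiMinus1 q l x t) (psiMinus2 q l x t) = 1 := by
  have h₁ := contour_subset_sectorMinus hl
  have h₂ := contour_subset_sectorPlus hl
  have hL₁ := isLaxSolution_psiMinus1 hq h₁
  have hL₂ := isLaxSolution_psiMinus2 hq h₂
  have t₁ := tendsto_pi_nhds.1 (isJostColumn_jost (existsUnique_jostColumn_minus_one hq h₁ t)).2
  have t₂ := tendsto_pi_nhds.1 (isJostColumn_jost (existsUnique_jostColumn_minus_two hq h₂ t)).2
  have h := ((t₁ 0).mul (t₂ 1)).sub ((t₂ 0).mul (t₁ 1))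
  refine tendsto_nhds_unique (f := fun _ : ℝ => detCols (psiMinus1 q l x t) (psiMinus2 q l x t))
    (l := atBot) tendsto_const_nhds ?_
  have e : (Pi.single (M := fun _ => ℂ) (0 : Fin 2) 1 0) * (Pi.single (M := fun _ => ℂ) (1 : Fin 2) 1 1) -
      (Pi.single (M := fun _ => ℂ) (1 : Fin 2) 1 0) * (Pi.single (M := fun _ => ℂ) (0 : Fin 2) 1 1)
      = (1 : ℂ) := by simp
  rw [e] at h
  refine h.congr fun y => ?_
  rw [hL₁.detCols_eq hL₂ x t, ← hL₁.detCols_eq hL₂ y t, detCols_eq, psiMinus1, psiMinus2]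
  simp only [sigma3_zero, sigma3_one, mul_neg, mul_one, neg_neg, Pi.smul_apply, smul_eq_mul]
  linear_combination (jost q atBot 0 l y t 0 * jost q atBot 1 l y t 1 -
    jost q atBot 1 l y t 0 * jost q atBot 0 l y t 1) * exp_mul_exp_neg (I * theta l y t)

/-- Without reflection `ψ₊₁ = s₁₁ ψ₋₁` on the contour. -/
theorem colPlus1_eq_smul (hq : IsDecayingSolution q) (hns : NoSpectralSingularity q)
    (hr : Reflectionless q) {l : ℂ} (hl : l ∈ contour) (x t : ℝ) :
    colPlus1 q x t l = s11 q l • colMinus1 q x t l := by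
  have h₁ := contour_subset_sectorMinus hl
  have h₂ := contour_subset_sectorPlus hl
  have hd := detCols_psiMinus hq hl x t
  have h0 : s21 q l = 0 := (div_eq_zero_iff.1 (hr l hl).1).resolve_right (hns l hl).1
  rw [s21, ← (isLaxSolution_psiMinus1 hq h₁).detCols_eq (isLaxSolution_psiPlus1 hq h₂) x t] at h0
  have hs : s11 q l = _ :=
    ((isLaxSolution_psiPlus1 hq h₂).detCols_eq (isLaxSolution_psiMinus2 hq h₂) x t).symm
  rw [colPlus1, colMinus1, smul_comm, hs]
  congr 1
  simp only [detCols_eq] at h0 hd ⊢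
  funext i
  fin_cases i
  · simp only [Fin.zero_eta, Pi.smul_apply, smul_eq_mul]
    linear_combination (-psiPlus1 q l x t 0) * hd + psiMinus2 q l x t 0 * h0
  · simp only [Fin.mk_one, Pi.smul_apply, smul_eq_mul]
    linear_combination (-psiPlus1 q l x t 1) * hd + psiMinus2 q l x t 1 * h0

/-- Without reflection `ψ₊₂ = s₂₂ ψ₋₂` on the contour. -/
theorem colPlus2_eq_smul (hq : IsDecayingSolution q) (hns : NoSpectralSingularity q)
    (hr : Reflectionless q) {l : ℂ} (hl : l ∈ contour) (x t : ℝ) :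
    colPlus2 q x t l = s22 q l • colMinus2 q x t l := by
  have h₁ := contour_subset_sectorMinus hl
  have h₂ := contour_subset_sectorPlus hl
  have hd := detCols_psiMinus hq hl x t
  have h0 : s12 q l = 0 := (div_eq_zero_iff.1 (hr l hl).2).resolve_right (hns l hl).2
  rw [s12, ← (isLaxSolution_psiPlus2 hq h₁).detCols_eq (isLaxSolution_psiMinus2 hq h₂) x t] at h0
  have hs : s22 q l = _ :=
    ((isLaxSolution_psiMinus1 hq h₁).detCols_eq (isLaxSolution_psiPlus2 hq h₁) x t).symm
  rw [colPlus2, colMinus2, smul_comm, hs]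
  congr 1
  simp only [detCols_eq] at h0 hd ⊢
  funext i
  fin_cases i
  · simp only [Fin.zero_eta, Pi.smul_apply, smul_eq_mul]
    linear_combination (-psiPlus2 q l x t 0) * hd + psiMinus1 q l x t 0 * h0
  · simp only [Fin.mk_one, Pi.smul_apply, smul_eq_mul]
    linear_combination (-psiPlus2 q l x t 1) * hd + psiMinus1 q l x t 1 * h0

section Glue

variable {f g₁ g₂ : ℂ → ℂ}

theorem continuousAt_of_sectors {l : ℂ} (e₁ : ∀ z ∈ sectorMinus, f z = g₁ z)
    (e₂ : ∀ z ∈ sectorPlus, f z = g₂ z)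
    (h₁ : l ∈ sectorMinus → ContinuousWithinAt g₁ sectorMinus l)
    (h₂ : l ∈ sectorPlus → ContinuousWithinAt g₂ sectorPlus l) : ContinuousAt f l := by
  rw [← continuousWithinAt_univ, ← sectorMinus_union_sectorPlus, continuousWithinAt_union]
  constructor
  · by_cases hl : l ∈ sectorMinus
    · exact (h₁ hl).congr e₁ (e₁ l hl)
    · exact continuousWithinAt_of_notMem_closure (by rwa [isClosed_sectorMinus.closure_eq])
  · by_cases hl : l ∈ sectorPlus
    · exact (h₂ hl).congr e₂ (e₂ l hl)
    · exact continuousWithinAt_of_notMem_closure (by rwa [isClosed_sectorPlus.closure_eq])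

theorem differentiableAt_of_sectors {l : ℂ} (hl : l ∉ contour)
    (e₁ : ∀ z ∈ sectorMinus, f z = g₁ z) (e₂ : ∀ z ∈ sectorPlus, f z = g₂ z)
    (h₁ : l ∈ Dminus → DifferentiableAt ℂ g₁ l) (h₂ : l ∈ Dplus → DifferentiableAt ℂ g₂ l) :
    DifferentiableAt ℂ f l := by
  rw [mem_contour_iff] at hl
  rcases lt_or_gt_of_ne hl with h | h
  · refine (h₁ h).congr_of_eventuallyEq ?_
    filter_upwards [isOpen_Dminus.mem_nhds h] with z hz using e₁ z (Dminus_subset hz)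
  · refine (h₂ h).congr_of_eventuallyEq ?_
    filter_upwards [isOpen_Dplus.mem_nhds h] with z hz using e₂ z (Dplus_subset hz)

theorem isBigO_of_sectors (e₁ : ∀ z ∈ sectorMinus, f z = g₁ z)
    (e₂ : ∀ z ∈ sectorPlus, f z = g₂ z)
    (h₁ : g₁ =O[cocompact ℂ ⊓ 𝓟 sectorMinus] fun _ => (1 : ℂ))
    (h₂ : g₂ =O[cocompact ℂ ⊓ 𝓟 sectorPlus] fun _ => (1 : ℂ)) :
    f =O[cocompact ℂ] fun _ => (1 : ℂ) := by
  have e : cocompact ℂ = (cocompact ℂ ⊓ 𝓟 sectorMinus) ⊔ (cocompact ℂ ⊓ 𝓟 sectorPlus) := by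
    rw [← inf_sup_left, sup_principal, sectorMinus_union_sectorPlus, principal_univ, inf_top_eq]
  rw [e]
  refine Asymptotics.IsBigO.sup (h₁.congr' ?_ EventuallyEq.rfl) (h₂.congr' ?_ EventuallyEq.rfl)
  · filter_upwards [mem_inf_of_right (mem_principal_self sectorMinus)] with z hz
      using (e₁ z hz).symm
  · filter_upwards [mem_inf_of_right (mem_principal_self sectorPlus)] with z hz
      using (e₂ z hz).symm

end Glue

open Classical in
/-- The first column of the Riemann-Hilbert matrix: `e^{-iθ} ψ₋₁` in the closure of `D⁻` and
`e^{-iθ} ψ₊₁ / s₁₁` in `D⁺`. -/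
noncomputable def rhFst (q : ℝ → ℝ → ℂ) (x t : ℝ) (l : ℂ) : Fin 2 → ℂ :=
  if l ∈ sectorMinus then colMinus1 q x t l else (s11 q l)⁻¹ • colPlus1 q x t l

open Classical in
/-- The second column of the Riemann-Hilbert matrix: `e^{iθ} ψ₋₂` in the closure of `D⁺` and
`e^{iθ} ψ₊₂ / s₂₂` in `D⁻`. -/
noncomputable def rhSnd (q : ℝ → ℝ → ℂ) (x t : ℝ) (l : ℂ) : Fin 2 → ℂ :=
  if l ∈ sectorPlus then colMinus2 q x t l else (s22 q l)⁻¹ • colPlus2 q x t l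

theorem rhFst_of_minus {l : ℂ} (hl : l ∈ sectorMinus) (x t : ℝ) :
    rhFst q x t l = colMinus1 q x t l := if_pos hl

theorem rhSnd_of_plus {l : ℂ} (hl : l ∈ sectorPlus) (x t : ℝ) :
    rhSnd q x t l = colMinus2 q x t l := if_pos hl

theorem rhFst_of_plus (hq : IsDecayingSolution q) (hns : NoSpectralSingularity q)
    (hr : Reflectionless q) {l : ℂ} (hl : l ∈ sectorPlus) (x t : ℝ) :
    rhFst q x t l = (s11 q l)⁻¹ • colPlus1 q x t l := by
  by_cases h : l ∈ sectorMinus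
  · have hc := mem_contour_of_sectors h hl
    rw [rhFst_of_minus h, colPlus1_eq_smul hq hns hr hc, smul_smul,
      inv_mul_cancel₀ (hns l hc).1, one_smul]
  · exact if_neg h

theorem rhSnd_of_minus (hq : IsDecayingSolution q) (hns : NoSpectralSingularity q)
    (hr : Reflectionless q) {l : ℂ} (hl : l ∈ sectorMinus) (x t : ℝ) :
    rhSnd q x t l = (s22 q l)⁻¹ • colPlus2 q x t l := by
  by_cases h : l ∈ sectorPlus
  · have hc := mem_contour_of_sectors hl h
    rw [rhSnd_of_plus h, colPlus2_eq_smul hq hns hr hc, smul_smul,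
      inv_mul_cancel₀ (hns l hc).2, one_smul]
  · exact if_neg h

theorem isBigO_inv_of_tendsto {F : Filter ℂ} {s : ℂ → ℂ} {c : ℂ} (h : Tendsto s F (𝓝 c))
    (hc : c ≠ 0) : (fun l => (s l)⁻¹) =O[F] fun _ => (1 : ℂ) :=
  (h.inv₀ hc).isBigO_one ℂ

theorem iteratedDeriv_mul_theta (c l : ℂ) (x t : ℝ) :
    iteratedDeriv 1 (fun l => c * theta l x t) l = c * theta1 l x t ∧
      iteratedDeriv 2 (fun l => c * theta l x t) l = c * theta2 l x t := by
  rw [theta1, theta2, ← iteratedDeriv_one]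
  exact ⟨iteratedDeriv_const_mul_field _ _, iteratedDeriv_const_mul_field _ _⟩

variable {N : ℕ} {lam : Fin N → ℂ}

theorem isRHSolution (hq : IsDecayingSolution q) (hns : NoSpectralSingularity q)
    (hr : Reflectionless q) (hz : HasTripleZeros q lam) {b d h : ℂ → ℂ}
    (H : IsNorming q lam b d h) (x t : ℝ) :
    IsRHSolution (tA q b) (tB q b d) (tC q b d h) (zeta lam) x t (rhFst q x t) (rhSnd q x t) := by
  have e11 : ∀ i, ∀ l ∈ sectorMinus, rhFst q x t l i = colMinus1 q x t l i := fun i l hl => by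
    rw [rhFst_of_minus hl]
  have e12 : ∀ i, ∀ l ∈ sectorPlus, rhFst q x t l i = (s11 q l)⁻¹ * colPlus1 q x t l i :=
    fun i l hl => by rw [rhFst_of_plus hq hns hr hl]; rfl
  have e21 : ∀ i, ∀ l ∈ sectorMinus, rhSnd q x t l i = (s22 q l)⁻¹ * colPlus2 q x t l i :=
    fun i l hl => by rw [rhSnd_of_minus hq hns hr hl]; rfl
  have e22 : ∀ i, ∀ l ∈ sectorPlus, rhSnd q x t l i = colMinus2 q x t l i := fun i l hl => by
    rw [rhSnd_of_plus hl]
  have s1 : ∀ l ∈ sectorPlus, (∀ n, l ≠ zeta lam n) → s11 q l ≠ 0 := fun l hl h h0 => by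
    obtain ⟨n, hn⟩ := (hz.s11_eq_zero_iff hq hns hl).1 h0
    exact h n hn
  have s2 : ∀ l ∈ sectorMinus, (∀ n, l ≠ conj (zeta lam n)) → s22 q l ≠ 0 := fun l hl h h0 => by
    obtain ⟨n, hn⟩ := (hz.s22_eq_zero_iff hq hns hl).1 h0
    exact h n hn
  have hne : ∀ {w : Fin N ⊕ Fin N → ℂ} {l : ℂ}, l ∈ (Set.range w)ᶜ → ∀ n, l ≠ w n :=
    fun hl n h => hl ⟨n, h.symm⟩
  have hS1 := isSectorFun_s11 hq
  have hS2 := isSectorFun_s22 hq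
  refine ⟨fun i l hl => ?_, fun i l hl => ?_, fun i l hl hl' => ?_, fun i l hl hl' => ?_,
    fun i n => ?_, fun i n => ?_, fun l hl hl' => ?_, fun i => ?_, fun i => ?_⟩
  · exact (continuousAt_of_sectors (e11 i) (e12 i)
      (fun h => (isSectorFun_colMinus1 hq x t i).cont l h)
      (fun h => ((hS1.cont l h).inv₀ (s1 l h (hne hl))).mul
        ((isSectorFun_colPlus1 hq x t i).cont l h))).continuousWithinAt
  · exact (continuousAt_of_sectors (e21 i) (e22 i)
      (fun h => ((hS2.cont l h).inv₀ (s2 l h (hne hl))).mul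
        ((isSectorFun_colPlus2 hq x t i).cont l h))
      (fun h => (isSectorFun_colMinus2 hq x t i).cont l h)).continuousWithinAt
  · exact differentiableAt_of_sectors hl (e11 i) (e12 i)
      (fun h => (isSectorFun_colMinus1 hq x t i).diff l h)
      (fun h => ((hS1.diff l h).inv (s1 l (Dplus_subset h) hl')).mul
        ((isSectorFun_colPlus1 hq x t i).diff l h))
  · exact differentiableAt_of_sectors hl (e21 i) (e22 i)
      (fun h => ((hS2.diff l h).inv (s2 l (Dminus_subset h) hl')).mul
        ((isSectorFun_colPlus2 hq x t i).diff l h))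
      (fun h => (isSectorFun_colMinus2 hq x t i).diff l h)
  · have hl := hz.zeta_mem n
    obtain ⟨t1, t2⟩ := iteratedDeriv_mul_theta (-I) (zeta lam n) x t
    have key := (isSpectralPair_plus hq hz n).div_sub_poleCoef_isBigO ((isNorming_iff.1 H n).1)
      (hS1.analyticAt isOpen_Dplus hl) (hz.s11_triple hq n) (φ := fun l => -I * theta l x t)
      (analyticAt_const.mul (analyticAt_theta _ x t)) (A := tA q b (zeta lam n))
      (B := tB q b d (zeta lam n)) (C := tC q b d h (zeta lam n)) (by simp only [tA, sDer, if_pos hl])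
      (by simp only [tB, sDer, if_pos hl]) (by simp only [tC, sDer, if_pos hl]) x t i
    rw [t1, t2] at key
    refine key.congr' ?_ EventuallyEq.rfl
    filter_upwards [nhdsWithin_le_nhds (isOpen_Dplus.mem_nhds hl)] with l hl'
    rw [e12 i l (Dplus_subset hl'), e22 i l (Dplus_subset hl'), colPlus1, colMinus2, dF, fF]
    simp only [Pi.smul_apply, smul_eq_mul, neg_mul, neg_neg]
    rw [show 2 * -(I * theta (zeta lam n) x t) = -(2 * I * theta (zeta lam n) x t) by ring,
      show tB q b d (zeta lam n) + 2 * -(I * theta1 (zeta lam n) x t) =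
        tB q b d (zeta lam n) - 2 * I * theta1 (zeta lam n) x t by ring,
      show tC q b d h (zeta lam n) + (-(I * theta2 (zeta lam n) x t) +
          2 * (-(I * theta1 (zeta lam n) x t)) ^ 2) +
          2 * -(I * theta1 (zeta lam n) x t) * tB q b d (zeta lam n) =
        tC q b d h (zeta lam n) - 2 * theta1 (zeta lam n) x t ^ 2 - I * theta2 (zeta lam n) x t -
          2 * I * theta1 (zeta lam n) x t * tB q b d (zeta lam n) by
        linear_combination (2 * theta1 (zeta lam n) x t ^ 2) * I_sq]
    ring
  · have hl := conj_mem_Dminus.2 (hz.zeta_mem n)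
    have hl0 : conj (zeta lam n) ∉ Dplus := fun h => ne_of_Dplus_of_Dminus h hl rfl
    obtain ⟨t1, t2⟩ := iteratedDeriv_mul_theta I (conj (zeta lam n)) x t
    have key := (isSpectralPair_minus hq hz n).div_sub_poleCoef_isBigO ((isNorming_iff.1 H n).2)
      (hS2.analyticAt isOpen_Dminus hl) (hz.s22_triple hq n) (φ := fun l => I * theta l x t)
      (analyticAt_const.mul (analyticAt_theta _ x t)) (A := tA q b (conj (zeta lam n)))
      (B := tB q b d (conj (zeta lam n))) (C := tC q b d h (conj (zeta lam n)))
      (by simp only [tA, sDer, if_neg hl0]) (by simp only [tB, sDer, if_neg hl0])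
      (by simp only [tC, sDer, if_neg hl0]) x t i
    rw [t1, t2] at key
    refine key.congr' ?_ EventuallyEq.rfl
    filter_upwards [nhdsWithin_le_nhds (isOpen_Dminus.mem_nhds hl)] with l hl'
    rw [e11 i l (Dminus_subset hl'), e21 i l (Dminus_subset hl'), colPlus2, colMinus1, dHat, fHat]
    simp only [Pi.smul_apply, smul_eq_mul]
    rw [show 2 * (I * theta (conj (zeta lam n)) x t) = 2 * I * theta (conj (zeta lam n)) x t by ring,
      show tB q b d (conj (zeta lam n)) + 2 * (I * theta1 (conj (zeta lam n)) x t) =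
        tB q b d (conj (zeta lam n)) + 2 * I * theta1 (conj (zeta lam n)) x t by ring,
      show tC q b d h (conj (zeta lam n)) + (I * theta2 (conj (zeta lam n)) x t +
          2 * (I * theta1 (conj (zeta lam n)) x t) ^ 2) +
          2 * (I * theta1 (conj (zeta lam n)) x t) * tB q b d (conj (zeta lam n)) =
        tC q b d h (conj (zeta lam n)) - 2 * theta1 (conj (zeta lam n)) x t ^ 2 +
          I * theta2 (conj (zeta lam n)) x t +
          2 * I * theta1 (conj (zeta lam n)) x t * tB q b d (conj (zeta lam n)) by
        linear_combination (2 * theta1 (conj (zeta lam n)) x t ^ 2) * I_sq]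
    ring
  · rcases le_total (l.re * l.im) 0 with hs | hs
    · rw [e11 0 l hs, e11 1 l hs, e21 0 l hs, e21 1 l hs]
      have h0 := s2 l hs hl'
      have := s22_eq hq hs x t
      rw [detCols_eq] at this
      field_simp
      linear_combination -this
    · rw [e12 0 l hs, e12 1 l hs, e22 0 l hs, e22 1 l hs]
      have h0 := s1 l hs hl
      have := s11_eq hq hs x t
      rw [detCols_eq] at this
      field_simp
      linear_combination -this
  · obtain ⟨c, hc, hlim⟩ := tendsto_s11 hq
    refine isBigO_of_sectors (e11 i) (e12 i) (isSectorFun_colMinus1 hq x t i).bdd ?_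
    simpa using (isBigO_inv_of_tendsto hlim hc).mul (isSectorFun_colPlus1 hq x t i).bdd
  · obtain ⟨c, hc, hlim⟩ := tendsto_s22 hq
    refine isBigO_of_sectors (e21 i) (e22 i) ?_ (isSectorFun_colMinus2 hq x t i).bdd
    simpa using (isBigO_inv_of_tendsto hlim hc).mul (isSectorFun_colPlus2 hq x t i).bdd

theorem neBot_cocompact_inf {S : Set ℂ} (hS : contour ⊆ S) : (cocompact ℂ ⊓ 𝓟 S).NeBot := by
  have h : Tendsto (fun x : ℝ => (x : ℂ)) atTop (cocompact ℂ ⊓ 𝓟 S) := by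
    refine tendsto_inf.2 ⟨?_, tendsto_principal.2 (Eventually.of_forall fun x => hS ?_)⟩
    · rw [← Metric.cobounded_eq_cocompact, ← tendsto_norm_atTop_iff_cobounded]
      simpa using tendsto_abs_atTop_atTop
    · exact Or.inl (ofReal_im x)
  exact h.neBot

end TOFKN

theorem mainTheorem2 (N : ℕ) (q : ℝ → ℝ → ℂ) (lam : Fin N → ℂ)
    (hq : TOFKN.IsDecayingSolution q)
    (hns : TOFKN.NoSpectralSingularity q)
    (hrefl : TOFKN.Reflectionless q)
    (hzero : TOFKN.HasTripleZeros q lam) :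
    (∃ b d h : ℂ → ℂ, TOFKN.IsNorming q lam b d h) ∧
    ∀ b d h : ℂ → ℂ, TOFKN.IsNorming q lam b d h →
      ∀ x t : ℝ,
        (1 - TOFKN.matG (TOFKN.tA q b) (TOFKN.tB q b d) (TOFKN.tC q b d h)
          (TOFKN.zeta lam) x t).det ≠ 0 ∧
        q x t = 2 * Complex.I * Complex.exp (2 * Complex.I * (TOFKN.nuMinus q x t : ℂ)) *
          ((TOFKN.matR (TOFKN.tA q b) (TOFKN.tB q b d) (TOFKN.tC q b d h)
              (TOFKN.zeta lam) x t).det /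
            (1 - TOFKN.matG (TOFKN.tA q b) (TOFKN.tB q b d) (TOFKN.tC q b d h)
              (TOFKN.zeta lam) x t).det) := by
  refine ⟨TOFKN.exists_isNorming hq hzero, fun b d h H x t => ?_⟩
  have hRH := TOFKN.isRHSolution hq hns hrefl hzero H x t
  have := TOFKN.neBot_cocompact_inf fun l => TOFKN.contour_subset_sectorMinus (l := l)
  have := TOFKN.neBot_cocompact_inf fun l => TOFKN.contour_subset_sectorPlus (l := l)
  have hκ : Tendsto (fun l => l * TOFKN.rhSnd q x t l 0) (cocompact ℂ ⊓ 𝓟 TOFKN.sectorPlus)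
      (𝓝 (I / 2 * q x t * exp (-(I * TOFKN.nuMinus q x t)))) := by
    refine (TOFKN.tendsto_mul_colMinus2 hq x t).congr' ?_
    filter_upwards [mem_inf_of_right (mem_principal_self TOFKN.sectorPlus)] with l hl
    rw [TOFKN.rhSnd_of_plus hl]
  have hc : Tendsto (fun l => TOFKN.rhFst q x t l 0) (cocompact ℂ ⊓ 𝓟 TOFKN.sectorMinus)
      (𝓝 (exp (I * TOFKN.nuMinus q x t))) := by
    refine (TOFKN.tendsto_colMinus1 hq x t).1.congr' ?_
    filter_upwards [mem_inf_of_right (mem_principal_self TOFKN.sectorMinus)] with l hl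
    rw [TOFKN.rhFst_of_minus hl]
  obtain ⟨hdet, hR⟩ := hRH.det_ne_zero_and_det_matR hzero.zeta_mem hzero.injective_zeta
    inf_le_left inf_le_left (exp_ne_zero _) hc
    (TOFKN.tendsto_zero_of_tendsto_mul inf_le_left hκ) hκ
  refine ⟨hdet, ?_⟩
  rw [hR]
  have e : exp (2 * I * TOFKN.nuMinus q x t) * exp (-(I * TOFKN.nuMinus q x t)) =
      exp (I * TOFKN.nuMinus q x t) := by
    rw [← exp_add]; congr 1; ring
  have hne := exp_ne_zero (I * TOFKN.nuMinus q x t)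
  field_simp
  linear_combination (I ^ 2 * q x t) * e + (exp (I * TOFKN.nuMinus q x t) * q x t) * I_sq
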